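/- Let $\lambda:\mathbb{Z}\to\mathbb{C}$ and $w:\mathbb{Z}\to\mathbb{C}\setminus\{0\}$ satisfy $w\in\ell^2(\mathbb{Z})$ and $\lambda\in\ell^p(\mathbb{Z})$ for some integer $p\ge 1$. **Operators.** For a complex sequence $x$ put $(\mathcal{J}x)_n=w_{n-1}x_{n-1}+\lambda_nx_n+w_nx_{n+1}$, $n\in\mathbb{Z}$. Let $J_0$ be the restriction of $\mathcal{J}$ to the linear span of the standard basis of $\ell^2(\mathbb{Z})$, let $J_{\min}$ be its closure, and let $J_{\max}x=\mathcal{J}x$ with domain $\{x\in\ell^2(\mathbb{Z}) : \mathcal{J}x\in\ell^2(\mathbb{Z})\}$. **Functions.** For $x:\mathbb{Z}\to\mathbb{C}$ with $\sum_k|x_kx_{k+1}|<\infty$ put $$\mathfrak{F}(x)=1+\sum_{m=1}^{\infty}(-1)^m\sum_{k_1=-\infty}^{\infty}\ \sum_{k_2=k_1+2}^{\infty}\cdots\sum_{k_m=k_{m-1}+2}^{\infty}\ \prod_{j=1}^{m}x_{k_j}x_{k_j+1},$$ and let $\mathfrak{F}(\{x_k\}_{k=n}^{\infty})$ be the value of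 $\mathfrak F$ at the sequence obtained from $x$ by replacing all entries with index below $n$ by $0$. Let $\gamma:\mathbb{Z}\to\mathbb{C}$ be any sequence with $\gamma_n\gamma_{n+1}=w_n$ for all $n$. For $z\in\mathbb{C}_0^\lambda:=\mathbb{C}\setminus\overline{\{\lambda_n : n\in\mathbb{Z}\}}$ put $$F_{\mathcal{J}}(z)=\mathfrak{F}\left(\left\{\frac{\gamma_n^2}{z-\lambda_n}\right\}_{n=-\infty}^{\infty}\right),\qquad f_n(z)=\mathcal{P}_n(z)\,\mathfrak{F}\left(\left\{\frac{\gamma_k^2}{\lambda_k-z}\right\}_{k=n+1}^{\infty}\right),$$ where $\mathcal{P}_n(z)=\prod_{k=1}^{n}\frac{w_{k-1}}{z-\lambda_k}$ for $n\ge0$ and $\mathcal{P}_n(z)=\prod_{k=n+1}^{0}\frac{z-\lambda_k}{w_{k-1}}$ for $n<0$. For $z\ne0$ let $$\Phi_p^{+}(z)=\prod_{n\ge1}E_p(\lambda_n/z),\quad \Phi_p^{-}(z)=\prod_{n\le0}E_p(\lambda_n/z),\quad \Phi_p=\Phi_p^-\Phi_p^+,\quad E_p(x)=(1-x)\exp\Big(\sum_{j=1}^{p-1}\frac{x^j}{j}\Big).$$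 Then the argument of $\mathfrak{F}$ in $F_{\mathcal J}(z)$ satisfies the summability condition for every $z\in\mathbb{C}_0^\lambda$, the products converge for every $z\neq 0$, and the functions $\tilde F_{\mathcal{J}}:=\Phi_pF_{\mathcal{J}}$ and $\tilde f_n:=\Phi_p^+f_n$ ($n\in\mathbb{Z}$), defined on $\mathbb{C}_0^\lambda$, extend (by taking limits at the removable singularities) to analytic functions on $\mathbb{C}\setminus\{0\}$, denoted by the same symbols. **Claim.** $J_0$ is closable, $J_{\min}=J_{\max}=:J$, and $$\operatorname{spec}(J)=\operatorname{spec}_p(J)\cup\{0\}=\{z\in\mathbb{C}\setminus\{0\} : \tilde F_{\mathcal{J}}(z)=0\}\cup\{0\},$$ where $\operatorname{spec}_p(J)$ is the set of eigenvalues of $J$. Moreover, every nonzero eigenvalue $z$ of $J$ is an isolated point of $\operatorname{spec}(J)$, and its algebraic multiplicity $\nu_a(z)$, i.e. the dimension of the range of the Riesz projection $-\frac{1}{2\pi i}\oint_{|\xi-z|=r}(J-\xi)^{-1}\,d\xi$ (for any $r>0$ such that the closed disc of radius $r$ about $z$ contains no other point of $\operatorname{spec}(J)$), is finite and equals the order of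 $z$ as a zero of $\tilde F_{\mathcal{J}}$. The derivatives $\tilde f(z),\tilde f'(z),\dots,\tilde f^{(\nu_a(z)-1)}(z)$ (taken entrywise, with $\tilde f(z)=\{\tilde f_n(z)\}_{n\in\mathbb{Z}}$) belong to $\ell^2(\mathbb{Z})$ and span the space of generalized eigenvectors $\{v : (J-z)^nv=0 \text{ for some } n\in\mathbb{N}\}$. -/

import Mathlib

open Filter Topology
open scoped ENNReal Real

noncomputable section

namespace DoublyInfiniteJacobi

/-! ### Closed operators on a complex Banach space: spectrum, Riesz projection, root vectors -/

section Operators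

variable {H : Type*} [NormedAddCommGroup H] [NormedSpace ℂ H]

/-- `R` is a bounded two-sided inverse of `A - z`. -/
def IsResolventAt (A : H →ₗ.[ℂ] H) (z : ℂ) (R : H →L[ℂ] H) : Prop :=
  (∀ y : H, ∃ h : R y ∈ A.domain, A ⟨R y, h⟩ - z • R y = y) ∧
    ∀ x : A.domain, R (A x - z • (x : H)) = x

/-- The resolvent set `ρ(A)`. -/
def resolventSet (A : H →ₗ.[ℂ] H) : Set ℂ :=
  {z | ∃ R : H →L[ℂ] H, IsResolventAt A z R}

/-- The spectrum `spec(A) = ℂ ∖ ρ(A)`. -/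
def spec (A : H →ₗ.[ℂ] H) : Set ℂ :=
  (resolventSet A)ᶜ

/-- The point spectrum `spec_p(A)`: the set of eigenvalues. -/
def pointSpec (A : H →ₗ.[ℂ] H) : Set ℂ :=
  {z | ∃ x : A.domain, (x : H) ≠ 0 ∧ A x = z • (x : H)}

/-- A bounded two-sided inverse of `A - z` is unique. -/
theorem IsResolventAt.unique {A : H →ₗ.[ℂ] H} {z : ℂ} {R S : H →L[ℂ] H}
    (hR : IsResolventAt A z R) (hS : IsResolventAt A z S) : R = S := by
  ext y
  obtain ⟨h, hy⟩ := hS.1 y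
  have h2 := hR.2 ⟨S y, h⟩
  rw [hy] at h2
  exact h2

open Classical in
/-- The resolvent `(A - z)⁻¹`, for `z ∈ ρ(A)` (and `0` elsewhere). -/
def resolvent (A : H →ₗ.[ℂ] H) (z : ℂ) : H →L[ℂ] H :=
  if h : z ∈ resolventSet A then h.choose else 0

/-- The closed disc of radius `r > 0` about `z` contains no point of `spec(A)` other than `z`. -/
def IsIsolatingRadius (A : H →ₗ.[ℂ] H) (z : ℂ) (r : ℝ) : Prop :=
  0 < r ∧ Metric.closedBall z r \ {z} ⊆ resolventSet A

/-- The Riesz spectral projection `-(2πi)⁻¹ ∮ (A - ξ)⁻¹ dξ` over the circle `|ξ - z| = r`. -/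
def rieszProjection (A : H →ₗ.[ℂ] H) (z : ℂ) (r : ℝ) : H →L[ℂ] H :=
  (-(2 * (π : ℂ) * Complex.I)⁻¹) • ∮ ξ in C(z, r), resolvent A ξ

/-- `Ker (A - z)^n`: a vector `v` lies in `Ker (A - z)^(n+1)` if and only if `v ∈ Dom A` and
`(A - z) v ∈ Ker (A - z)^n`. -/
def kerPow (A : H →ₗ.[ℂ] H) (z : ℂ) : ℕ → Submodule ℂ H
  | 0 => ⊥
  | n + 1 => ((kerPow A z n).comap (A.toFun - z • A.domain.subtype)).map A.domain.subtype

/-- The set of generalized eigenvectors, `{v | (A - z)^n v = 0 for some n}`. -/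
def generalizedEigenvectors (A : H →ₗ.[ℂ] H) (z : ℂ) : Set H :=
  {v | ∃ n : ℕ, v ∈ kerPow A z n}

end Operators

/-! ### The Jacobi operator on `ℓ²(ℤ)` -/

/-- The Hilbert space `ℓ²(ℤ)`. -/
abbrev L2Z : Type := lp (fun _ : ℤ => ℂ) 2

/-- The formal action `(𝒥x)_n = w_{n-1} x_{n-1} + λ_n x_n + w_n x_{n+1}` of the doubly infinite
Jacobi matrix on complex sequences. -/
def jacobiMatrix (w lam : ℤ → ℂ) : (ℤ → ℂ) →ₗ[ℂ] (ℤ → ℂ) where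
  toFun x n := w (n - 1) * x (n - 1) + lam n * x n + w n * x (n + 1)
  map_add' x y := by
    funext n
    simp only [Pi.add_apply]
    ring
  map_smul' c x := by
    funext n
    simp only [Pi.smul_apply, smul_eq_mul, RingHom.id_apply]
    ring

/-- The maximal operator: `Dom J_max = {x ∈ ℓ² | 𝒥x ∈ ℓ²}` and `J_max x = 𝒥x`. -/
def jacobiMax (w lam : ℤ → ℂ) : L2Z →ₗ.[ℂ] L2Z where
  domain :=
    { carrier := {x | Memℓp (jacobiMatrix w lam (x : ℤ → ℂ)) 2}
      add_mem' := by
        intro x y hx hy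
        simp only [Set.mem_ofPred_eq, lp.coeFn_add, map_add] at *
        exact hx.add hy
      zero_mem' := by
        simp only [Set.mem_ofPred_eq, lp.coeFn_zero, map_zero]
        exact zero_memℓp
      smul_mem' := by
        intro c x hx
        simp only [Set.mem_ofPred_eq, lp.coeFn_smul, map_smul] at *
        exact hx.const_smul c }
  toFun :=
    { toFun := fun x => ⟨jacobiMatrix w lam ((x : L2Z) : ℤ → ℂ), x.2⟩
      map_add' := by
        intro x y
        apply Subtype.ext
        exact map_add (jacobiMatrix w lam) ((x : L2Z) : ℤ → ℂ) ((y : L2Z) : ℤ → ℂ)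
      map_smul' := by
        intro c x
        apply Subtype.ext
        exact map_smul (jacobiMatrix w lam) c ((x : L2Z) : ℤ → ℂ) }

/-- The linear span of the standard basis vectors `e_n`, `n ∈ ℤ`, of `ℓ²(ℤ)`. -/
def finiteSequences : Submodule ℂ L2Z :=
  Submodule.span ℂ (Set.range fun n : ℤ => lp.single 2 n (1 : ℂ))

/-- The operator `J₀`, the restriction of `𝒥` to the span of the standard basis. -/
def jacobiZero (w lam : ℤ → ℂ) : L2Z →ₗ.[ℂ] L2Z :=
  (jacobiMax w lam).domRestrict finiteSequences

/-- The domain of `J₀` is the whole span of the standard basis. -/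
theorem jacobiZero_domain (w lam : ℤ → ℂ) : (jacobiZero w lam).domain = finiteSequences := by
  have h : finiteSequences ≤ (jacobiMax w lam).domain := by
    refine Submodule.span_le.2 ?_
    rintro _ ⟨m, rfl⟩
    change Memℓp (jacobiMatrix w lam (lp.single 2 m (1 : ℂ) : L2Z)) 2
    refine (memℓp_zero ?_).of_exponent_ge (zero_le (a := (2 : ℝ≥0∞)))
    refine Set.Finite.subset (Set.toFinite ({m - 1, m, m + 1} : Set ℤ)) ?_
    intro n hn
    by_contra hc
    simp only [Set.mem_insert_iff, Set.mem_singleton_iff, not_or] at hc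
    apply hn
    have h1 : n - 1 ≠ m := by omega
    have h2 : n + 1 ≠ m := by omega
    simp [jacobiMatrix, lp.single_apply, h1, h2, hc.2.1]
  exact inf_eq_left.2 h

/-- The minimal operator `J_min`: the closure of `J₀`. -/
def jacobiMin (w lam : ℤ → ℂ) : L2Z →ₗ.[ℂ] L2Z :=
  (jacobiZero w lam).closure

/-! ### The function `𝔉` -/

/-- `Dom 𝔉`: the sequences with `∑ |x_k x_{k+1}| < ∞`. -/
def DomF (x : ℤ → ℂ) : Prop :=
  Summable fun k : ℤ => ‖x k * x (k + 1)‖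

/-- The iterated sum
`∑_{k₁ ≥ n} ∑_{k₂ ≥ k₁ + 2} ⋯ ∑_{k_m ≥ k_{m-1} + 2} ∏_{j ≤ m} x_{k_j} x_{k_j + 1}`. -/
def nestedSum (x : ℤ → ℂ) : ℕ → ℤ → ℂ
  | 0, _ => 1
  | m + 1, n => ∑' j : ℕ, x (n + j) * x (n + j + 1) * nestedSum x m (n + j + 2)

/-- `𝔉(x) = 1 + ∑_{m ≥ 1} (-1)^m ∑_{k₁ ∈ ℤ} ∑_{k₂ ≥ k₁ + 2} ⋯ ∏_j x_{k_j} x_{k_j + 1}`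
(the summation variable `m` of the code is shifted by one). -/
def frakF (x : ℤ → ℂ) : ℂ :=
  1 + ∑' m : ℕ, (-1) ^ (m + 1) * ∑' k : ℤ, x k * x (k + 1) * nestedSum x m (k + 2)

/-- `𝔉({x_k}_{k = n}^∞)`: the entries with index below `n` are replaced by `0`. -/
def frakFFrom (x : ℤ → ℂ) (n : ℤ) : ℂ :=
  frakF fun k => if n ≤ k then x k else 0

/-! ### Characteristic function, the solution `f`, and their regularizations -/

/-- `ℂ₀^λ`, the complement of the closure of the range of `λ`. -/
def regularSet (lam : ℤ → ℂ) : Set ℂ :=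
  (closure (Set.range lam))ᶜ

/-- The characteristic function `F_𝒥(z) = 𝔉({γ_n² / (z - λ_n)})`, for `z ∈ ℂ₀^λ`. -/
def charFn (lam γ : ℤ → ℂ) (z : ℂ) : ℂ :=
  frakF fun n => γ n ^ 2 / (z - lam n)

/-- `𝒫_n(z)`, for `z ∈ ℂ₀^λ`. -/
def weightP (w lam : ℤ → ℂ) (n : ℤ) (z : ℂ) : ℂ :=
  if 0 ≤ n then ∏ k ∈ Finset.Icc 1 n, w (k - 1) / (z - lam k)
  else ∏ k ∈ Finset.Icc (n + 1) 0, (z - lam k) / w (k - 1)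

/-- `f_n(z) = 𝒫_n(z) 𝔉({γ_k² / (λ_k - z)}_{k = n+1}^∞)`, for `z ∈ ℂ₀^λ`. -/
def solF (w lam γ : ℤ → ℂ) (n : ℤ) (z : ℂ) : ℂ :=
  weightP w lam n z * frakFFrom (fun k => γ k ^ 2 / (lam k - z)) (n + 1)

/-- The Weierstrass elementary factor `(1 - x) exp(∑_{j=1}^{p-1} x^j / j)`. -/
def elemFactor (p : ℕ) (x : ℂ) : ℂ :=
  (1 - x) * Complex.exp (∑ j ∈ Finset.Ico 1 p, x ^ j / (j : ℂ))

/-- `Φ_p⁺(z)`, the product over the indices `n ≥ 1`. -/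
def PhiPlus (lam : ℤ → ℂ) (p : ℕ) (z : ℂ) : ℂ :=
  ∏' n : ℕ, elemFactor p (lam ((n : ℤ) + 1) / z)

/-- `Φ_p⁻(z)`, the product over the indices `n ≤ 0`. -/
def PhiMinus (lam : ℤ → ℂ) (p : ℕ) (z : ℂ) : ℂ :=
  ∏' n : ℕ, elemFactor p (lam (-(n : ℤ)) / z)

/-- `Φ_p(z) = Φ_p⁻(z) Φ_p⁺(z)`. -/
def Phi (lam : ℤ → ℂ) (p : ℕ) (z : ℂ) : ℂ :=
  PhiMinus lam p z * PhiPlus lam p z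

/-- The regularized characteristic function `F̃_𝒥 = Φ_p F_𝒥`, whose removable singularities at the
nonzero values of `λ` are filled in by taking the limit. -/
def regCharFn (lam γ : ℤ → ℂ) (p : ℕ) (z : ℂ) : ℂ :=
  limUnder (𝓝[≠] z) fun u => Phi lam p u * charFn lam γ u

/-- The regularized solution `f̃_n = Φ_p⁺ f_n`, whose removable singularities at the nonzero values
of `λ` are filled in by taking the limit. -/
def regSolF (w lam γ : ℤ → ℂ) (p : ℕ) (n : ℤ) (z : ℂ) : ℂ :=
  limUnder (𝓝[≠] z) fun u => PhiPlus lam p u * solF w lam γ n u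

end DoublyInfiniteJacobi

end

open Filter Topology
open scoped ENNReal Real
noncomputable section

/-! Since `w` and `lam` tend to zero, the Jacobi matrix acts on ℓ²(ℤ) as a bounded, indeed compact,
operator `T`. So `jacobiMax` is everywhere defined, and density of the finite sequences gives
`jacobiMin = jacobiMax`. Zero lies in the spectrum because a compact operator on an
infinite-dimensional space has no bounded inverse; every other spectral point is an eigenvalue by
the Fredholm alternative.

Splitting off the first index in 𝔉 gives a three-term recurrence (`tailF_recurrence`), which makes
`f` a solution of 𝒥f = zf that decays at +∞. Multiplication by Φ⁺ cancels its poles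
(`exists_local_solution`). The reflection k ↦ 1 - k produces a second solution `g` that decays at
-∞. Cutting 𝔉 at one place (`frakF_eq_wronskian`) shows that ΦF equals the Wronskian W = f₀g₁ -
f₁g₀. A square-summable solution must be proportional to both `f` and `g`, so the nonzero
eigenvalues are exactly the zeros of W (`exists_eigenvector_iff`).

For multiplicities, let U(ξ) be the numerator of Green's function at a fixed index N, glued from f
and g so that (J - ξ)U(ξ) = -w₀W(ξ)e_N. Choose N with f_N(z), g_N(z) nonzero. Then u = U/g_N differs
from f entrywise by analytic multiples of W. If W vanishes to order m at z, the derivatives of u of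
order below m are therefore those of f, and differentiating the equation for u makes them a Jordan
chain. The m-th derivative contributes a nonzero multiple of e_N, which is not in the range of J -
z; hence the chain cannot be prolonged (`exists_jordan_chain`). As the eigenspace is a line, the
chain spans all generalized eigenvectors.

Finally, the Riesz projection fixes generalized eigenvectors, and because (J - ξ)⁻¹e_k = -U/(w₀W)
has a pole of order at most m, its range is killed by (J - z)^m. Hence its range is the span of the
chain, of dimension m. -/

namespace DoublyInfiniteJacobi

/-! ### Tails of summable families indexed by `ℤ` -/

section Tail

variable {E : Type*} [NormedAddCommGroup E]

/-- The tail `∑_{k ≥ n} h_k`. -/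
def tailSum (h : ℤ → E) (n : ℤ) : E := ∑' j : ℕ, h (n + j)

theorem add_natCast_injective (n : ℤ) : Function.Injective fun j : ℕ => n + (j : ℤ) := by
  intro a b hab
  simpa using hab

theorem summable_tail [CompleteSpace E] {h : ℤ → E} (hs : Summable h) (n : ℤ) :
    Summable fun j : ℕ => h (n + j) :=
  hs.comp_injective (add_natCast_injective n)

/-- With a summation range independent of `n`, the limits at both ends become instances of dominated
convergence. -/
theorem tailSum_eq_tsum_ite (h : ℤ → E) (n : ℤ) :
    tailSum h n = ∑' k : ℤ, if n ≤ k then h k else 0 := by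
  have := (add_natCast_injective n).tsum_eq (f := fun k : ℤ => if n ≤ k then h k else 0) ?_
  · rw [← this]
    simp [tailSum]
  · intro k hk
    have hk' : n ≤ k := by
      by_contra hc
      simp [hc] at hk
    exact ⟨(k - n).toNat, by simp only; omega⟩

theorem tailSum_eq_add [CompleteSpace E] {h : ℤ → E} (hs : Summable h) (n : ℤ) :
    tailSum h n = h n + tailSum h (n + 1) := by
  unfold tailSum
  rw [(summable_tail hs n).tsum_eq_zero_add]
  simp only [Nat.cast_zero, add_zero, Nat.cast_add, Nat.cast_one]
  congr 2
  funext j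
  congr 1
  ring

theorem tendsto_tailSum_atTop [CompleteSpace E] {h : ℤ → E} (hs : Summable fun k => ‖h k‖) :
    Tendsto (tailSum h) atTop (𝓝 0) := by
  have := tendsto_tsum_of_dominated_convergence (𝓕 := (atTop : Filter ℤ))
    (f := fun (n k : ℤ) => if n ≤ k then h k else 0) (g := fun _ => 0) hs ?_ ?_
  · simpa only [tailSum_eq_tsum_ite, tsum_zero, funext (tailSum_eq_tsum_ite h)] using this
  · intro k
    refine tendsto_const_nhds.congr' ?_
    filter_upwards [eventually_gt_atTop k] with n hn
    simp [not_le.2 hn]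
  · refine Eventually.of_forall fun n k => ?_
    split_ifs <;> simp

theorem tendsto_tailSum_atBot [CompleteSpace E] {h : ℤ → E} (hs : Summable fun k => ‖h k‖) :
    Tendsto (tailSum h) atBot (𝓝 (∑' k, h k)) := by
  have := tendsto_tsum_of_dominated_convergence (𝓕 := (atBot : Filter ℤ))
    (f := fun (n k : ℤ) => if n ≤ k then h k else 0) (g := h) hs ?_ ?_
  · simpa only [funext (tailSum_eq_tsum_ite h)] using this
  · intro k
    refine tendsto_const_nhds.congr' ?_
    filter_upwards [eventually_le_atBot k] with n hn
    simp [hn]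
  · refine Eventually.of_forall fun n k => ?_
    split_ifs <;> simp

end Tail

theorem tailSum_nonneg {α : ℤ → ℝ} (h0 : ∀ k, 0 ≤ α k) (n : ℤ) : 0 ≤ tailSum α n :=
  tsum_nonneg fun _ => h0 _

theorem tailSum_le_tsum {α : ℤ → ℝ} (hα : Summable α) (h0 : ∀ k, 0 ≤ α k) (n : ℤ) :
    tailSum α n ≤ ∑' k, α k :=
  tsum_comp_le_tsum_of_inj hα h0 (add_natCast_injective n)

theorem tailSum_succ_le {α : ℤ → ℝ} (hα : Summable α) (h0 : ∀ k, 0 ≤ α k) (n : ℤ) :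
    tailSum α (n + 1) ≤ tailSum α n := by
  rw [tailSum_eq_add hα n]
  linarith [h0 n]

/-- Each of the m + 1 terms in (a - b)∑ aⁱb^(m-i) is at least (a - b)b^m. This is the discrete
substitute for integrating t^m, and the source of the factorials below. -/
theorem mul_pow_le_pow_succ_sub {a b : ℝ} (hb : 0 ≤ b) (hab : b ≤ a) (m : ℕ) :
    (m + 1) * ((a - b) * b ^ m) ≤ a ^ (m + 1) - b ^ (m + 1) := by
  induction m with
  | zero => simp
  | succ m ih =>
    have h1 : b ^ (m + 1) ≤ a ^ (m + 1) := pow_le_pow_left₀ hb hab _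
    have h2 := mul_le_mul_of_nonneg_left ih hb
    have h3 := mul_le_mul_of_nonneg_left h1 (sub_nonneg.2 hab)
    have e : a ^ (m + 1 + 1) - b ^ (m + 1 + 1)
        = (a - b) * a ^ (m + 1) + b * (a ^ (m + 1) - b ^ (m + 1)) := by ring
    rw [e]
    push_cast
    have e2 : ((m : ℝ) + 1 + 1) * ((a - b) * b ^ (m + 1))
      = (a - b) * b ^ (m + 1) + b * ((m + 1) * ((a - b) * b ^ m)) := by ring
    rw [e2]
    linarith

/-! ### The iterated sums -/

section Nested

variable {x : ℤ → ℂ} {α : ℤ → ℝ}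

theorem nonneg_of_norm_le (hx : ∀ k, ‖x k * x (k + 1)‖ ≤ α k) (k : ℤ) : 0 ≤ α k :=
  (norm_nonneg _).trans (hx k)

/-- α_k is the decrement of its own tail, so the summands are dominated by a telescoping difference
of (tail)^(m+1)/(m+1)!. -/
theorem mul_tailSum_pow_le (hα : Summable α) (h0 : ∀ k, 0 ≤ α k) (m : ℕ) (k : ℤ) :
    α k * (tailSum α (k + 2) ^ m / (m.factorial : ℝ)) ≤
      tailSum α k ^ (m + 1) / ((m + 1).factorial : ℝ) -
        tailSum α (k + 1) ^ (m + 1) / ((m + 1).factorial : ℝ) := by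
  have hf : (0 : ℝ) < (m.factorial : ℝ) := by exact_mod_cast m.factorial_pos
  have hle : tailSum α (k + 2) ≤ tailSum α (k + 1) := by
    have := tailSum_succ_le hα h0 (k + 1)
    rwa [add_assoc] at this
  have h1 := mul_pow_le_pow_succ_sub (tailSum_nonneg h0 (k + 1)) (tailSum_succ_le hα h0 k) m
  have h2 : tailSum α k - tailSum α (k + 1) = α k := by
    rw [tailSum_eq_add hα k]; ring
  rw [h2] at h1
  rw [← sub_div, Nat.factorial_succ]
  push_cast
  rw [le_div_iff₀ (by positivity)]
  have h3 : α k * tailSum α (k + 2) ^ m ≤ α k * tailSum α (k + 1) ^ m :=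
    mul_le_mul_of_nonneg_left (pow_le_pow_left₀ (tailSum_nonneg h0 _) hle _) (h0 k)
  calc α k * (tailSum α (k + 2) ^ m / (m.factorial : ℝ)) * ((m + 1) * (m.factorial : ℝ))
      = (m + 1) * (α k * tailSum α (k + 2) ^ m) := by field_simp
    _ ≤ (m + 1) * (α k * tailSum α (k + 1) ^ m) := by gcongr
    _ ≤ _ := h1

/-- A nonnegative family bounded by the differences of a nonnegative function sums to at most its
initial value. -/
theorem tsum_le_of_le_sub {b : ℕ → ℝ} {t : ℕ → ℝ} (hb : ∀ j, 0 ≤ b j) (ht : ∀ j, 0 ≤ t j)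
    (h : ∀ j, b j ≤ t j - t (j + 1)) : Summable b ∧ ∑' j, b j ≤ t 0 := by
  have hs : ∀ n, ∑ j ∈ Finset.range n, b j ≤ t 0 := by
    intro n
    calc ∑ j ∈ Finset.range n, b j ≤ ∑ j ∈ Finset.range n, (t j - t (j + 1)) :=
          Finset.sum_le_sum fun j _ => h j
      _ = t 0 - t n := Finset.sum_range_sub' t n
      _ ≤ t 0 := by linarith [ht n]
  exact ⟨summable_of_sum_range_le hb hs, Real.tsum_le_of_sum_range_le hb hs⟩

/-- The ordering k₁ < k₂ < ⋯ gains the factor 1/m!, so 𝔉 is dominated by an exponential series.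
Every convergence and analyticity statement about 𝔉 rests on this. -/
theorem norm_nestedSum_le (hα : Summable α) (hx : ∀ k, ‖x k * x (k + 1)‖ ≤ α k) (m : ℕ) (n : ℤ) :
    ‖nestedSum x m n‖ ≤ tailSum α n ^ m / (m.factorial : ℝ) := by
  have h0 := nonneg_of_norm_le hx
  induction m generalizing n with
  | zero => simp [nestedSum]
  | succ m ih =>
    have key := tsum_le_of_le_sub
      (b := fun j : ℕ => ‖x (n + j) * x (n + j + 1) * nestedSum x m (n + j + 2)‖)
      (t := fun j : ℕ => tailSum α (n + j) ^ (m + 1) / ((m + 1).factorial : ℝ))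
      (fun j => norm_nonneg _)
      (fun j => div_nonneg (pow_nonneg (tailSum_nonneg h0 _) _) (Nat.cast_nonneg _)) ?_
    · calc ‖nestedSum x (m + 1) n‖ ≤ _ := norm_tsum_le_tsum_norm key.1
        _ ≤ _ := key.2
        _ = _ := by simp
    · intro j
      rw [norm_mul]
      refine (mul_le_mul (hx _) (ih _) (norm_nonneg _) (h0 _)).trans ?_
      refine (mul_tailSum_pow_le hα h0 m (n + j)).trans_eq ?_
      push_cast
      rw [add_assoc]

theorem norm_nestedSum_le_tsum (hα : Summable α) (hx : ∀ k, ‖x k * x (k + 1)‖ ≤ α k)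
    (m : ℕ) (n : ℤ) : ‖nestedSum x m n‖ ≤ (∑' k, α k) ^ m / (m.factorial : ℝ) := by
  refine (norm_nestedSum_le hα hx m n).trans ?_
  have h0 := nonneg_of_norm_le hx
  gcongr
  · exact tailSum_nonneg h0 n
  · exact tailSum_le_tsum hα h0 n

/-- The summand over the first index of the iterated sum. -/
def nestedTerm (x : ℤ → ℂ) (m : ℕ) (k : ℤ) : ℂ := x k * x (k + 1) * nestedSum x m (k + 2)

theorem nestedSum_succ_eq_tailSum (x : ℤ → ℂ) (m : ℕ) (n : ℤ) :
    nestedSum x (m + 1) n = tailSum (nestedTerm x m) n := rfl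

theorem norm_nestedTerm_le (hα : Summable α) (hx : ∀ k, ‖x k * x (k + 1)‖ ≤ α k) (m : ℕ) (k : ℤ) :
    ‖nestedTerm x m k‖ ≤ α k * ((∑' k, α k) ^ m / (m.factorial : ℝ)) := by
  unfold nestedTerm
  rw [norm_mul]
  exact mul_le_mul (hx k) (norm_nestedSum_le_tsum hα hx m _) (norm_nonneg _)
    (nonneg_of_norm_le hx k)

theorem summable_norm_nestedTerm (hα : Summable α) (hx : ∀ k, ‖x k * x (k + 1)‖ ≤ α k) (m : ℕ) :
    Summable fun k => ‖nestedTerm x m k‖ :=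
  Summable.of_nonneg_of_le (fun _ => norm_nonneg _) (norm_nestedTerm_le hα hx m)
    (hα.mul_right _)

theorem nestedSum_succ (hα : Summable α) (hx : ∀ k, ‖x k * x (k + 1)‖ ≤ α k) (m : ℕ) (n : ℤ) :
    nestedSum x (m + 1) n =
      x n * x (n + 1) * nestedSum x m (n + 2) + nestedSum x (m + 1) (n + 1) := by
  rw [nestedSum_succ_eq_tailSum, nestedSum_succ_eq_tailSum,
    tailSum_eq_add (summable_norm_nestedTerm hα hx m).of_norm n]
  rfl

/-- `∑_m (-1)^m ∑_{k₁ ≥ n} ∑_{k₂ ≥ k₁ + 2} ⋯`, the value of `𝔉` on the truncation of `x`. -/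
def tailF (x : ℤ → ℂ) (n : ℤ) : ℂ := ∑' m : ℕ, (-1) ^ m * nestedSum x m n

theorem norm_neg_one_pow_mul (m : ℕ) (a : ℂ) : ‖(-1) ^ m * a‖ = ‖a‖ := by simp

theorem summable_norm_tailF (hα : Summable α) (hx : ∀ k, ‖x k * x (k + 1)‖ ≤ α k) (n : ℤ) :
    Summable fun m : ℕ => ‖(-1) ^ m * nestedSum x m n‖ := by
  simp only [norm_neg_one_pow_mul]
  exact Summable.of_nonneg_of_le (fun _ => norm_nonneg _)
    (fun m => norm_nestedSum_le_tsum hα hx m n) (Real.summable_pow_div_factorial _)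

theorem norm_tailF_sub_one_le (hα : Summable α) (hx : ∀ k, ‖x k * x (k + 1)‖ ≤ α k) (n : ℤ) :
    ‖tailF x n - 1‖ ≤ Real.exp (tailSum α n) - 1 := by
  have hs := summable_norm_tailF hα hx n
  have e : tailF x n - 1 = ∑' m : ℕ, (-1) ^ (m + 1) * nestedSum x (m + 1) n := by
    unfold tailF
    rw [hs.of_norm.tsum_eq_zero_add]
    simp [nestedSum]
  have hexp : Summable fun m : ℕ => tailSum α n ^ m / (m.factorial : ℝ) :=
    Real.summable_pow_div_factorial _
  have e2 : Real.exp (tailSum α n) - 1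
      = ∑' m : ℕ, tailSum α n ^ (m + 1) / ((m + 1).factorial : ℝ) := by
    rw [Real.exp_eq_exp_ℝ, NormedSpace.exp_eq_tsum_div]
    simp only
    rw [hexp.tsum_eq_zero_add]
    simp
  rw [e, e2]
  refine tsum_of_norm_bounded ((summable_nat_add_iff 1).2 hexp).hasSum fun m => ?_
  rw [norm_neg_one_pow_mul]
  exact norm_nestedSum_le hα hx _ _

theorem norm_tailF_le (hα : Summable α) (hx : ∀ k, ‖x k * x (k + 1)‖ ≤ α k) (n : ℤ) :
    ‖tailF x n‖ ≤ Real.exp (∑' k, α k) := by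
  have h1 := norm_tailF_sub_one_le hα hx n
  have h2 : ‖tailF x n‖ ≤ ‖tailF x n - 1‖ + ‖(1 : ℂ)‖ := by
    simpa using norm_add_le (tailF x n - 1) 1
  have h3 := Real.exp_le_exp.2 (tailSum_le_tsum hα (nonneg_of_norm_le hx) n)
  rw [norm_one] at h2
  linarith

theorem tendsto_tailF_atTop (hα : Summable α) (hx : ∀ k, ‖x k * x (k + 1)‖ ≤ α k) :
    Tendsto (tailF x) atTop (𝓝 1) := by
  rw [tendsto_iff_norm_sub_tendsto_zero]
  have h0 := nonneg_of_norm_le hx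
  have h1 : Tendsto (fun n => Real.exp (tailSum α n) - 1) atTop (𝓝 0) := by
    have := (Real.continuous_exp.tendsto _).comp
      (tendsto_tailSum_atTop (h := α) (by simpa [abs_of_nonneg (h0 _)] using hα))
    simpa using this.sub_const 1
  exact squeeze_zero (fun _ => norm_nonneg _) (norm_tailF_sub_one_le hα hx) h1

/-- An admissible tuple of indices either starts at n, forcing the rest to be at least n + 2 and
flipping the sign, or lies entirely in k ≥ n + 1. -/
theorem tailF_recurrence (hα : Summable α) (hx : ∀ k, ‖x k * x (k + 1)‖ ≤ α k) (n : ℤ) :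
    tailF x n = tailF x (n + 1) - x n * x (n + 1) * tailF x (n + 2) := by
  have s0 := (summable_norm_tailF hα hx n).of_norm
  have s1 := (summable_norm_tailF hα hx (n + 1)).of_norm
  have s2 := (summable_norm_tailF hα hx (n + 2)).of_norm
  unfold tailF
  rw [s0.tsum_eq_zero_add, s1.tsum_eq_zero_add, ← tsum_mul_left, add_sub_assoc,
    ← ((summable_nat_add_iff 1).2 s1).tsum_sub (s2.mul_left _)]
  have z : ∀ k, nestedSum x 0 k = 1 := fun _ => rfl
  simp only [z, nestedSum_succ hα hx _ n]
  congr 2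
  funext m
  ring

/-- `∑_{k₁ ∈ ℤ}` and the limit of the truncated sums agree. -/
theorem tendsto_tailF_atBot (hα : Summable α) (hx : ∀ k, ‖x k * x (k + 1)‖ ≤ α k) :
    Tendsto (tailF x) atBot (𝓝 (frakF x)) := by
  have e : tailF x = fun n => 1 + ∑' m : ℕ, (-1) ^ (m + 1) * nestedSum x (m + 1) n := by
    funext n
    unfold tailF
    rw [(summable_norm_tailF hα hx n).of_norm.tsum_eq_zero_add]
    simp [nestedSum]
  rw [e]
  refine tendsto_const_nhds.add ?_
  refine tendsto_tsum_of_dominated_convergence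
    ((summable_nat_add_iff 1).2 (Real.summable_pow_div_factorial (∑' k, α k))) ?_ ?_
  · intro m
    exact (tendsto_tailSum_atBot (summable_norm_nestedTerm hα hx m)).const_mul _
  · refine Eventually.of_forall fun n m => ?_
    rw [norm_neg_one_pow_mul]
    exact norm_nestedSum_le_tsum hα hx _ _

/-- The truncation of `x` to the indices `k ≥ n`. -/
def truncSeq (x : ℤ → ℂ) (n : ℤ) (k : ℤ) : ℂ := if n ≤ k then x k else 0

/-- The bound on `x` is required only for k ≥ n; this later permits finitely or infinitely many
poles at indices below the cut. -/
theorem norm_truncSeq_mul_le (hx : ∀ k, n ≤ k → ‖x k * x (k + 1)‖ ≤ α k) (h0 : ∀ k, 0 ≤ α k)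
    (k : ℤ) : ‖truncSeq x n k * truncSeq x n (k + 1)‖ ≤ α k := by
  unfold truncSeq
  by_cases h : n ≤ k
  · rw [if_pos h, if_pos (by omega)]
    exact hx k h
  · rw [if_neg h]
    simpa using h0 k

theorem nestedSum_truncSeq (x : ℤ → ℂ) (n : ℤ) (m : ℕ) (k : ℤ) (hk : n ≤ k) :
    nestedSum (truncSeq x n) m k = nestedSum x m k := by
  induction m generalizing k with
  | zero => rfl
  | succ m ih =>
    unfold nestedSum
    refine tsum_congr fun j => ?_
    rw [ih _ (by omega)]
    unfold truncSeq
    rw [if_pos (by omega), if_pos (by omega)]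

theorem tailF_truncSeq (x : ℤ → ℂ) (n k : ℤ) (hk : n ≤ k) :
    tailF (truncSeq x n) k = tailF x k := by
  unfold tailF
  exact tsum_congr fun m => by rw [nestedSum_truncSeq x n m k hk]

/-- Below the cut the entries vanish, so the recurrence makes `tailF` of the truncated sequence
constant there; its limit at -∞, which is 𝔉, is already attained at n. -/
theorem frakFFrom_eq_tailF (hα : Summable α) (hx : ∀ k, n ≤ k → ‖x k * x (k + 1)‖ ≤ α k)
    (h0 : ∀ k, 0 ≤ α k) : frakFFrom x n = tailF x n := by
  have hy := norm_truncSeq_mul_le hx h0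
  have h1 := tendsto_tailF_atBot hα hy
  rw [← tailF_truncSeq x n n le_rfl]
  refine tendsto_nhds_unique h1 (tendsto_const_nhds.congr' ?_)
  have step : ∀ j : ℕ, tailF (truncSeq x n) (n - j) = tailF (truncSeq x n) n := by
    intro j
    induction j with
    | zero => simp
    | succ j ih =>
      rw [tailF_recurrence hα hy]
      have : truncSeq x n (n - ((j + 1 : ℕ) : ℤ)) = 0 := by
        unfold truncSeq
        rw [if_neg (by push_cast; omega)]
      rw [this, ← ih]
      simp only [zero_mul, sub_zero]
      congr 1
      push_cast
      ring
  filter_upwards [eventually_le_atBot n] with k hk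
  rw [← step (n - k).toNat]
  congr 1
  omega

/-- The sequence `k ↦ x_{1-k}`. -/
def reflect (x : ℤ → ℂ) (k : ℤ) : ℂ := x (1 - k)

theorem norm_reflect_mul_le (hx : ∀ k, ‖x k * x (k + 1)‖ ≤ α k) (k : ℤ) :
    ‖reflect x k * reflect x (k + 1)‖ ≤ α (-k) := by
  have := hx (-k)
  unfold reflect
  rw [mul_comm]
  convert this using 4 <;> ring

/-- Cut the index line between n and n + 1: either no chosen pair straddles the cut and both halves
are independent, or the pair (n, n + 1) is used. The resulting expression does not depend on n by
the two recurrences, and as n → -∞ the left factors tend to 1 and x_n x_{n+1} to 0, which leaves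
𝔉(x). -/
theorem frakF_eq_wronskian (hα : Summable α) (hx : ∀ k, ‖x k * x (k + 1)‖ ≤ α k) :
    frakF x = tailF (reflect x) 1 * tailF x 1 -
      x 0 * x 1 * tailF (reflect x) 2 * tailF x 2 := by
  have hα' : Summable fun k => α (-k) := (Equiv.neg ℤ).summable_iff.2 hα
  have hx' := norm_reflect_mul_le hx
  set D : ℤ → ℂ := fun n => tailF (reflect x) (1 - n) * tailF x (n + 1) -
      x n * x (n + 1) * tailF (reflect x) (2 - n) * tailF x (n + 2) with hD
  have hstep : ∀ n, D (n - 1) = D n := by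
    intro n
    simp only [hD]
    have r1 := tailF_recurrence hα hx n
    have r2 := tailF_recurrence hα' hx' (1 - n)
    have e1 : reflect x (1 - n) = x n := by unfold reflect; congr 1; ring
    have e2 : reflect x (1 - n + 1) = x (n - 1) := by unfold reflect; congr 1; ring
    rw [e1, e2] at r2
    have e3 : (1 : ℤ) - n + 1 = 2 - n := by ring
    have e4 : (1 : ℤ) - n + 2 = 3 - n := by ring
    have e5 : (1 : ℤ) - (n - 1) = 2 - n := by ring
    have e6 : (2 : ℤ) - (n - 1) = 3 - n := by ring
    have e7 : n - 1 + 1 = n := by ring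
    have e8 : n - 1 + 2 = n + 1 := by ring
    rw [e3, e4] at r2
    rw [e5, e6, e7, e8, r1, r2]
    ring
  have hconst : ∀ j : ℕ, D (-j) = D 0 := by
    intro j
    induction j with
    | zero => simp
    | succ j ih =>
      rw [← ih, ← hstep (-j)]
      congr 1
      push_cast
      ring
  have hlim : Tendsto D atBot (𝓝 (frakF x)) := by
    have t1 : Tendsto (fun n : ℤ => tailF (reflect x) (1 - n)) atBot (𝓝 1) :=
      (tendsto_tailF_atTop hα' hx').comp
        (tendsto_atTop_add_const_left _ 1 tendsto_neg_atBot_atTop)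
    have t2 : Tendsto (fun n : ℤ => tailF x (n + 1)) atBot (𝓝 (frakF x)) :=
      (tendsto_tailF_atBot hα hx).comp (tendsto_atBot_add_const_right _ 1 tendsto_id)
    have t3 : Tendsto (fun n : ℤ => tailF (reflect x) (2 - n)) atBot (𝓝 1) :=
      (tendsto_tailF_atTop hα' hx').comp
        (tendsto_atTop_add_const_left _ 2 tendsto_neg_atBot_atTop)
    have t4 : Tendsto (fun n : ℤ => tailF x (n + 2)) atBot (𝓝 (frakF x)) :=
      (tendsto_tailF_atBot hα hx).comp (tendsto_atBot_add_const_right _ 2 tendsto_id)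
    have t5 : Tendsto (fun n : ℤ => x n * x (n + 1)) atBot (𝓝 0) := by
      have h1 := hα.tendsto_cofinite_zero
      have h2 : Tendsto α atBot (𝓝 0) := h1.mono_left (by
        rw [Int.cofinite_eq]; exact le_sup_left)
      exact squeeze_zero_norm hx h2
    simpa using (t1.mul t2).sub ((t5.mul t3).mul t4)
  have hcz : frakF x = D 0 := by
    refine tendsto_nhds_unique hlim (tendsto_const_nhds.congr' ?_)
    filter_upwards [eventually_le_atBot 0] with k hk
    rw [← hconst (-k).toNat]
    congr 1
    omega
  rw [hcz]
  simp [hD]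

end Nested

/-! ### Elementary factors and their products -/

section Factors

/-- The logarithm of the elementary factor, for arguments near the origin. -/
def logFactor (p : ℕ) (x : ℂ) : ℂ :=
  Complex.log (1 - x) + ∑ j ∈ Finset.Ico 1 p, x ^ j / (j : ℂ)

theorem exp_logFactor {p : ℕ} {x : ℂ} (hx : ‖x‖ < 1) :
    Complex.exp (logFactor p x) = elemFactor p x := by
  have h1 : (1 : ℂ) - x ≠ 0 := by
    intro h
    have : x = 1 := (sub_eq_zero.1 h).symm
    simp [this] at hx
  rw [logFactor, Complex.exp_add, Complex.exp_log h1, elemFactor]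

/-- The exponential in the elementary factor cancels the Taylor polynomial of log(1 - x) of degree p
- 1, leaving a remainder of order p; this is where ℓ^p summability of `lam` is enough. -/
theorem norm_logFactor_le {p : ℕ} (hp : 1 ≤ p) {x : ℂ} (hx : ‖x‖ ≤ 1 / 2) :
    ‖logFactor p x‖ ≤ 2 * ‖x‖ ^ p := by
  obtain ⟨q, rfl⟩ : ∃ q, p = q + 1 := ⟨p - 1, by omega⟩
  have h1 := Complex.norm_log_sub_logTaylor_le q (z := -x) (by rw [norm_neg]; linarith)
  have e : Complex.log (1 + -x) - Complex.logTaylor (q + 1) (-x) = logFactor (q + 1) x := by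
    rw [logFactor, Complex.logTaylor, sub_eq_add_neg (1 : ℂ) x, sub_eq_add_neg,
      ← Finset.sum_neg_distrib, Finset.range_eq_Ico, Finset.sum_eq_sum_Ico_succ_bot (by omega)]
    simp only [Nat.cast_zero, div_zero, neg_zero, zero_add]
    congr 1
    refine Finset.sum_congr rfl fun j _ => ?_
    have h : (-x) ^ j = (-1) ^ j * x ^ j := neg_pow x j
    have h2 : ((-1 : ℂ) ^ j) * (-1) ^ j = 1 := by rw [← mul_pow]; simp
    rw [h, pow_succ]
    linear_combination (x ^ j / (j : ℂ)) * h2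
  rw [e, norm_neg] at h1
  refine h1.trans ?_
  have h2 : (1 - ‖x‖)⁻¹ ≤ 2 := by
    rw [inv_le_comm₀ (by linarith) (by norm_num)]
    linarith
  have h3 : ‖x‖ ^ (q + 1) * (1 - ‖x‖)⁻¹ ≤ ‖x‖ ^ (q + 1) * 2 := by gcongr
  have h4 : (0 : ℝ) ≤ ‖x‖ ^ (q + 1) := by positivity
  rw [div_le_iff₀ (by positivity)]
  nlinarith [(Nat.cast_nonneg q : (0 : ℝ) ≤ q)]

theorem differentiableAt_logFactor {p : ℕ} {x : ℂ} (hx : ‖x‖ < 1) :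
    DifferentiableAt ℂ (logFactor p) x := by
  have h1 : (1 : ℂ) - x ∈ Complex.slitPlane := by
    have := Complex.mem_slitPlane_of_norm_lt_one (z := -x) (by simpa using hx)
    simpa [sub_eq_add_neg] using this
  unfold logFactor
  refine DifferentiableAt.add ?_ ?_
  · exact DifferentiableAt.clog (by fun_prop) h1
  · fun_prop

theorem norm_elemFactor_sub_one_le {p : ℕ} (hp : 1 ≤ p) {x : ℂ} (hx : ‖x‖ ≤ 1 / 2) :
    ‖elemFactor p x - 1‖ ≤ 4 * ‖x‖ ^ p := by
  have h1 := norm_logFactor_le hp hx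
  have h2 : ‖logFactor p x‖ ≤ 1 := by
    have h3 : ‖x‖ ^ p ≤ ‖x‖ := pow_le_of_le_one (norm_nonneg _) (by linarith) (by omega)
    linarith
  rw [← exp_logFactor (by linarith)]
  linarith [Complex.norm_exp_sub_one_le h2]

theorem multipliable_elemFactor {p : ℕ} (hp : 1 ≤ p) {μ : ℕ → ℂ}
    (hμ : Summable fun n => ‖μ n‖ ^ p) (z : ℂ) :
    Multipliable fun n : ℕ => elemFactor p (μ n / z) := by
  have hs : Summable fun n => ‖μ n / z‖ ^ p := by
    simpa only [norm_div, div_pow] using hμ.div_const (‖z‖ ^ p)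
  have h0 : ∀ᶠ n in cofinite, ‖μ n / z‖ ≤ 1 / 2 := by
    have h1 : ∀ᶠ n in cofinite, ‖μ n / z‖ ^ p < (1 / 2 : ℝ) ^ p :=
      hs.tendsto_cofinite_zero.eventually_lt_const (by positivity)
    filter_upwards [h1] with n hn
    exact (lt_of_pow_lt_pow_left₀ p (by norm_num) hn).le
  have h2 : Summable fun n : ℕ => ‖elemFactor p (μ n / z) - 1‖ := by
    refine Summable.of_norm_bounded_eventually (hs.mul_left 4) ?_
    filter_upwards [h0] with n hn
    rw [norm_norm]
    exact norm_elemFactor_sub_one_le hp hn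
  simpa using multipliable_one_add_of_summable h2

end Factors

/-! ### Analyticity of the truncated values of `𝔉` -/

section Analytic

/-- Weierstrass M-test. Only products of neighbours are assumed analytic, since these are all that
the iterated sums see. -/
theorem differentiableOn_nestedSum {U : Set ℂ} (hU : IsOpen U) {x : ℂ → ℤ → ℂ} {α : ℤ → ℝ}
    (hα : Summable α) (hx : ∀ ξ ∈ U, ∀ k, ‖x ξ k * x ξ (k + 1)‖ ≤ α k)
    (hd : ∀ k, DifferentiableOn ℂ (fun ξ => x ξ k * x ξ (k + 1)) U) (m : ℕ) (n : ℤ) :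
    DifferentiableOn ℂ (fun ξ => nestedSum (x ξ) m n) U := by
  induction m generalizing n with
  | zero => exact differentiableOn_const 1
  | succ m ih =>
    have hb : Summable fun j : ℕ =>
        α (n + j) * ((∑' k, α k) ^ m / (m.factorial : ℝ)) :=
      (summable_tail hα n).mul_right _
    exact Complex.differentiableOn_tsum_of_summable_norm hb (fun j => (hd _).mul (ih _)) hU
      fun j ξ hξ => norm_nestedTerm_le hα (hx ξ hξ) m _

theorem differentiableOn_tailF {U : Set ℂ} (hU : IsOpen U) {x : ℂ → ℤ → ℂ} {α : ℤ → ℝ}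
    (hα : Summable α) (hx : ∀ ξ ∈ U, ∀ k, ‖x ξ k * x ξ (k + 1)‖ ≤ α k)
    (hd : ∀ k, DifferentiableOn ℂ (fun ξ => x ξ k * x ξ (k + 1)) U) (n : ℤ) :
    DifferentiableOn ℂ (fun ξ => tailF (x ξ) n) U := by
  refine Complex.differentiableOn_tsum_of_summable_norm
    (Real.summable_pow_div_factorial (∑' k, α k))
    (fun m => (differentiableOn_nestedSum hU hα hx hd m n).const_mul _) hU fun m ξ hξ => ?_
  rw [norm_neg_one_pow_mul]
  exact norm_nestedSum_le_tsum hα (hx ξ hξ) m n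

end Analytic

/-! ### The solution `f_n` on the regular set -/

section Solution

variable {w lam γ : ℤ → ℂ} {p : ℕ}

theorem summable_norm_pow (hp : 1 ≤ p) (hlam : Memℓp lam (p : ℝ≥0∞)) :
    Summable fun k => ‖lam k‖ ^ p := by
  have := hlam.summable (by simp; omega)
  simpa using this

theorem summable_norm_sq (hw : Memℓp w 2) : Summable fun k => ‖w k‖ ^ 2 :=
  summable_norm_pow (p := 2) (by norm_num) (by simpa using hw)

theorem tendsto_zero_of_summable_norm_pow (hl : Summable fun k => ‖lam k‖ ^ p) :
    Tendsto lam cofinite (𝓝 0) := by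
  rw [tendsto_zero_iff_norm_tendsto_zero, Metric.tendsto_nhds]
  intro ε hε
  filter_upwards [hl.tendsto_cofinite_zero.eventually_lt_const (pow_pos hε p)] with k hk
  simpa using lt_of_pow_lt_pow_left₀ p hε.le hk

/-- Since `lam` tends to 0 along the infinite index set ℤ, the closure of its range adds exactly the
point 0. -/
theorem mem_regularSet (ht : Tendsto lam cofinite (𝓝 0)) {z : ℂ} :
    z ∈ regularSet lam ↔ z ≠ 0 ∧ ∀ k, lam k ≠ z := by
  have hc : IsClosed (insert 0 (Set.range lam)) :=
    ht.isCompact_insert_range_of_cofinite.isClosed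
  constructor
  · intro h
    refine ⟨?_, ?_⟩
    · rintro rfl
      have : Tendsto lam cofinite (𝓝 (0 : ℂ)) := ht
      exact h (mem_closure_of_tendsto ht (Eventually.of_forall fun k => Set.mem_range_self k))
    · rintro k rfl
      exact h (subset_closure (Set.mem_range_self k))
  · rintro ⟨h0, hk⟩ h
    have h2 : z ∈ insert 0 (Set.range lam) :=
      closure_minimal (Set.subset_insert _ _) hc h
    rcases h2 with h2 | ⟨k, h2⟩
    · exact h0 h2
    · exact hk k h2

theorem isOpen_regularSet : IsOpen (regularSet lam) := isClosed_closure.isOpen_compl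

/-- Only finitely many λ_k have modulus at least |z|/2, so the exceptional points do not accumulate
at z. -/
theorem eventually_mem_regularSet (ht : Tendsto lam cofinite (𝓝 0)) {z : ℂ} (hz : z ≠ 0) :
    ∀ᶠ ξ in 𝓝[≠] z, ξ ∈ regularSet lam := by
  have hpos : 0 < ‖z‖ / 2 := by positivity
  have hfin : {k | ¬ ‖lam k‖ < ‖z‖ / 2}.Finite := by
    have := ht.norm.eventually_lt_const (u := ‖z‖ / 2) (by simpa using hpos)
    exact this
  have h1 : ∀ᶠ ξ in 𝓝 z, ξ ∉ (lam '' {k | ¬ ‖lam k‖ < ‖z‖ / 2}) \ {z} :=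
    (((hfin.image lam).subset Set.sdiff_subset).isClosed.isOpen_compl).mem_nhds (by simp)
  have h2 : ∀ᶠ ξ in 𝓝 z, ‖z‖ / 2 < ‖ξ‖ :=
    continuous_norm.continuousAt.eventually_const_lt (by linarith)
  filter_upwards [h1.filter_mono nhdsWithin_le_nhds, h2.filter_mono nhdsWithin_le_nhds,
    self_mem_nhdsWithin] with ξ a b c
  rw [mem_regularSet ht]
  refine ⟨fun h => by simp [h] at b; linarith, ?_⟩
  rintro k rfl
  exact a ⟨⟨k, not_lt.2 b.le, rfl⟩, c⟩

/-- The argument of `𝔉` in the definition of `f_n`. -/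
def ratioSeq (lam γ : ℤ → ℂ) (z : ℂ) (k : ℤ) : ℂ := γ k ^ 2 / (lam k - z)

/-- γ enters 𝔉 only through γ_k γ_{k+1} = w_k; its choice is therefore immaterial. -/
theorem ratioSeq_mul (hγ : ∀ n : ℤ, γ n * γ (n + 1) = w n) (z : ℂ) (k : ℤ) :
    ratioSeq lam γ z k * ratioSeq lam γ z (k + 1) =
      w k ^ 2 / ((z - lam k) * (z - lam (k + 1))) := by
  unfold ratioSeq
  rw [div_mul_div_comm, ← mul_pow, hγ]
  congr 1
  ring

theorem norm_ratioSeq_mul_le (hγ : ∀ n : ℤ, γ n * γ (n + 1) = w n) {z : ℂ} {c : ℝ} (hc : 0 < c)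
    {k : ℤ} (h1 : c ≤ ‖z - lam k‖) (h2 : c ≤ ‖z - lam (k + 1)‖) :
    ‖ratioSeq lam γ z k * ratioSeq lam γ z (k + 1)‖ ≤ (c * c)⁻¹ * ‖w k‖ ^ 2 := by
  rw [ratioSeq_mul hγ, norm_div, norm_mul, norm_pow, div_eq_inv_mul]
  gcongr

theorem exists_pos_le_norm_sub {z : ℂ} (hz : z ∈ regularSet lam) :
    ∃ c > 0, ∀ k, c ≤ ‖z - lam k‖ := by
  obtain ⟨c, hc, hb⟩ := Metric.isOpen_iff.1 (isOpen_regularSet (lam := lam)) z hz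
  refine ⟨c, hc, fun k => ?_⟩
  by_contra hk
  have h1 : lam k ∈ Metric.ball z c := by
    rw [mem_ball_iff_norm, norm_sub_rev]
    exact not_le.1 hk
  exact hb h1 (subset_closure (Set.mem_range_self k))

theorem exists_summable_bound (hw : Memℓp w 2) (hγ : ∀ n : ℤ, γ n * γ (n + 1) = w n) {z : ℂ}
    (hz : z ∈ regularSet lam) :
    ∃ α : ℤ → ℝ, Summable α ∧
      ∀ k, ‖ratioSeq lam γ z k * ratioSeq lam γ z (k + 1)‖ ≤ α k := by
  obtain ⟨c, hc, h⟩ := exists_pos_le_norm_sub hz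
  exact ⟨_, (summable_norm_sq hw).mul_left (c * c)⁻¹, fun k =>
    norm_ratioSeq_mul_le hγ hc (h k) (h (k + 1))⟩

theorem nestedSum_congr {x y : ℤ → ℂ} (h : ∀ k, x k * x (k + 1) = y k * y (k + 1)) (m : ℕ)
    (n : ℤ) : nestedSum x m n = nestedSum y m n := by
  induction m generalizing n with
  | zero => rfl
  | succ m ih =>
    unfold nestedSum
    exact tsum_congr fun j => by rw [h, ih]

theorem frakF_congr {x y : ℤ → ℂ} (h : ∀ k, x k * x (k + 1) = y k * y (k + 1)) :
    frakF x = frakF y := by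
  unfold frakF
  simp only [h, nestedSum_congr h]

theorem charArg_mul (z : ℂ) (k : ℤ) :
    (γ k ^ 2 / (z - lam k)) * (γ (k + 1) ^ 2 / (z - lam (k + 1))) =
      ratioSeq lam γ z k * ratioSeq lam γ z (k + 1) := by
  unfold ratioSeq
  rw [div_mul_div_comm, div_mul_div_comm]
  congr 1
  ring

theorem domF_charArg (hw : Memℓp w 2) (hγ : ∀ n : ℤ, γ n * γ (n + 1) = w n) {z : ℂ}
    (hz : z ∈ regularSet lam) : DomF fun n => γ n ^ 2 / (z - lam n) := by
  obtain ⟨α, hα, h⟩ := exists_summable_bound hw hγ hz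
  unfold DomF
  simp only [charArg_mul]
  exact Summable.of_nonneg_of_le (fun _ => norm_nonneg _) h hα

theorem solF_eq (hw : Memℓp w 2) (hγ : ∀ n : ℤ, γ n * γ (n + 1) = w n) {z : ℂ}
    (hz : z ∈ regularSet lam) (n : ℤ) :
    solF w lam γ n z = weightP w lam n z * tailF (ratioSeq lam γ z) (n + 1) := by
  obtain ⟨α, hα, h⟩ := exists_summable_bound hw hγ hz
  unfold solF
  congr 1
  exact frakFFrom_eq_tailF hα (fun k _ => h k) (nonneg_of_norm_le h)

theorem weightP_succ (hw0 : ∀ n : ℤ, w n ≠ 0) {z : ℂ} (hz : ∀ k, z - lam k ≠ 0) (n : ℤ) :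
    weightP w lam (n + 1) z = weightP w lam n z * (w n / (z - lam (n + 1))) := by
  unfold weightP
  rcases lt_trichotomy n (-1) with h | h | h
  · rw [if_neg (by omega), if_neg (by omega)]
    have e : Finset.Icc (n + 1) 0 = insert (n + 1) (Finset.Icc (n + 1 + 1) 0) := by
      ext k; simp only [Finset.mem_Icc, Finset.mem_insert]; omega
    rw [e, Finset.prod_insert (by simp)]
    have h1 := hz (n + 1)
    have h2 := hw0 n
    simp only [add_sub_cancel_right]
    field_simp
  · subst h
    have h1 := hz 0
    have h2 := hw0 (-1)
    simp
    field_simp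
  · rw [if_pos (by omega), if_pos (by omega)]
    have e : Finset.Icc 1 (n + 1) = insert (n + 1) (Finset.Icc 1 n) := by
      ext k; simp only [Finset.mem_Icc, Finset.mem_insert]; omega
    rw [e, Finset.prod_insert (by simp)]
    simp only [add_sub_cancel_right]
    ring

theorem sub_ne_zero_of_mem_regularSet {z : ℂ} (hz : z ∈ regularSet lam) (k : ℤ) :
    z - lam k ≠ 0 := by
  intro h
  exact hz (subset_closure ⟨k, (sub_eq_zero.1 h).symm⟩)

/-- The weights satisfy w_{n-1}𝒫_{n-1} = (z - λ_n)𝒫_n; after dividing them out, the equation is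
`tailF_recurrence` at n. -/
theorem solF_recurrence (hw0 : ∀ n : ℤ, w n ≠ 0) (hw : Memℓp w 2)
    (hγ : ∀ n : ℤ, γ n * γ (n + 1) = w n) {z : ℂ} (hz : z ∈ regularSet lam) (n : ℤ) :
    w (n - 1) * solF w lam γ (n - 1) z + lam n * solF w lam γ n z + w n * solF w lam γ (n + 1) z =
      z * solF w lam γ n z := by
  obtain ⟨α, hα, h⟩ := exists_summable_bound hw hγ hz
  have hz' := sub_ne_zero_of_mem_regularSet hz
  rw [solF_eq hw hγ hz, solF_eq hw hγ hz, solF_eq hw hγ hz, weightP_succ hw0 hz' n]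
  have r := tailF_recurrence hα h n
  rw [ratioSeq_mul hγ] at r
  have e := weightP_succ hw0 hz' (n - 1)
  rw [sub_add_cancel] at e
  have a : n + 1 + 1 = n + 2 := by ring
  rw [e, sub_add_cancel, a, r]
  have h1 := hz' n
  have h2 := hz' (n + 1)
  field_simp
  ring

/-- The Wronskian formula for the characteristic function. -/
theorem charFn_eq_wronskian (hw : Memℓp w 2)
    (hγ : ∀ n : ℤ, γ n * γ (n + 1) = w n) {z : ℂ} (hz : z ∈ regularSet lam)
    (hw' : Memℓp (fun k => w (-k)) 2) (hz' : z ∈ regularSet (reflect lam))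
    (hγ' : ∀ n : ℤ, reflect γ n * reflect γ (n + 1) = w (-n)) :
    charFn lam γ z =
      solF w lam γ 0 z * solF (fun k => w (-k)) (reflect lam) (reflect γ) 0 z -
        solF w lam γ 1 z * solF (fun k => w (-k)) (reflect lam) (reflect γ) 1 z := by
  obtain ⟨α, hα, h⟩ := exists_summable_bound hw hγ hz
  have e : charFn lam γ z = frakF (ratioSeq lam γ z) := frakF_congr (charArg_mul z)
  have e2 : ratioSeq (reflect lam) (reflect γ) z = reflect (ratioSeq lam γ z) := rfl
  have h0 := sub_ne_zero_of_mem_regularSet hz 0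
  have h1 := sub_ne_zero_of_mem_regularSet hz 1
  have e3 := ratioSeq_mul (lam := lam) hγ z 0
  rw [zero_add] at e3
  rw [e, frakF_eq_wronskian hα h, solF_eq hw hγ hz, solF_eq hw hγ hz, solF_eq hw' hγ' hz',
    solF_eq hw' hγ' hz', e2, e3]
  simp only [weightP, le_refl, zero_le_one, if_true, reflect, zero_add, one_add_one_eq_two,
    Finset.Icc_self, Finset.prod_singleton, sub_self, neg_zero]
  simp
  field_simp

end Solution

/-! ### The regularized solution near a nonzero point -/

section Local

variable {w lam γ : ℤ → ℂ} {p : ℕ}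

/-- Evaluates the regularized functions: any continuous candidate that agrees with the formula at
regular points is the filled-in value. -/
theorem limUnder_eq_of_eqOn (ht : Tendsto lam cofinite (𝓝 0)) {U : Set ℂ} (hU : IsOpen U)
    {h s : ℂ → ℂ} (hs : ContinuousOn s U) (heq : ∀ ξ ∈ U, ξ ∈ regularSet lam → s ξ = h ξ) {z : ℂ}
    (hzU : z ∈ U) (hz : z ≠ 0) : limUnder (𝓝[≠] z) h = s z := by
  have h1 : Tendsto s (𝓝[≠] z) (𝓝 (s z)) :=
    (hs.continuousAt (hU.mem_nhds hzU)).tendsto.mono_left nhdsWithin_le_nhds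
  refine (h1.congr' ?_).limUnder_eq
  filter_upwards [eventually_mem_regularSet ht hz, nhdsWithin_le_nhds (hU.mem_nhds hzU)]
    with ξ a b
  exact heq ξ b a

theorem weightP_natCast (hw0 : ∀ n : ℤ, w n ≠ 0) {z : ℂ} (hz : ∀ k, z - lam k ≠ 0) (m : ℕ) :
    weightP w lam m z = ∏ i ∈ Finset.range m, w i / (z - lam (i + 1)) := by
  induction m with
  | zero => simp [weightP]
  | succ m ih =>
    push_cast
    rw [weightP_succ hw0 hz, ih, Finset.prod_range_succ]

/-- The regularization of `∏_{k = 1}^N w_{k-1} / (z - λ_k)`. -/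
def headFactor (w lam : ℤ → ℂ) (p N : ℕ) (z : ℂ) : ℂ :=
  ∏ i ∈ Finset.range N,
    (w i * z⁻¹ * Complex.exp (∑ j ∈ Finset.Ico 1 p, (lam (i + 1) / z) ^ j / (j : ℂ)))

/-- The logarithm of the product of the elementary factors with index above `N`. -/
def tailLog (lam : ℤ → ℂ) (p N : ℕ) (z : ℂ) : ℂ :=
  ∑' n : ℕ, logFactor p (lam ((n + N : ℕ) + 1) / z)

/-- For each of the first N indices, (1 - λ_k/z) · w_{k-1}/(z - λ_k) = w_{k-1}/z, so the zeros of Φ⁺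
cancel the poles of the weight. The factors of Φ⁺ beyond N are collected into one exponential. -/
theorem PhiPlus_mul_weightP (hp : 1 ≤ p) (hw0 : ∀ n : ℤ, w n ≠ 0)
    (hl : Summable fun k => ‖lam k‖ ^ p) {N : ℕ} {z : ℂ} (hz0 : z ≠ 0)
    (hz : ∀ k, z - lam k ≠ 0) (hN : ∀ n : ℕ, ‖lam ((n + N : ℕ) + 1) / z‖ ≤ 1 / 2) (j : ℕ) :
    PhiPlus lam p z * weightP w lam ((N + j : ℕ) : ℤ) z =
      headFactor w lam p N z * Complex.exp (tailLog lam p N z) *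
        ∏ i ∈ Finset.range j, w (N + i : ℕ) / (z - lam ((N + i : ℕ) + 1)) := by
  have hinj : Function.Injective fun n : ℕ => ((n + N : ℕ) : ℤ) + 1 := by
    intro a b hab
    simpa using hab
  have hμ : Summable fun n : ℕ => ‖lam ((n + N : ℕ) + 1)‖ ^ p := hl.comp_injective hinj
  have hsum : Summable fun n : ℕ => logFactor p (lam ((n + N : ℕ) + 1) / z) := by
    have hs : Summable fun n : ℕ => 2 * ‖lam ((n + N : ℕ) + 1) / z‖ ^ p := by
      simpa only [norm_div, div_pow] using (hμ.div_const (‖z‖ ^ p)).mul_left 2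
    exact Summable.of_norm_bounded hs fun n => norm_logFactor_le hp (hN n)
  have htail : ∏' n : ℕ, elemFactor p (lam ((n + N : ℕ) + 1) / z) =
      Complex.exp (tailLog lam p N z) := by
    refine HasProd.tprod_eq ?_
    refine hsum.hasSum.cexp.congr_fun ?_
    intro n
    exact (exp_logFactor ((hN n).trans_lt (by norm_num))).symm
  have hsplit := Multipliable.prod_mul_tprod_nat_mul' (f := fun n : ℕ => elemFactor p
    (lam ((n : ℤ) + 1) / z)) (k := N) (multipliable_elemFactor hp hμ z)
  unfold PhiPlus
  rw [← hsplit, htail, weightP_natCast hw0 hz, Finset.prod_range_add]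
  have hhead : (∏ i ∈ Finset.range N, elemFactor p (lam ((i : ℤ) + 1) / z)) *
      ∏ i ∈ Finset.range N, w i / (z - lam (i + 1)) = headFactor w lam p N z := by
    unfold headFactor
    rw [← Finset.prod_mul_distrib]
    refine Finset.prod_congr rfl fun i _ => ?_
    have h1 := hz (i + 1)
    have h2 : 1 - lam ((i : ℤ) + 1) / z = (z - lam (i + 1)) * z⁻¹ := by field_simp
    rw [elemFactor, h2]
    field_simp
  rw [← hhead]
  ring

theorem differentiableOn_tailLog (hp : 1 ≤ p) (hl : Summable fun k => ‖lam k‖ ^ p) {N : ℕ}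
    {U : Set ℂ} (hU : IsOpen U) {c : ℝ} (hc : 0 < c) (hUc : ∀ ξ ∈ U, c ≤ ‖ξ‖)
    (hN : ∀ ξ ∈ U, ∀ n : ℕ, ‖lam ((n + N : ℕ) + 1) / ξ‖ ≤ 1 / 2) :
    DifferentiableOn ℂ (tailLog lam p N) U := by
  have hinj : Function.Injective fun n : ℕ => ((n + N : ℕ) : ℤ) + 1 := by
    intro a b hab
    simpa using hab
  have hμ : Summable fun n : ℕ => ‖lam ((n + N : ℕ) + 1)‖ ^ p := hl.comp_injective hinj
  refine Complex.differentiableOn_tsum_of_summable_norm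
    ((hμ.div_const (c ^ p)).mul_left 2) (fun n ξ hξ => ?_) hU fun n ξ hξ => ?_
  · have h0 : ξ ≠ 0 := norm_pos_iff.1 (hc.trans_le (hUc ξ hξ))
    have h1 : DifferentiableAt ℂ (fun ξ => lam ((n + N : ℕ) + 1) / ξ) ξ := by
      fun_prop (disch := exact h0)
    exact (DifferentiableAt.comp ξ (differentiableAt_logFactor
      ((hN ξ hξ n).trans_lt (by norm_num))) h1).differentiableWithinAt
  · refine (norm_logFactor_le hp (hN ξ hξ n)).trans ?_
    rw [norm_div, div_pow]
    have := hUc ξ hξ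
    gcongr

theorem summable_prod_range {a : ℕ → ℝ} (ha : ∀ i, 0 < a i) (h : Tendsto a atTop (𝓝 0)) :
    Summable fun j : ℕ => ∏ i ∈ Finset.range j, a i := by
  have hpos : ∀ j, 0 < ∏ i ∈ Finset.range j, a i := fun j => Finset.prod_pos fun i _ => ha i
  refine summable_of_ratio_test_tendsto_lt_one (l := 0) (by norm_num)
    (Eventually.of_forall fun j => (hpos j).ne') ?_
  refine h.congr fun j => ?_
  rw [Finset.prod_range_succ, Real.norm_of_nonneg (mul_pos (hpos j) (ha j)).le,
    Real.norm_of_nonneg (hpos j).le, mul_comm, mul_div_assoc, div_self (hpos j).ne', mul_one]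

/-- Near a nonzero point, the functions `Φ_p⁺ f_n` with large `n` are analytic, dominated by a
summable sequence, and not all zero. -/
theorem exists_local_solution (hp : 1 ≤ p) (hw0 : ∀ n : ℤ, w n ≠ 0) (hw : Memℓp w 2)
    (hlam : Memℓp lam (p : ℝ≥0∞)) (hγ : ∀ n : ℤ, γ n * γ (n + 1) = w n) {z : ℂ} (hz : z ≠ 0) :
    ∃ (U : Set ℂ) (N : ℤ) (u : ℕ → ℝ) (s : ℕ → ℂ → ℂ), IsOpen U ∧ z ∈ U ∧ U ⊆ {0}ᶜ ∧ Summable u ∧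
      (∀ j, DifferentiableOn ℂ (s j) U) ∧
      (∀ j, ∀ ξ ∈ U, ξ ∈ regularSet lam → s j ξ = PhiPlus lam p ξ * solF w lam γ (N + j) ξ) ∧
      (∀ j, ∀ ξ ∈ U, ‖s j ξ‖ ≤ u j) ∧ ∃ j, s j z ≠ 0 := by
  have hl := summable_norm_pow hp hlam
  have ht := tendsto_zero_of_summable_norm_pow hl
  have htw := tendsto_zero_of_summable_norm_pow (summable_norm_sq hw)
  have hzpos : 0 < ‖z‖ := norm_pos_iff.2 hz
  -- On the disc of radius |z|/2 one has |ξ| ≥ |z|/2. The constant 1/8 then gives |λ_k/ξ| ≤ 1/4 and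
  -- |ξ - λ_k| ≥ 3|z|/8 for k > N, more than the two bounds used below.
  obtain ⟨N, hN⟩ : ∃ N : ℕ, ∀ k : ℤ, N < k → ‖lam k‖ ≤ ‖z‖ / 8 := by
    have h1 : Tendsto lam atTop (𝓝 0) := ht.mono_left (by
      rw [Int.cofinite_eq]; exact le_sup_right)
    have h2 := h1.norm.eventually_lt_const (u := ‖z‖ / 8) (by simpa using by positivity)
    obtain ⟨M, hM⟩ := eventually_atTop.1 h2
    exact ⟨M.toNat, fun k hk => (hM k (by omega)).le⟩
  set U₀ := Metric.ball z (‖z‖ / 2) with hU₀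
  have hU₀o : IsOpen U₀ := Metric.isOpen_ball
  have hnorm : ∀ ξ ∈ U₀, ‖z‖ / 2 ≤ ‖ξ‖ := by
    intro ξ hξ
    rw [hU₀, mem_ball_iff_norm, norm_sub_rev] at hξ
    linarith [norm_sub_norm_le z ξ]
  have hratio : ∀ ξ ∈ U₀, ∀ n : ℕ, ‖lam ((n + N : ℕ) + 1) / ξ‖ ≤ 1 / 2 := by
    intro ξ hξ n
    have h1 := hN ((n + N : ℕ) + 1) (by omega)
    have h2 := hnorm ξ hξ
    rw [norm_div, div_le_iff₀ (by linarith)]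
    linarith
  have hdist : ∀ ξ ∈ U₀, ∀ k : ℤ, N < k → ‖z‖ / 4 ≤ ‖ξ - lam k‖ := by
    intro ξ hξ k hk
    linarith [norm_sub_norm_le ξ (lam k), hnorm ξ hξ, hN k hk]
  have hne : ∀ ξ ∈ U₀, ∀ k : ℤ, N < k → ξ - lam k ≠ 0 := fun ξ hξ k hk =>
    norm_pos_iff.1 (lt_of_lt_of_le (by positivity) (hdist ξ hξ k hk))
  have hξ0 : ∀ ξ ∈ U₀, ξ ≠ 0 := fun ξ hξ =>
    norm_pos_iff.1 (lt_of_lt_of_le (by positivity) (hnorm ξ hξ))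
  set α : ℤ → ℝ := fun k => (‖z‖ / 4 * (‖z‖ / 4))⁻¹ * ‖w k‖ ^ 2 with hα_def
  have hα : Summable α := (summable_norm_sq hw).mul_left _
  have hα0 : ∀ k, 0 ≤ α k := fun k => by positivity
  have hx : ∀ ξ ∈ U₀, ∀ k : ℤ, (N : ℤ) + 1 ≤ k →
      ‖ratioSeq lam γ ξ k * ratioSeq lam γ ξ (k + 1)‖ ≤ α k := fun ξ hξ k hk =>
    norm_ratioSeq_mul_le hγ (by positivity) (hdist ξ hξ k (by omega))
      (hdist ξ hξ (k + 1) (by omega))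
  -- Truncating above N discards the λ_k that might lie in the disc, so `y` has no poles there,
  -- while `tailF` at indices beyond N is unchanged.
  set y : ℂ → ℤ → ℂ := fun ξ => truncSeq (ratioSeq lam γ ξ) (N + 1) with hy_def
  have hy : ∀ ξ ∈ U₀, ∀ k, ‖y ξ k * y ξ (k + 1)‖ ≤ α k := fun ξ hξ =>
    norm_truncSeq_mul_le (hx ξ hξ) hα0
  have hyd : ∀ k, DifferentiableOn ℂ (fun ξ => y ξ k * y ξ (k + 1)) U₀ := by
    intro k
    by_cases hk : (N : ℤ) + 1 ≤ k
    · have e : (fun ξ => y ξ k * y ξ (k + 1)) = fun ξ =>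
          w k ^ 2 / ((ξ - lam k) * (ξ - lam (k + 1))) := by
        funext ξ
        simp only [hy_def, truncSeq]
        rw [if_pos hk, if_pos (by omega), ratioSeq_mul hγ]
      rw [e]
      intro ξ hξ
      have h1 := hne ξ hξ k (by omega)
      have h2 := hne ξ hξ (k + 1) (by omega)
      exact DifferentiableAt.differentiableWithinAt (by
        fun_prop (disch := exact mul_ne_zero h1 h2))
    · have e : (fun ξ => y ξ k * y ξ (k + 1)) = fun ξ => 0 := by
        funext ξ
        simp only [hy_def, truncSeq]
        rw [if_neg hk, zero_mul]
      rw [e]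
      exact differentiableOn_const 0
  set A : ℂ → ℂ := fun ξ => headFactor w lam p N ξ * Complex.exp (tailLog lam p N ξ) with hA_def
  have hAd : DifferentiableOn ℂ A U₀ := by
    refine DifferentiableOn.mul ?_ ?_
    · unfold headFactor
      refine DifferentiableOn.fun_finsetProd fun i _ => ?_
      intro ξ hξ
      have h0 := hξ0 ξ hξ
      exact DifferentiableAt.differentiableWithinAt (by fun_prop (disch := exact h0))
    · exact (differentiableOn_tailLog hp hl hU₀o (by positivity) hnorm hratio).cexp
  have hA0 : ∀ ξ ∈ U₀, A ξ ≠ 0 := by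
    intro ξ hξ
    refine mul_ne_zero ?_ (Complex.exp_ne_zero _)
    unfold headFactor
    refine Finset.prod_ne_zero_iff.2 fun i _ => ?_
    exact mul_ne_zero (mul_ne_zero (hw0 _) (inv_ne_zero (hξ0 ξ hξ))) (Complex.exp_ne_zero _)
  set B : ℕ → ℂ → ℂ := fun j ξ =>
    ∏ i ∈ Finset.range j, w (N + i : ℕ) / (ξ - lam ((N + i : ℕ) + 1)) with hB_def
  have hBd : ∀ j, DifferentiableOn ℂ (B j) U₀ := by
    intro j
    refine DifferentiableOn.fun_finsetProd fun i _ => ?_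
    intro ξ hξ
    have h1 := hne ξ hξ ((N + i : ℕ) + 1) (by omega)
    exact DifferentiableAt.differentiableWithinAt (by fun_prop (disch := exact h1))
  have hB0 : ∀ j, ∀ ξ ∈ U₀, B j ξ ≠ 0 := by
    intro j ξ hξ
    exact Finset.prod_ne_zero_iff.2 fun i _ =>
      div_ne_zero (hw0 _) (hne ξ hξ _ (by omega))
  have hBle : ∀ j, ∀ ξ ∈ U₀, ‖B j ξ‖ ≤ ∏ i ∈ Finset.range j, ‖w (N + i : ℕ)‖ / (‖z‖ / 4) := by
    intro j ξ hξ
    simp only [hB_def]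
    rw [norm_prod]
    refine Finset.prod_le_prod (fun _ _ => norm_nonneg _) fun i _ => ?_
    rw [norm_div]
    have h1 := hdist ξ hξ ((N + i : ℕ) + 1) (by omega)
    gcongr
  have hBs : Summable fun j : ℕ => ∏ i ∈ Finset.range j, ‖w (N + i : ℕ)‖ / (‖z‖ / 4) := by
    refine summable_prod_range (fun i => div_pos (norm_pos_iff.2 (hw0 _)) (by positivity)) ?_
    have hinj : Function.Injective fun i : ℕ => ((N + i : ℕ) : ℤ) := by
      intro a b hab
      simpa using hab
    have h1 : Tendsto (fun i : ℕ => w ((N + i : ℕ) : ℤ)) atTop (𝓝 0) := by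
      rw [← Nat.cofinite_eq_atTop]
      exact htw.comp hinj.tendsto_cofinite
    simpa using h1.norm.div_const (‖z‖ / 4)
  have hzU : z ∈ U₀ := Metric.mem_ball_self (by positivity)
  -- The prefactor `A` is continuous but not known to be bounded on the whole disc; a smaller
  -- neighbourhood bounds it.
  have hAz : ∀ᶠ ξ in 𝓝 z, ‖A ξ‖ < ‖A z‖ + 1 :=
    ((hAd.differentiableAt (hU₀o.mem_nhds hzU)).continuousAt.norm).eventually_lt_const (by simp)
  obtain ⟨U₁, hU₁, hU₁o, hzU₁⟩ := eventually_nhds_iff.1 hAz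
  refine ⟨U₀ ∩ U₁, N, fun j => (‖A z‖ + 1) *
      (∏ i ∈ Finset.range j, ‖w (N + i : ℕ)‖ / (‖z‖ / 4)) * Real.exp (∑' k, α k),
    fun j ξ => A ξ * B j ξ * tailF (y ξ) (N + j + 1), hU₀o.inter hU₁o, ⟨hzU, hzU₁⟩,
    fun ξ hξ => hξ0 ξ hξ.1, (hBs.mul_left _).mul_right _, ?_, ?_, ?_, ?_⟩
  · intro j
    exact ((hAd.mul (hBd j)).mul (differentiableOn_tailF hU₀o hα hy hyd _)).mono
      Set.inter_subset_left
  · rintro j ξ ⟨hξ, -⟩ hreg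
    have e := PhiPlus_mul_weightP hp hw0 hl (hξ0 ξ hξ) (sub_ne_zero_of_mem_regularSet hreg)
      (hratio ξ hξ) j
    rw [solF_eq hw hγ hreg, ← mul_assoc]
    push_cast at e ⊢
    rw [e]
    simp only [hy_def, hA_def, hB_def]
    rw [tailF_truncSeq _ _ _ (by omega)]
    push_cast
    rfl
  · rintro j ξ ⟨hξ, hξ₁⟩
    rw [norm_mul, norm_mul]
    have h1 := (hU₁ ξ hξ₁).le
    have h2 := hBle j ξ hξ
    have h3 := norm_tailF_le hα (hy ξ hξ) (N + j + 1)
    exact mul_le_mul (mul_le_mul h1 h2 (norm_nonneg _) (by positivity)) h3 (norm_nonneg _)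
      (mul_nonneg (by positivity) ((norm_nonneg _).trans h2))
  · have h1 : Tendsto (fun j : ℕ => tailF (y z) (N + j + 1)) atTop (𝓝 1) := by
      refine (tendsto_tailF_atTop hα (hy z hzU)).comp ?_
      exact tendsto_atTop_add_const_right _ _ (tendsto_atTop_add_const_left _ _
        tendsto_natCast_atTop_atTop)
    obtain ⟨j, hj⟩ := (h1.eventually_ne one_ne_zero).exists
    exact ⟨j, mul_ne_zero (mul_ne_zero (hA0 z hzU) (hB0 j z hzU)) hj⟩

end Local

/-! ### The regularized functions off the origin -/

/-- A family of solutions of `𝒥 f(ξ) = ξ f(ξ)`, analytic in `ξ ≠ 0`, nontrivial, and locally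
uniformly summable at `+∞`. -/
structure IsDecayingSolution (w lam : ℤ → ℂ) (f : ℤ → ℂ → ℂ) : Prop where
  differentiableOn : ∀ n, DifferentiableOn ℂ (f n) {0}ᶜ
  recurrence : ∀ ξ ≠ 0, ∀ n : ℤ,
    w (n - 1) * f (n - 1) ξ + lam n * f n ξ + w n * f (n + 1) ξ = ξ * f n ξ
  decay : ∀ z ≠ 0, ∀ k : ℤ, ∃ U ∈ 𝓝 z, ∃ u : ℕ → ℝ, Summable u ∧
    ∀ ξ ∈ U, ∀ j : ℕ, ‖f (k + j) ξ‖ ≤ u j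
  exists_ne_zero : ∀ z ≠ 0, ∃ n, f n z ≠ 0

section Regularized

variable {w lam γ : ℤ → ℂ} {p : ℕ}

/-- For n below N the recurrence is solved for its lowest term, which is possible because w never
vanishes. Two consecutive indices are carried through the induction. -/
theorem exists_local_extension (hw0 : ∀ n : ℤ, w n ≠ 0) (hw : Memℓp w 2)
    (hγ : ∀ n : ℤ, γ n * γ (n + 1) = w n) {U : Set ℂ} {N : ℤ} {s : ℕ → ℂ → ℂ}
    (hd : ∀ j, DifferentiableOn ℂ (s j) U)
    (he : ∀ j, ∀ ξ ∈ U, ξ ∈ regularSet lam → s j ξ = PhiPlus lam p ξ * solF w lam γ (N + j) ξ)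
    (n : ℤ) : ∃ t : ℂ → ℂ, DifferentiableOn ℂ t U ∧
      ∀ ξ ∈ U, ξ ∈ regularSet lam → t ξ = PhiPlus lam p ξ * solF w lam γ n ξ := by
  have up : ∀ j : ℕ, ∃ t : ℂ → ℂ, DifferentiableOn ℂ t U ∧
      ∀ ξ ∈ U, ξ ∈ regularSet lam → t ξ = PhiPlus lam p ξ * solF w lam γ (N + j) ξ :=
    fun j => ⟨s j, hd j, he j⟩
  have down : ∀ j : ℕ, (∃ t : ℂ → ℂ, DifferentiableOn ℂ t U ∧
      ∀ ξ ∈ U, ξ ∈ regularSet lam → t ξ = PhiPlus lam p ξ * solF w lam γ (N - j) ξ) ∧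
      ∃ t : ℂ → ℂ, DifferentiableOn ℂ t U ∧
      ∀ ξ ∈ U, ξ ∈ regularSet lam → t ξ = PhiPlus lam p ξ * solF w lam γ (N - j + 1) ξ := by
    intro j
    induction j with
    | zero => exact ⟨by simpa using up 0, by simpa using up 1⟩
    | succ j ih =>
      obtain ⟨⟨t₀, hd₀, he₀⟩, t₁, hd₁, he₁⟩ := ih
      have a1 : N - ((j + 1 : ℕ) : ℤ) = N - j - 1 := by push_cast; ring
      have a2 : N - (j : ℤ) - 1 + 1 = N - j := by ring
      rw [a1, a2]
      refine ⟨⟨fun ξ => (w (N - j - 1))⁻¹ * ((ξ - lam (N - j)) * t₀ ξ - w (N - j) * t₁ ξ),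
        by fun_prop, fun ξ hξ hreg => ?_⟩, t₀, hd₀, he₀⟩
      have r := solF_recurrence hw0 hw hγ hreg (N - j)
      simp only
      rw [he₀ ξ hξ hreg, he₁ ξ hξ hreg, inv_mul_eq_iff_eq_mul₀ (hw0 _)]
      linear_combination (-PhiPlus lam p ξ) * r
  rcases le_total N n with h | h
  · have := up (n - N).toNat
    rwa [show N + ((n - N).toNat : ℤ) = n by omega] at this
  · have := (down (N - n).toNat).1
    rwa [show N - ((N - n).toNat : ℤ) = n by omega] at this

theorem regSolF_eq_of_mem_regularSet (hp : 1 ≤ p) (hw0 : ∀ n : ℤ, w n ≠ 0) (hw : Memℓp w 2)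
    (hlam : Memℓp lam (p : ℝ≥0∞)) (hγ : ∀ n : ℤ, γ n * γ (n + 1) = w n) (n : ℤ) {z : ℂ}
    (hz : z ∈ regularSet lam) :
    regSolF w lam γ p n z = PhiPlus lam p z * solF w lam γ n z := by
  have ht := tendsto_zero_of_summable_norm_pow (summable_norm_pow hp hlam)
  have hz0 := ((mem_regularSet ht).1 hz).1
  obtain ⟨U, N, u, s, hU, hzU, hU0, -, hd, he, -, -⟩ :=
    exists_local_solution hp hw0 hw hlam hγ hz0
  obtain ⟨t, htd, hte⟩ := exists_local_extension hw0 hw hγ hd he n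
  rw [← hte z hzU hz]
  exact limUnder_eq_of_eqOn ht hU htd.continuousOn hte hzU hz0

theorem eq_of_eqOn_regularSet (ht : Tendsto lam cofinite (𝓝 0)) {f g : ℂ → ℂ}
    (hf : ContinuousOn f {0}ᶜ) (hg : ContinuousOn g {0}ᶜ)
    (h : ∀ ξ ∈ regularSet lam, f ξ = g ξ) {z : ℂ} (hz : z ≠ 0) : f z = g z := by
  have hU : ({0}ᶜ : Set ℂ) ∈ 𝓝 z := isOpen_compl_singleton.mem_nhds hz
  have h1 : Tendsto f (𝓝[≠] z) (𝓝 (f z)) :=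
    (hf.continuousAt hU).tendsto.mono_left nhdsWithin_le_nhds
  have h2 : Tendsto g (𝓝[≠] z) (𝓝 (g z)) :=
    (hg.continuousAt hU).tendsto.mono_left nhdsWithin_le_nhds
  refine tendsto_nhds_unique (h1.congr' ?_) h2
  filter_upwards [eventually_mem_regularSet ht hz] with ξ hξ using h ξ hξ

/-- Moving the starting index changes only finitely many terms, each locally bounded by continuity.
-/
theorem decay_of_decay {f : ℤ → ℂ → ℂ} {z : ℂ} (hf : ∀ n, ContinuousAt (f n) z) {N : ℤ}
    (h : ∃ U ∈ 𝓝 z, ∃ u : ℕ → ℝ, Summable u ∧ ∀ ξ ∈ U, ∀ j : ℕ, ‖f (N + j) ξ‖ ≤ u j) (k : ℤ) :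
    ∃ U ∈ 𝓝 z, ∃ u : ℕ → ℝ, Summable u ∧ ∀ ξ ∈ U, ∀ j : ℕ, ‖f (k + j) ξ‖ ≤ u j := by
  have down : ∀ i : ℕ, ∃ U ∈ 𝓝 z, ∃ u : ℕ → ℝ, Summable u ∧
      ∀ ξ ∈ U, ∀ j : ℕ, ‖f (N - i + j) ξ‖ ≤ u j := by
    intro i
    induction i with
    | zero => simpa using h
    | succ i ih =>
      obtain ⟨U, hU, u, hu, hb⟩ := ih
      have hc : ∀ᶠ ξ in 𝓝 z, ‖f (N - (i + 1 : ℕ)) ξ‖ < ‖f (N - (i + 1 : ℕ)) z‖ + 1 :=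
        (hf _).norm.eventually_lt_const (by simp)
      -- The new majorant is the old one with a bound for the additional first term put in front.
      refine ⟨_, inter_mem hU hc, fun j => Nat.casesOn j (‖f (N - (i + 1 : ℕ)) z‖ + 1) u,
        (summable_nat_add_iff 1).1 hu, ?_⟩
      rintro ξ ⟨h1, h2⟩ j
      cases j with
      | zero => simpa using h2.le
      | succ j =>
        have := hb ξ h1 j
        rwa [show N - (i : ℤ) + j = N - (i + 1 : ℕ) + (j + 1 : ℕ) by push_cast; ring] at this
  rcases le_total k N with hk | hk
  · have := down (N - k).toNat
    rwa [show N - ((N - k).toNat : ℤ) = k by omega] at this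
  · obtain ⟨U, hU, u, hu, hb⟩ := h
    refine ⟨U, hU, fun j => u ((k - N).toNat + j), ?_, fun ξ hξ j => ?_⟩
    · exact hu.comp_injective (add_right_injective _)
    · have := hb ξ hξ ((k - N).toNat + j)
      rwa [show N + (((k - N).toNat + j : ℕ) : ℤ) = k + j by omega] at this

theorem isDecayingSolution_regSolF (hp : 1 ≤ p) (hw0 : ∀ n : ℤ, w n ≠ 0) (hw : Memℓp w 2)
    (hlam : Memℓp lam (p : ℝ≥0∞)) (hγ : ∀ n : ℤ, γ n * γ (n + 1) = w n) :
    IsDecayingSolution w lam (regSolF w lam γ p) := by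
  have ht := tendsto_zero_of_summable_norm_pow (summable_norm_pow hp hlam)
  have hdiff : ∀ n, DifferentiableOn ℂ (regSolF w lam γ p n) {0}ᶜ := by
    intro n z hz
    obtain ⟨U, N, u, s, hU, hzU, hU0, -, hd, he, -, -⟩ :=
      exists_local_solution hp hw0 hw hlam hγ hz
    obtain ⟨t, htd, hte⟩ := exists_local_extension hw0 hw hγ hd he n
    have e : Set.EqOn (regSolF w lam γ p n) t U := fun ξ hξ =>
      limUnder_eq_of_eqOn ht hU htd.continuousOn hte hξ (hU0 hξ)
    exact ((htd.congr e).differentiableAt (hU.mem_nhds hzU)).differentiableWithinAt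
  refine ⟨hdiff, ?_, ?_, ?_⟩
  · intro z hz n
    have hc := fun n => (hdiff n).continuousOn
    have c1 := hc (n - 1)
    have c2 := hc n
    have c3 := hc (n + 1)
    refine eq_of_eqOn_regularSet ht (f := fun ξ => w (n - 1) * regSolF w lam γ p (n - 1) ξ +
      lam n * regSolF w lam γ p n ξ + w n * regSolF w lam γ p (n + 1) ξ)
      (g := fun ξ => ξ * regSolF w lam γ p n ξ) (by fun_prop) (by fun_prop) ?_ hz
    intro ξ hξ
    simp only [regSolF_eq_of_mem_regularSet hp hw0 hw hlam hγ _ hξ]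
    linear_combination PhiPlus lam p ξ * solF_recurrence hw0 hw hγ hξ n
  · intro z hz k
    obtain ⟨U, N, u, s, hU, hzU, hU0, hu, hd, he, hb, -⟩ :=
      exists_local_solution hp hw0 hw hlam hγ hz
    refine decay_of_decay (N := N) (fun n => (hdiff n).continuousOn.continuousAt
      (isOpen_compl_singleton.mem_nhds hz)) ⟨U, hU.mem_nhds hzU, u, hu, fun ξ hξ j => ?_⟩ k
    have : regSolF w lam γ p (N + j) ξ = s j ξ :=
      limUnder_eq_of_eqOn ht hU (hd j).continuousOn (he j) hξ (hU0 hξ)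
    rw [this]
    exact hb j ξ hξ
  · intro z hz
    obtain ⟨U, N, u, s, hU, hzU, hU0, hu, hd, he, hb, j, hj⟩ :=
      exists_local_solution hp hw0 hw hlam hγ hz
    refine ⟨N + j, ?_⟩
    have : regSolF w lam γ p (N + j) z = s j z :=
      limUnder_eq_of_eqOn ht hU (hd j).continuousOn (he j) hzU hz
    rwa [this]

/-- The family of solutions which are summable at `-∞`, obtained by reflection. -/
def leftSol (w lam γ : ℤ → ℂ) (p : ℕ) (n : ℤ) (z : ℂ) : ℂ :=
  regSolF (fun k => w (-k)) (reflect lam) (reflect γ) p (1 - n) z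

theorem memℓp_comp_equiv {x : ℤ → ℂ} {q : ℝ≥0∞} (hq : 0 < q.toReal) (hx : Memℓp x q)
    (e : ℤ ≃ ℤ) : Memℓp (fun k => x (e k)) q :=
  memℓp_gen ((e.summable_iff (f := fun k => ‖x k‖ ^ q.toReal)).2 (hx.summable hq))

theorem memℓp_neg_index (hw : Memℓp w 2) : Memℓp (fun k => w (-k)) 2 :=
  memℓp_comp_equiv (by simp) hw (Equiv.neg ℤ)

theorem memℓp_reflect (hp : 1 ≤ p) (hlam : Memℓp lam (p : ℝ≥0∞)) :
    Memℓp (reflect lam) (p : ℝ≥0∞) :=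
  memℓp_comp_equiv (by simp; omega) hlam (Equiv.subLeft 1)

theorem reflect_mul_reflect (hγ : ∀ n : ℤ, γ n * γ (n + 1) = w n) (n : ℤ) :
    reflect γ n * reflect γ (n + 1) = w (-n) := by
  unfold reflect
  rw [← hγ (-n), mul_comm]
  congr 2 <;> ring

theorem regularSet_reflect : regularSet (reflect lam) = regularSet lam := by
  unfold regularSet
  congr 2
  exact (Equiv.subLeft (1 : ℤ)).surjective.range_comp lam

theorem isDecayingSolution_leftSol (hp : 1 ≤ p) (hw0 : ∀ n : ℤ, w n ≠ 0) (hw : Memℓp w 2)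
    (hlam : Memℓp lam (p : ℝ≥0∞)) (hγ : ∀ n : ℤ, γ n * γ (n + 1) = w n) :
    IsDecayingSolution (fun k => w (-k)) (reflect lam)
      (fun n => leftSol w lam γ p (1 - n)) := by
  have := isDecayingSolution_regSolF hp (fun n => hw0 (-n)) (memℓp_neg_index hw)
    (memℓp_reflect hp hlam) (reflect_mul_reflect hγ)
  have e : (fun n => leftSol w lam γ p (1 - n)) =
      regSolF (fun k => w (-k)) (reflect lam) (reflect γ) p := by
    funext n z
    simp [leftSol]
  rwa [e]

theorem PhiPlus_reflect (z : ℂ) : PhiPlus (reflect lam) p z = PhiMinus lam p z := by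
  unfold PhiPlus PhiMinus reflect
  refine tprod_congr fun n => ?_
  congr 3
  ring

/-- The Wronskian of the two decaying solutions. -/
def wronskian (w lam γ : ℤ → ℂ) (p : ℕ) (z : ℂ) : ℂ :=
  regSolF w lam γ p 0 z * leftSol w lam γ p 1 z - regSolF w lam γ p 1 z * leftSol w lam γ p 0 z

theorem wronskian_eq (hp : 1 ≤ p) (hw0 : ∀ n : ℤ, w n ≠ 0) (hw : Memℓp w 2)
    (hlam : Memℓp lam (p : ℝ≥0∞)) (hγ : ∀ n : ℤ, γ n * γ (n + 1) = w n) {z : ℂ}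
    (hz : z ∈ regularSet lam) :
    wronskian w lam γ p z = Phi lam p z * charFn lam γ z := by
  have hz' : z ∈ regularSet (reflect lam) := by rwa [regularSet_reflect]
  have hw' := memℓp_neg_index hw
  have hγ' := reflect_mul_reflect hγ
  have e := fun n => regSolF_eq_of_mem_regularSet hp hw0 hw hlam hγ n hz
  have e' := fun n => regSolF_eq_of_mem_regularSet hp (fun n => hw0 (-n)) hw'
    (memℓp_reflect hp hlam) hγ' n hz'
  unfold wronskian leftSol
  rw [e, e, e', e', charFn_eq_wronskian hw hγ hz hw' hz' hγ', PhiPlus_reflect, Phi]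
  simp only [sub_self, sub_zero]
  ring

theorem differentiableOn_wronskian (hp : 1 ≤ p) (hw0 : ∀ n : ℤ, w n ≠ 0) (hw : Memℓp w 2)
    (hlam : Memℓp lam (p : ℝ≥0∞)) (hγ : ∀ n : ℤ, γ n * γ (n + 1) = w n) :
    DifferentiableOn ℂ (wronskian w lam γ p) {0}ᶜ := by
  have hf := (isDecayingSolution_regSolF hp hw0 hw hlam hγ).differentiableOn
  have hg := (isDecayingSolution_regSolF hp (fun n => hw0 (-n)) (memℓp_neg_index hw)
    (memℓp_reflect hp hlam) (reflect_mul_reflect hγ)).differentiableOn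
  exact ((hf 0).mul (hg _)).sub ((hf 1).mul (hg _))

/-- The Wronskian is analytic off the origin and equals ΦF on the regular set, so it is the
extension of ΦF. -/
theorem regCharFn_eq_wronskian (hp : 1 ≤ p) (hw0 : ∀ n : ℤ, w n ≠ 0) (hw : Memℓp w 2)
    (hlam : Memℓp lam (p : ℝ≥0∞)) (hγ : ∀ n : ℤ, γ n * γ (n + 1) = w n) {z : ℂ} (hz : z ≠ 0) :
    regCharFn lam γ p z = wronskian w lam γ p z :=
  limUnder_eq_of_eqOn (tendsto_zero_of_summable_norm_pow (summable_norm_pow hp hlam))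
    isOpen_compl_singleton (differentiableOn_wronskian hp hw0 hw hlam hγ).continuousOn
    (fun _ _ hreg => wronskian_eq hp hw0 hw hlam hγ hreg) hz hz

end Regularized

/-! ### Everywhere defined bounded operators -/

section Bounded

variable {H : Type*} [NormedAddCommGroup H] [NormedSpace ℂ H]

/-- `A` is the everywhere defined operator given by the bounded operator `T`. -/
def IsTotal (A : H →ₗ.[ℂ] H) (T : H →L[ℂ] H) : Prop :=
  A.domain = ⊤ ∧ ∀ x : A.domain, A x = T x

variable {A : H →ₗ.[ℂ] H} {T : H →L[ℂ] H}

theorem IsTotal.mem_domain (hA : IsTotal A T) (x : H) : x ∈ A.domain := by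
  rw [hA.1]
  trivial

theorem IsTotal.mem_pointSpec (hA : IsTotal A T) {z : ℂ} :
    z ∈ pointSpec A ↔ ∃ x : H, x ≠ 0 ∧ T x = z • x := by
  constructor
  · rintro ⟨x, h0, hx⟩
    exact ⟨x, h0, by rw [← hx, hA.2]⟩
  · rintro ⟨x, h0, hx⟩
    exact ⟨⟨x, hA.mem_domain x⟩, h0, by rw [hA.2]; exact hx⟩

theorem IsTotal.mem_kerPow (hA : IsTotal A T) {z : ℂ} {n : ℕ} {v : H} :
    v ∈ kerPow A z n ↔ ((T - z • 1) ^ n) v = 0 := by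
  induction n generalizing v with
  | zero => simp [kerPow]
  | succ n ih =>
    have e : ((T - z • 1) ^ (n + 1)) v = ((T - z • 1) ^ n) (T v - z • v) := by
      rw [pow_succ]
      simp
    rw [e, ← ih]
    constructor
    · rintro ⟨x, hx, rfl⟩
      have h : A x - z • (x : H) ∈ kerPow A z n := hx
      rwa [hA.2] at h
    · intro h
      refine ⟨⟨v, hA.mem_domain v⟩, ?_, rfl⟩
      change A ⟨v, hA.mem_domain v⟩ - z • v ∈ kerPow A z n
      rwa [hA.2]

theorem IsTotal.isResolventAt (hA : IsTotal A T) {z : ℂ} {R : H →L[ℂ] H} :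
    IsResolventAt A z R ↔ (∀ y, T (R y) - z • R y = y) ∧ ∀ x, R (T x - z • x) = x := by
  constructor
  · rintro ⟨h1, h2⟩
    refine ⟨fun y => ?_, fun x => ?_⟩
    · obtain ⟨h, hy⟩ := h1 y
      rwa [hA.2] at hy
    · have := h2 ⟨x, hA.mem_domain x⟩
      rwa [hA.2] at this
  · rintro ⟨h1, h2⟩
    refine ⟨fun y => ⟨hA.mem_domain _, ?_⟩, fun x => ?_⟩
    · rw [hA.2]
      exact h1 y
    · rw [hA.2]
      exact h2 x

/-- The minus sign reconciles (A - z)⁻¹ with Mathlib's convention (z - T)⁻¹. -/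
theorem IsTotal.isResolventAt_of_isUnit (hA : IsTotal A T) {z : ℂ}
    (h : z ∈ _root_.resolventSet ℂ T) : IsResolventAt A z (-_root_.resolvent T z) := by
  have h1 : (algebraMap ℂ (H →L[ℂ] H) z - T) * _root_.resolvent T z = 1 :=
    Ring.mul_inverse_cancel _ h
  have h2 : _root_.resolvent T z * (algebraMap ℂ (H →L[ℂ] H) z - T) = 1 :=
    Ring.inverse_mul_cancel _ h
  rw [hA.isResolventAt]
  refine ⟨fun y => ?_, fun x => ?_⟩
  · have := DFunLike.congr_fun h1 y
    simp only [Algebra.algebraMap_eq_smul_one, mul_apply_eq_comp,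
      sub_apply, smul_apply,
      one_apply_eq_self] at this
    rw [neg_apply, map_neg, smul_neg, neg_sub_neg]
    exact this
  · have := DFunLike.congr_fun h2 x
    simp only [Algebra.algebraMap_eq_smul_one, mul_apply_eq_comp,
      sub_apply, smul_apply,
      one_apply_eq_self] at this
    rw [neg_apply, ← map_neg, neg_sub]
    exact this

theorem IsTotal.mem_resolventSet (hA : IsTotal A T) {z : ℂ} :
    z ∈ resolventSet A ↔ z ∈ _root_.resolventSet ℂ T := by
  constructor
  · rintro ⟨R, hR⟩
    rw [hA.isResolventAt] at hR
    refine ⟨⟨algebraMap ℂ (H →L[ℂ] H) z - T, -R, ?_, ?_⟩, rfl⟩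
    · ext y
      simp only [Algebra.algebraMap_eq_smul_one, mul_apply_eq_comp,
        sub_apply, smul_apply,
        one_apply_eq_self, neg_apply, map_neg]
      rw [neg_sub]
      exact hR.1 y
    · ext x
      simp only [Algebra.algebraMap_eq_smul_one, mul_apply_eq_comp,
        sub_apply, smul_apply,
        one_apply_eq_self, neg_apply]
      rw [← map_neg, neg_sub]
      exact hR.2 x
  · intro h
    exact ⟨_, hA.isResolventAt_of_isUnit h⟩

theorem isResolventAt_resolvent {z : ℂ} (hz : z ∈ resolventSet A) :
    IsResolventAt A z (resolvent A z) := by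
  unfold resolvent
  rw [dif_pos hz]
  exact hz.choose_spec

theorem IsTotal.apply_resolvent (hA : IsTotal A T) {z : ℂ} (hz : z ∈ resolventSet A) (y : H) :
    T (resolvent A z y) - z • resolvent A z y = y :=
  (hA.isResolventAt.1 (isResolventAt_resolvent hz)).1 y

theorem IsTotal.resolvent_apply (hA : IsTotal A T) {z : ℂ} (hz : z ∈ resolventSet A) (x : H) :
    resolvent A z (T x - z • x) = x :=
  (hA.isResolventAt.1 (isResolventAt_resolvent hz)).2 x

theorem IsTotal.continuousOn_resolvent [CompleteSpace H] (hA : IsTotal A T) :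
    ContinuousOn (resolvent A) (resolventSet A) := by
  have h1 : ContinuousOn (fun z => -_root_.resolvent T z) (resolventSet A) := by
    intro z hz
    exact (spectrum.hasDerivAt_resolvent_const_left
      (hA.mem_resolventSet.1 hz)).continuousAt.neg.continuousWithinAt
  refine h1.congr fun z hz => ?_
  exact (isResolventAt_resolvent hz).unique
    (hA.isResolventAt_of_isUnit (hA.mem_resolventSet.1 hz))

/-! ### The Riesz projection of an everywhere defined operator -/

theorem circleIntegral_comp_comm [CompleteSpace H] {F : Type*} [NormedAddCommGroup F]
    [NormedSpace ℂ F] [CompleteSpace F] (L : H →L[ℂ] F) {f : ℂ → H} {c : ℂ} {r : ℝ}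
    (hf : CircleIntegrable f c r) : (∮ ξ in C(c, r), L (f ξ)) = L (∮ ξ in C(c, r), f ξ) := by
  unfold circleIntegral
  rw [← L.intervalIntegral_comp_comm hf.out]
  simp

variable {z : ℂ} {r : ℝ}

theorem IsIsolatingRadius.sphere_subset (hr : IsIsolatingRadius A z r) :
    Metric.sphere z r ⊆ resolventSet A := fun ξ hξ =>
  hr.2 ⟨Metric.sphere_subset_closedBall hξ, fun h => by
    rw [Set.mem_singleton_iff.1 h, mem_sphere_iff_norm, sub_self, norm_zero] at hξ
    exact hr.1.ne hξ⟩

theorem IsIsolatingRadius.sub_ne_zero (hr : IsIsolatingRadius A z r) {ξ : ℂ}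
    (hξ : ξ ∈ Metric.sphere z r) : ξ - z ≠ 0 := by
  rw [mem_sphere_iff_norm] at hξ
  exact norm_pos_iff.1 (hξ ▸ hr.1)

/-- Trades `v` for (T - z)v, lowering the order of a generalized eigenvector at the cost of one
factor (ξ - z)⁻¹. -/
theorem IsTotal.resolvent_apply_eq (hA : IsTotal A T) {ξ : ℂ} (hξ : ξ ∈ resolventSet A)
    (hne : ξ - z ≠ 0) (v : H) :
    resolvent A ξ v = (ξ - z)⁻¹ • (resolvent A ξ (T v - z • v) - v) := by
  have h1 := hA.resolvent_apply hξ v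
  have h2 : T v - ξ • v = (T v - z • v) - (ξ - z) • v := by module
  rw [h2, map_sub, map_smul] at h1
  rw [eq_inv_smul_iff₀ hne]
  exact eq_sub_of_add_eq' (sub_eq_iff_eq_add.1 h1).symm

variable [CompleteSpace H]

theorem IsTotal.circleIntegrable_zpow_smul (hA : IsTotal A T) (hr : IsIsolatingRadius A z r)
    (i : ℤ) (y : H) : CircleIntegrable (fun ξ => (ξ - z) ^ i • resolvent A ξ y) z r := by
  refine ContinuousOn.circleIntegrable hr.1.le ?_
  have h1 : ContinuousOn (fun ξ => resolvent A ξ y) (Metric.sphere z r) :=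
    (hA.continuousOn_resolvent.mono hr.sphere_subset).clm_apply continuousOn_const
  refine ContinuousOn.smul (ContinuousOn.zpow₀ (by fun_prop) i fun ξ hξ => ?_) h1
  exact Or.inl (hr.sub_ne_zero hξ)

theorem IsTotal.circleIntegrable_resolvent (hA : IsTotal A T) (hr : IsIsolatingRadius A z r) :
    CircleIntegrable (resolvent A) z r :=
  ContinuousOn.circleIntegrable hr.1.le (hA.continuousOn_resolvent.mono hr.sphere_subset)

theorem IsTotal.rieszProjection_apply (hA : IsTotal A T) (hr : IsIsolatingRadius A z r) (y : H) :
    rieszProjection A z r y =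
      (-(2 * (π : ℂ) * Complex.I)⁻¹) • ∮ ξ in C(z, r), resolvent A ξ y := by
  unfold rieszProjection
  rw [smul_apply]
  congr 1
  exact (circleIntegral_comp_comm (ContinuousLinearMap.apply ℂ H y)
    (hA.circleIntegrable_resolvent hr)).symm

/-- Induction on the order k, with the exponent i left free. One exchange of v for (T - z)v raises i
to i + 1, so the inductive integral vanishes; what remains is -∮(ξ - z)^(-i-1) v, which is nonzero
only for i = 0. -/
theorem IsTotal.circleIntegral_of_mem_kerPow (hA : IsTotal A T) (hr : IsIsolatingRadius A z r)
    {k : ℕ} {v : H} (hv : ((T - z • 1) ^ k) v = 0) (i : ℕ) :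
    (∮ ξ in C(z, r), (ξ - z) ^ (-(i : ℤ)) • resolvent A ξ v) =
      if i = 0 then -(2 * (π : ℂ) * Complex.I) • v else 0 := by
  induction k generalizing v i with
  | zero =>
    have : v = 0 := by simpa using hv
    simp [this, circleIntegral]
  | succ k ih =>
    have hv' : ((T - z • 1) ^ k) (T v - z • v) = 0 := by
      rw [pow_succ] at hv
      simpa using hv
    have e1 : (∮ ξ in C(z, r), (ξ - z) ^ (-(i : ℤ)) • resolvent A ξ v) =
        ∮ ξ in C(z, r), ((ξ - z) ^ (-((i + 1 : ℕ) : ℤ)) • resolvent A ξ (T v - z • v) -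
          (ξ - z) ^ (-((i + 1 : ℕ) : ℤ)) • v) := by
      refine circleIntegral.integral_congr hr.1.le fun ξ hξ => ?_
      have hne := hr.sub_ne_zero hξ
      rw [hA.resolvent_apply_eq (hr.sphere_subset hξ) hne v, smul_smul, ← smul_sub]
      congr 1
      rw [← zpow_sub_one₀ hne]
      congr 1
      push_cast
      ring
    have hint : CircleIntegrable (fun ξ => (ξ - z) ^ (-((i + 1 : ℕ) : ℤ)) • v) z r := by
      refine ContinuousOn.circleIntegrable hr.1.le ?_
      refine ContinuousOn.smul (ContinuousOn.zpow₀ (by fun_prop) _ fun ξ hξ => ?_)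
        continuousOn_const
      exact Or.inl (hr.sub_ne_zero hξ)
    rw [e1, circleIntegral.integral_sub (hA.circleIntegrable_zpow_smul hr _ _) hint, ih hv',
      if_neg (Nat.succ_ne_zero i), circleIntegral.integral_smul_const]
    by_cases hi : i = 0
    · subst hi
      have : (∮ ξ in C(z, r), (ξ - z) ^ (-((0 + 1 : ℕ) : ℤ))) = 2 * π * Complex.I := by
        simp [circleIntegral.integral_sub_center_inv z hr.1.ne']
      rw [this, if_pos rfl]
      simp
    · rw [circleIntegral.integral_sub_zpow_of_ne (by push_cast; omega), if_neg hi]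
      simp

/-- The Riesz projection fixes the generalized eigenvectors. -/
theorem IsTotal.rieszProjection_of_mem_kerPow (hA : IsTotal A T) (hr : IsIsolatingRadius A z r)
    {k : ℕ} {v : H} (hv : v ∈ kerPow A z k) : rieszProjection A z r v = v := by
  have := hA.circleIntegral_of_mem_kerPow hr (hA.mem_kerPow.1 hv) 0
  simp only [Nat.cast_zero, neg_zero, zpow_zero, one_smul, if_true] at this
  rw [hA.rieszProjection_apply hr, this, smul_smul, neg_mul_neg,
    inv_mul_cancel₀ Complex.two_pi_I_ne_zero, one_smul]

/-- (T - z)(T - ξ)⁻¹y = y + (ξ - z)(T - ξ)⁻¹y, and the first term, multiplied by a nonnegative power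
of ξ - z, integrates to zero. -/
theorem IsTotal.pow_circleIntegral (hA : IsTotal A T) (hr : IsIsolatingRadius A z r) (y : H)
    (i : ℕ) : ((T - z • 1) ^ i) (∮ ξ in C(z, r), resolvent A ξ y) =
      ∮ ξ in C(z, r), (ξ - z) ^ (i : ℤ) • resolvent A ξ y := by
  induction i with
  | zero => simp
  | succ i ih =>
    rw [pow_succ', mul_apply_eq_comp, ih,
      ← circleIntegral_comp_comm _ (hA.circleIntegrable_zpow_smul hr i y)]
    have e1 : (∮ ξ in C(z, r), (T - z • 1) ((ξ - z) ^ (i : ℤ) • resolvent A ξ y)) =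
        ∮ ξ in C(z, r), ((ξ - z) ^ (i : ℤ) • y +
          (ξ - z) ^ ((i + 1 : ℕ) : ℤ) • resolvent A ξ y) := by
      refine circleIntegral.integral_congr hr.1.le fun ξ hξ => ?_
      have hne := hr.sub_ne_zero hξ
      have h1 := hA.apply_resolvent (hr.sphere_subset hξ) y
      have h2 : T (resolvent A ξ y) - z • resolvent A ξ y = y + (ξ - z) • resolvent A ξ y := by
        nth_rewrite 3 [← h1]
        module
      simp only [map_smul, sub_apply, smul_apply,
        one_apply_eq_self]
      rw [h2, smul_add, smul_smul, Nat.cast_succ, zpow_add_one₀ hne]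
    have hint : CircleIntegrable (fun ξ => (ξ - z) ^ (i : ℤ) • y) z r := by
      refine ContinuousOn.circleIntegrable hr.1.le ?_
      simp only [zpow_natCast]
      fun_prop
    rw [e1, circleIntegral.integral_add hint (hA.circleIntegrable_zpow_smul hr _ _),
      circleIntegral.integral_smul_const, circleIntegral.integral_sub_zpow_of_ne (by omega),
      zero_smul, zero_add]

/-- If `(ξ - z)^m (A - ξ)⁻¹ y` has vanishing circle integral for a total set of vectors `y`, and
all generalized eigenvectors lie in `Ker (A - z)^m`, then this is the range of the Riesz
projection. -/
theorem IsTotal.range_rieszProjection (hA : IsTotal A T) (hr : IsIsolatingRadius A z r) {m : ℕ}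
    {ι : Type*} {e : ι → H} (he : (Submodule.span ℂ (Set.range e)).topologicalClosure = ⊤)
    (h : ∀ i, (∮ ξ in C(z, r), (ξ - z) ^ (m : ℤ) • resolvent A ξ (e i)) = 0) :
    ((rieszProjection A z r).range : Set H) = kerPow A z m := by
  -- Continuity and density reduce the vanishing of (T - z)^m P to the vectors e_i.
  have h1 : ((T - z • 1) ^ m).comp (rieszProjection A z r) = 0 := by
    refine ContinuousLinearMap.ext_on (s := Set.range e) ?_ ?_
    · rw [dense_iff_closure_eq, ← Submodule.topologicalClosure_coe, he]
      rfl
    · rintro _ ⟨i, rfl⟩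
      rw [ContinuousLinearMap.comp_apply, hA.rieszProjection_apply hr, map_smul,
        hA.pow_circleIntegral hr, h i]
      simp
  ext v
  constructor
  · rintro ⟨y, rfl⟩
    exact hA.mem_kerPow.2 (DFunLike.congr_fun h1 y)
  · intro hv
    exact ⟨v, hA.rieszProjection_of_mem_kerPow hr hv⟩

end Bounded

/-! ### Jordan chains -/

section Chain

variable {V : Type*} [AddCommGroup V] [Module ℂ V] {S : V →ₗ[ℂ] V} {D : ℕ → V} {m : ℕ}

/-- Applying S to a linear relation gives a shorter one whose coefficients are nonzero multiples of
c₁, c₂, …; what survives is c₀D₀ = 0. -/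
theorem linearIndependent_chain (h0 : S (D 0) = 0) (hD0 : D 0 ≠ 0)
    (hS : ∀ j, j + 1 < m → S (D (j + 1)) = ((j : ℂ) + 1) • D j) :
    LinearIndependent ℂ fun j : Fin m => D j := by
  rw [Fintype.linearIndependent_iff]
  suffices H : ∀ k ≤ m, ∀ c : ℕ → ℂ, ∑ j ∈ Finset.range k, c j • D j = 0 → ∀ j < k, c j = 0 by
    intro g hg i
    have := H m le_rfl (fun j => if h : j < m then g ⟨j, h⟩ else 0) ?_ i i.2
    · simpa using this
    · rw [Finset.sum_range]
      simpa using hg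
  intro k
  induction k with
  | zero => intro _ _ _ j hj; omega
  | succ k ih =>
    intro hk c hc
    have h1 : ∑ j ∈ Finset.range k, (c (j + 1) * ((j : ℂ) + 1)) • D j = 0 := by
      have := congrArg S hc
      rw [Finset.sum_range_succ', map_add, map_sum, map_smul, h0, smul_zero, add_zero,
        map_zero] at this
      rw [← this]
      refine Finset.sum_congr rfl fun j hj => ?_
      rw [map_smul, hS j (by have := Finset.mem_range.1 hj; omega), smul_smul]
    have h2 := ih (by omega) _ h1
    have h3 : ∀ j < k, c (j + 1) = 0 := fun j hj => by
      rcases mul_eq_zero.1 (h2 j hj) with h | h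
      · exact h
      · exact absurd h (Nat.cast_add_one_ne_zero j)
    intro j hj
    cases j with
    | succ j => exact h3 j (by omega)
    | zero =>
      rw [Finset.sum_range_succ', Finset.sum_eq_zero, zero_add] at hc
      · exact (smul_eq_zero.1 hc).resolve_right hD0
      · intro j hj
        rw [h3 j (Finset.mem_range.1 hj), zero_smul]

theorem chain_mem_ker_pow (h0 : S (D 0) = 0)
    (hS : ∀ j, j + 1 < m → S (D (j + 1)) = ((j : ℂ) + 1) • D j) {j : ℕ} (hj : j < m) :
    (S ^ (j + 1)) (D j) = 0 := by
  induction j with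
  | zero => simpa using h0
  | succ j ih => rw [pow_succ, Module.End.mul_apply, hS j hj, map_smul, ih (by omega), smul_zero]

/-- A Jordan chain whose last vector is not in the range spans the generalized eigenspace. -/
theorem ker_pow_le_span_chain (hm : 0 < m)
    (hS : ∀ j, j + 1 < m → S (D (j + 1)) = ((j : ℂ) + 1) • D j)
    (hker : ∀ y, S y = 0 → ∃ c : ℂ, y = c • D 0) (hlast : ∀ y, S y ≠ D (m - 1)) (n : ℕ) (y : V)
    (hy : (S ^ n) y = 0) : y ∈ Submodule.span ℂ (Set.range fun j : Fin m => D j) := by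
  have hmem : ∀ j < m, D j ∈ Submodule.span ℂ (Set.range fun j : Fin m => D j) :=
    fun j hj => Submodule.subset_span ⟨⟨j, hj⟩, rfl⟩
  induction n generalizing y with
  | zero =>
    have : y = 0 := by simpa using hy
    rw [this]
    exact Submodule.zero_mem _
  | succ n ih =>
    have h1 := ih (S y) (by rwa [pow_succ, Module.End.mul_apply] at hy)
    obtain ⟨q, rfl⟩ : ∃ q, m = q + 1 := ⟨m - 1, by omega⟩
    obtain ⟨c, hc⟩ := (Submodule.mem_span_range_iff_exists_fun ℂ).1 h1
    rw [Fin.sum_univ_castSucc] at hc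
    simp only [Fin.val_castSucc, Fin.val_last, Nat.add_sub_cancel] at hc hlast
    -- An explicit preimage under S of all terms but the last; the factor (j + 1)⁻¹ undoes the one
    -- in the chain relation.
    set Y : V := ∑ j : Fin q, (c j.castSucc * ((j : ℂ) + 1)⁻¹) • D (j + 1) with hY
    have hSY : S Y = ∑ j : Fin q, c j.castSucc • D j := by
      rw [hY, map_sum]
      refine Finset.sum_congr rfl fun j _ => ?_
      rw [map_smul, hS j (by omega), smul_smul, mul_assoc,
        inv_mul_cancel₀ (Nat.cast_add_one_ne_zero _), mul_one]
    -- A nonzero last coefficient would put D_{m-1} into the range of S.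
    have hcq : c (Fin.last q) = 0 := by
      by_contra hne
      refine hlast ((c (Fin.last q))⁻¹ • (y - Y)) ?_
      rw [map_smul, map_sub, hSY, ← hc, add_sub_cancel_left, inv_smul_smul₀ hne]
    rw [hcq, zero_smul, add_zero] at hc
    obtain ⟨a, ha⟩ := hker (y - Y) (by rw [map_sub, hSY, hc, sub_self])
    rw [sub_eq_iff_eq_add.1 ha]
    refine Submodule.add_mem _ (Submodule.smul_mem _ _ (hmem 0 (by omega))) ?_
    exact Submodule.sum_mem _ fun j _ => Submodule.smul_mem _ _ (hmem _ (by omega))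

end Chain

/-! ### The Jacobi operator as a compact operator -/

section Operator

theorem toReal_two_pos : 0 < (2 : ℝ≥0∞).toReal := by simp

theorem memℓp_mul {a x : ℤ → ℂ} {C : ℝ} (ha : ∀ n, ‖a n‖ ≤ C) (hx : Memℓp x 2) :
    Memℓp (fun n => a n * x n) 2 := by
  refine ((memℓp_norm_iff.2 hx).const_mul C).mono fun n => ?_
  rw [norm_mul]
  exact mul_le_mul_of_nonneg_right (ha n) (norm_nonneg _)

theorem norm_le_mul_norm {x y : L2Z} {C : ℝ} (hC : 0 ≤ C) (h : ∀ n, ‖x n‖ ≤ C * ‖y n‖) :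
    ‖x‖ ≤ C * ‖y‖ := by
  have h1 : ‖x‖ ≤ ‖(C : ℂ) • y‖ := by
    refine lp.norm_mono (by norm_num) fun n => ?_
    rw [lp.coeFn_smul, Pi.smul_apply, norm_smul, Complex.norm_real, Real.norm_of_nonneg hC]
    exact h n
  rwa [norm_smul, Complex.norm_real, Real.norm_of_nonneg hC] at h1

theorem lp_single_apply (i : ℤ) (a : ℂ) (n : ℤ) :
    (lp.single 2 i a : L2Z) n = if n = i then a else 0 := by
  rw [lp.single_apply]
  exact Pi.single_apply i a n

theorem exists_mulOp (a : ℤ → ℂ) {C : ℝ} (ha : ∀ n, ‖a n‖ ≤ C) :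
    ∃ M : L2Z →L[ℂ] L2Z, ∀ x n, M x n = a n * x n := by
  have hC : 0 ≤ C := (norm_nonneg _).trans (ha 0)
  refine ⟨LinearMap.mkContinuous
    { toFun := fun x => ⟨fun n => a n * x n, memℓp_mul ha (lp.memℓp x)⟩
      map_add' := fun x y => ?_
      map_smul' := fun c x => ?_ } C fun x => norm_le_mul_norm hC fun n => ?_, fun x n => rfl⟩
  · apply Subtype.ext
    funext n
    exact mul_add _ _ _
  · apply Subtype.ext
    funext n
    exact mul_left_comm _ _ _
  · change ‖a n * x n‖ ≤ _
    rw [norm_mul]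
    exact mul_le_mul_of_nonneg_right (ha n) (norm_nonneg _)

theorem exists_compOp (e : ℤ ≃ ℤ) : ∃ M : L2Z →L[ℂ] L2Z, ∀ x n, M x n = x (e n) := by
  refine ⟨LinearMap.mkContinuous
    { toFun := fun x => ⟨fun n => x (e n), memℓp_comp_equiv toReal_two_pos (lp.memℓp x) e⟩
      map_add' := fun x y => rfl
      map_smul' := fun c x => rfl } 1 fun x => ?_, fun x n => rfl⟩
  rw [one_mul, lp.norm_eq_tsum_rpow toReal_two_pos, lp.norm_eq_tsum_rpow toReal_two_pos]
  refine le_of_eq ?_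
  congr 1
  exact e.tsum_eq fun n => ‖x n‖ ^ (2 : ℝ≥0∞).toReal

/-- The finite truncations have finite rank and converge in operator norm because the diagonal tends
to zero. -/
theorem isCompactOperator_of_diagonal {a : ℤ → ℂ} (ha : Tendsto a cofinite (𝓝 0))
    {M : L2Z →L[ℂ] L2Z} (hM : ∀ x n, M x n = a n * x n) : IsCompactOperator M := by
  set F : Finset ℤ → L2Z →L[ℂ] L2Z := fun s => ∑ i ∈ s, a i •
    (lp.singleContinuousLinearMap ℂ (fun _ : ℤ => ℂ) 2 i).comp (lp.evalCLM ℂ (fun _ => ℂ) 2 i)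
    with hF
  have hFapply : ∀ s x n, F s x n = if n ∈ s then a n * x n else 0 := by
    intro s x n
    have : F s x n = lp.evalCLM ℂ (fun _ : ℤ => ℂ) 2 n (F s x) := rfl
    rw [this, hF]
    simp only [sum_apply, map_sum]
    have h2 : ∀ i ∈ s, lp.evalCLM ℂ (fun _ : ℤ => ℂ) 2 n ((a i •
        (lp.singleContinuousLinearMap ℂ (fun _ : ℤ => ℂ) 2 i).comp
          (lp.evalCLM ℂ (fun _ => ℂ) 2 i)) x) = if n = i then a i * x i else 0 := by
      intro i _
      change a i * (lp.single 2 i (x i) : L2Z) n = _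
      rw [lp_single_apply]
      split_ifs with h
      · subst h; rfl
      · exact mul_zero _
    rw [Finset.sum_congr rfl h2, Finset.sum_ite_eq]
  refine isCompactOperator_of_tendsto (l := atTop) (F := F) ?_ (Eventually.of_forall fun s => ?_)
  · rw [tendsto_iff_norm_sub_tendsto_zero, Metric.tendsto_nhds]
    intro ε hε
    have hfin : {n | ¬ ‖a n‖ < ε / 2}.Finite := by
      have := ha.norm.eventually_lt_const (u := ε / 2) (by simpa using half_pos hε)
      exact this
    filter_upwards [eventually_ge_atTop hfin.toFinset] with s hs
    rw [Real.dist_eq, sub_zero, abs_of_nonneg (norm_nonneg _)]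
    refine lt_of_le_of_lt (ContinuousLinearMap.opNorm_le_bound _ (half_pos hε).le fun x => ?_)
      (half_lt_self hε)
    refine norm_le_mul_norm (half_pos hε).le fun n => ?_
    have e : ((F s - M) x) n = F s x n - M x n := rfl
    rw [e, hFapply, hM]
    split_ifs with h
    · rw [sub_self, norm_zero]
      positivity
    · rw [zero_sub, norm_neg, norm_mul]
      refine mul_le_mul_of_nonneg_right ?_ (norm_nonneg _)
      by_contra hc
      exact h (hs (hfin.mem_toFinset.2 fun h' => hc h'.le))
  · have : F s ∈ compactOperator (RingHom.id ℂ) L2Z L2Z := by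
      refine Submodule.sum_mem _ fun i _ => Submodule.smul_mem _ _ ?_
      have h1 : IsCompactOperator (lp.singleContinuousLinearMap ℂ (fun _ : ℤ => ℂ) 2 i) :=
        isCompactOperator_of_locallyCompactSpace_rng _
      exact h1.comp_clm (lp.evalCLM ℂ (fun _ : ℤ => ℂ) 2 i)
    exact this

variable {w lam : ℤ → ℂ}

theorem exists_bound_of_tendsto_zero {a : ℤ → ℂ} (ha : Tendsto a cofinite (𝓝 0)) :
    ∃ C : ℝ, ∀ n, ‖a n‖ ≤ C := by
  have := ha.norm.isBoundedUnder_le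
  obtain ⟨C, hC⟩ := this.bddAbove_range_of_cofinite
  exact ⟨C, fun n => hC ⟨n, rfl⟩⟩

/-- The Jacobi matrix acts on `ℓ²(ℤ)` as a compact operator. -/
theorem exists_jacobi_clm (hw : Tendsto w cofinite (𝓝 0)) (hlam : Tendsto lam cofinite (𝓝 0)) :
    ∃ T : L2Z →L[ℂ] L2Z, (∀ x : L2Z, (T x : ℤ → ℂ) = jacobiMatrix w lam x) ∧
      IsCompactOperator T := by
  obtain ⟨Cw, hCw⟩ := exists_bound_of_tendsto_zero hw
  obtain ⟨Cl, hCl⟩ := exists_bound_of_tendsto_zero hlam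
  obtain ⟨Mw, hMw⟩ := exists_mulOp w hCw
  obtain ⟨Ml, hMl⟩ := exists_mulOp lam hCl
  obtain ⟨S, hS⟩ := exists_compOp (Equiv.addRight 1)
  obtain ⟨S', hS'⟩ := exists_compOp (Equiv.subRight 1)
  refine ⟨S'.comp Mw + Ml + Mw.comp S, fun x => ?_, ?_⟩
  · funext n
    change S' (Mw x) n + Ml x n + Mw (S x) n = _
    rw [hS', hMw, hMl, hMw, hS]
    rfl
  · exact (((isCompactOperator_of_diagonal hw hMw).clm_comp S').add
      (isCompactOperator_of_diagonal hlam hMl)).add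
      ((isCompactOperator_of_diagonal hw hMw).comp_clm S)

variable {T : L2Z →L[ℂ] L2Z}

theorem isTotal_jacobiMax (hT : ∀ x : L2Z, (T x : ℤ → ℂ) = jacobiMatrix w lam x) :
    IsTotal (jacobiMax w lam) T := by
  refine ⟨?_, fun x => ?_⟩
  · rw [Submodule.eq_top_iff']
    intro x
    change Memℓp (jacobiMatrix w lam x) 2
    rw [← hT x]
    exact lp.memℓp _
  · apply Subtype.ext
    exact (hT x).symm

theorem topologicalClosure_finiteSequences : finiteSequences.topologicalClosure = ⊤ := by
  rw [Submodule.eq_top_iff']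
  intro x
  refine mem_closure_of_tendsto (lp.hasSum_single (by norm_num) x)
    (Eventually.of_forall fun s => ?_)
  refine Submodule.sum_mem _ fun i _ => ?_
  have : lp.single 2 i (x i) = x i • (lp.single 2 i (1 : ℂ) : L2Z) := by
    rw [← lp.single_smul, smul_eq_mul, mul_one]
  rw [this]
  exact Submodule.smul_mem _ _ (Submodule.subset_span ⟨i, rfl⟩)

theorem isClosed_jacobiMax (hA : IsTotal (jacobiMax w lam) T) : (jacobiMax w lam).IsClosed := by
  have e : ((jacobiMax w lam).graph : Set (L2Z × L2Z)) = {q | q.2 = T q.1} := by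
    ext q
    rw [SetLike.mem_coe, LinearPMap.mem_graph_iff]
    constructor
    · rintro ⟨y, h1, h2⟩
      change q.2 = T q.1
      rw [← h2, hA.2, h1]
    · intro h
      exact ⟨⟨q.1, hA.mem_domain _⟩, rfl, by rw [hA.2]; exact h.symm⟩
  unfold LinearPMap.IsClosed
  rw [e]
  exact isClosed_eq continuous_snd (T.continuous.comp continuous_fst)

theorem isClosable_jacobiZero (hA : IsTotal (jacobiMax w lam) T) :
    (jacobiZero w lam).IsClosable :=
  (isClosed_jacobiMax hA).isClosable.leIsClosable LinearPMap.domRestrict_le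

/-- The set of x with (x, Tx) in the closed graph of J₀ is closed and contains the dense space of
finite sequences. -/
theorem jacobiMin_eq_jacobiMax (hA : IsTotal (jacobiMax w lam) T) :
    jacobiMin w lam = jacobiMax w lam := by
  have hc := isClosable_jacobiZero hA
  apply LinearPMap.eq_of_eq_graph
  unfold jacobiMin
  rw [← hc.graph_closure_eq_closure_graph]
  apply le_antisymm
  · exact Submodule.topologicalClosure_minimal _
      (LinearPMap.le_graph_of_le LinearPMap.domRestrict_le) (isClosed_jacobiMax hA)
  · intro q hq
    rw [LinearPMap.mem_graph_iff] at hq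
    obtain ⟨y, h1, h2⟩ := hq
    have e : q = (q.1, T q.1) := by
      rw [Prod.ext_iff]
      exact ⟨rfl, by rw [← h2, hA.2, h1]⟩
    rw [e]
    set p : Set L2Z := {x | ((x, T x) : L2Z × L2Z) ∈
      ((jacobiZero w lam).graph.topologicalClosure : Set (L2Z × L2Z))} with hp
    have hpc : IsClosed p :=
      (Submodule.isClosed_topologicalClosure _).preimage (by fun_prop)
    have hsub : (finiteSequences : Set L2Z) ⊆ p := by
      intro x hx
      apply Submodule.le_topologicalClosure
      rw [LinearPMap.mem_graph_iff]
      have hx' : x ∈ (jacobiZero w lam).domain := by rwa [jacobiZero_domain]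
      refine ⟨⟨x, hx'⟩, rfl, ?_⟩
      exact hA.2 ⟨x, hA.mem_domain x⟩
    have hx : q.1 ∈ (finiteSequences.topologicalClosure : Set L2Z) := by
      rw [topologicalClosure_finiteSequences]
      trivial
    exact closure_minimal hsub hpc hx

theorem not_finiteDimensional_L2Z : ¬ FiniteDimensional ℂ L2Z := by
  intro h
  have hli : LinearIndependent ℂ fun n : ℤ => (lp.single 2 n (1 : ℂ) : L2Z) := by
    rw [linearIndependent_iff']
    intro s g hg i hi
    have := congrArg (lp.evalCLM ℂ (fun _ : ℤ => ℂ) 2 i) hg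
    rw [map_sum, map_zero] at this
    have h2 : ∀ j ∈ s, lp.evalCLM ℂ (fun _ : ℤ => ℂ) 2 i
        (g j • (lp.single 2 j (1 : ℂ) : L2Z)) = if i = j then g j else 0 := by
      intro j _
      change g j * (lp.single 2 j (1 : ℂ) : L2Z) i = _
      rw [lp_single_apply]
      split_ifs
      · exact mul_one _
      · exact mul_zero _
    rw [Finset.sum_congr rfl h2, Finset.sum_ite_eq, if_pos hi] at this
    exact this
  have := hli.finite
  exact not_finite ℤ

/-- A bounded inverse would make the identity compact, forcing ℓ²(ℤ) to be finite-dimensional. -/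
theorem zero_mem_spec {A : L2Z →ₗ.[ℂ] L2Z} (hA : IsTotal A T) (hT : IsCompactOperator T) :
    (0 : ℂ) ∈ spec A := by
  rintro ⟨R, hR⟩
  rw [hA.isResolventAt] at hR
  have h1 : IsCompactOperator (R ∘ T) := hT.clm_comp R
  have h2 : (R ∘ T : L2Z → L2Z) = id := by
    funext x
    simpa using hR.2 x
  rw [h2] at h1
  exact not_finiteDimensional_L2Z (FiniteDimensional.of_isCompactOperator_id h1)

theorem mem_spec_iff_mem_pointSpec {A : L2Z →ₗ.[ℂ] L2Z} (hA : IsTotal A T)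
    (hT : IsCompactOperator T) {z : ℂ} (hz : z ≠ 0) : z ∈ spec A ↔ z ∈ pointSpec A := by
  have h1 : z ∈ spec A ↔ z ∈ spectrum ℂ T := by
    unfold spec
    rw [Set.mem_compl_iff, hA.mem_resolventSet]
    rfl
  rw [h1, ← hT.hasEigenvalue_iff_mem_spectrum hz, hA.mem_pointSpec]
  constructor
  · intro h
    obtain ⟨x, hx⟩ := h.exists_hasEigenvector
    exact ⟨x, hx.2, hx.apply_eq_smul⟩
  · rintro ⟨x, h0, hx⟩
    exact Module.End.hasEigenvalue_of_hasEigenvector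
      ⟨Module.End.mem_eigenspace_iff.2 hx, h0⟩

end Operator

/-! ### Solutions of the difference equation -/

section Difference

variable {w lam : ℤ → ℂ} {z : ℂ}

/-- `a` is a solution of `𝒥 a = z a`. -/
def IsSolution (w lam : ℤ → ℂ) (z : ℂ) (a : ℤ → ℂ) : Prop :=
  ∀ n : ℤ, w (n - 1) * a (n - 1) + lam n * a n + w n * a (n + 1) = z * a n

theorem IsSolution.sub_smul {a b : ℤ → ℂ} (ha : IsSolution w lam z a) (hb : IsSolution w lam z b)
    (c : ℂ) : IsSolution w lam z fun n => a n - c * b n := by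
  intro n
  linear_combination ha n - c * hb n

theorem IsSolution.eq_zero (hw0 : ∀ n, w n ≠ 0) {a : ℤ → ℂ} (ha : IsSolution w lam z a)
    (h0 : a 0 = 0) (h1 : a 1 = 0) (n : ℤ) : a n = 0 := by
  suffices H : ∀ n, a n = 0 ∧ a (n + 1) = 0 from (H n).1
  intro n
  induction n using Int.induction_on with
  | zero => exact ⟨h0, by simpa using h1⟩
  | succ i ih =>
    refine ⟨ih.2, ?_⟩
    have h := ha (i + 1)
    rw [add_sub_cancel_right, ih.1, ih.2] at h
    simpa [hw0] using h
  | pred i ih =>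
    have h := ha (-i)
    rw [ih.1, ih.2] at h
    refine ⟨by simpa [hw0] using h, by simpa using ih.1⟩

theorem IsSolution.exists_eq_mul (hw0 : ∀ n, w n ≠ 0) {a b : ℤ → ℂ} (ha : IsSolution w lam z a)
    (hb : IsSolution w lam z b) (h : a 0 * b 1 = a 1 * b 0) (hne : ∃ n, b n ≠ 0) :
    ∃ c : ℂ, ∀ n, a n = c * b n := by
  by_cases h0 : b 0 = 0
  · have h1 : b 1 ≠ 0 := by
      intro h1
      obtain ⟨n, hn⟩ := hne
      exact hn (hb.eq_zero hw0 h0 h1 n)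
    refine ⟨a 1 / b 1, fun n => sub_eq_zero.1 ((ha.sub_smul hb _).eq_zero hw0 ?_ ?_ n)⟩
    · rw [h0, mul_zero] at h
      rw [h0, (mul_eq_zero.1 h).resolve_right h1]
      simp
    · field_simp
      ring
  · refine ⟨a 0 / b 0, fun n => sub_eq_zero.1 ((ha.sub_smul hb _).eq_zero hw0 ?_ ?_ n)⟩
    · field_simp
      ring
    · field_simp
      linear_combination -h

/-- The weighted Wronskian of two solutions does not depend on n; this constancy decides
proportionality from the behaviour at infinity. -/
theorem IsSolution.wronskian_eq {a b : ℤ → ℂ} (ha : IsSolution w lam z a)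
    (hb : IsSolution w lam z b) (n : ℤ) :
    w n * (a n * b (n + 1) - a (n + 1) * b n) = w 0 * (a 0 * b 1 - a 1 * b 0) := by
  have step : ∀ n, w n * (a n * b (n + 1) - a (n + 1) * b n) =
      w (n - 1) * (a (n - 1) * b n - a n * b (n - 1)) := by
    intro n
    linear_combination a n * hb n - b n * ha n
  induction n using Int.induction_on with
  | zero => simp
  | succ i ih =>
    rw [step]
    simpa using ih
  | pred i ih =>
    rw [step] at ih
    simpa using ih

theorem eq_pred_of_tendsto_zero {v : ℤ → ℂ} {N : ℤ} (hbot : Tendsto v atBot (𝓝 0))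
    (htop : Tendsto v atTop (𝓝 0)) (h : ∀ n, n ≠ N → v n = v (n - 1)) : v N = 0 ∧ v (N - 1) = 0 := by
  have up : ∀ j : ℕ, v (N + j) = v N := by
    intro j
    induction j with
    | zero => simp
    | succ j ih =>
      rw [h _ (by omega), ← ih]
      congr 1
      push_cast
      ring
  have down : ∀ j : ℕ, v (N - 1 - j) = v (N - 1) := by
    intro j
    induction j with
    | zero => simp
    | succ j ih =>
      rw [← ih, h (N - 1 - j) (by omega)]
      congr 1
      push_cast
      ring
  constructor
  · refine tendsto_nhds_unique (tendsto_const_nhds.congr' ?_) htop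
    filter_upwards [eventually_ge_atTop N] with n hn
    rw [← up (n - N).toNat]
    congr 1
    omega
  · refine tendsto_nhds_unique (tendsto_const_nhds.congr' ?_) hbot
    filter_upwards [eventually_le_atBot (N - 1)] with n hn
    rw [← down (N - 1 - n).toNat]
    congr 1
    omega

theorem tendsto_wronskian {l : Filter ℤ} {C : ℝ} (hC : ∀ n, ‖w n‖ ≤ C) {a b : ℤ → ℂ}
    (ha : Tendsto a l (𝓝 0)) (ha' : Tendsto (fun n => a (n + 1)) l (𝓝 0))
    (hb : Tendsto b l (𝓝 0)) (hb' : Tendsto (fun n => b (n + 1)) l (𝓝 0)) :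
    Tendsto (fun n => w n * (a n * b (n + 1) - a (n + 1) * b n)) l (𝓝 0) := by
  have h1 : Tendsto (fun n => a n * b (n + 1) - a (n + 1) * b n) l (𝓝 0) := by
    simpa using (ha.mul hb').sub (ha'.mul hb)
  refine squeeze_zero_norm (a := fun n => C * ‖a n * b (n + 1) - a (n + 1) * b n‖)
    (fun n => ?_) (by simpa using h1.norm.const_mul C)
  rw [norm_mul]
  exact mul_le_mul_of_nonneg_right (hC n) (norm_nonneg _)

theorem tendsto_comp_add_one_atTop {a : ℤ → ℂ} (ha : Tendsto a atTop (𝓝 0)) :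
    Tendsto (fun n => a (n + 1)) atTop (𝓝 0) :=
  ha.comp (tendsto_atTop_add_const_right _ 1 tendsto_id)

theorem tendsto_comp_add_one_atBot {a : ℤ → ℂ} (ha : Tendsto a atBot (𝓝 0)) :
    Tendsto (fun n => a (n + 1)) atBot (𝓝 0) :=
  ha.comp (tendsto_atBot_add_const_right _ 1 tendsto_id)

theorem lp_tendsto_zero (x : L2Z) : Tendsto x cofinite (𝓝 0) :=
  tendsto_zero_of_summable_norm_pow (summable_norm_sq (lp.memℓp x))

theorem lp_tendsto_zero_atTop (x : L2Z) : Tendsto x atTop (𝓝 0) :=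
  (lp_tendsto_zero x).mono_left (by rw [Int.cofinite_eq]; exact le_sup_right)

theorem lp_tendsto_zero_atBot (x : L2Z) : Tendsto x atBot (𝓝 0) :=
  (lp_tendsto_zero x).mono_left (by rw [Int.cofinite_eq]; exact le_sup_left)

/-- Basis vectors at which an eigenvector does not vanish are not in the range of `J - z`. -/
theorem apply_eq_zero_of_range {C : ℝ} (hC : ∀ n, ‖w n‖ ≤ C) {d y : L2Z} {N : ℤ}
    (hd : IsSolution w lam z d)
    (hy : ∀ n : ℤ, w (n - 1) * y (n - 1) + lam n * y n + w n * y (n + 1) - z * y n =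
      if n = N then 1 else 0) : d N = 0 := by
  -- The weighted Wronskian of y and d is constant apart from a jump of -d_N at N. Being zero at
  -- both infinities, it is zero on both sides, so the jump vanishes.
  have step : ∀ n, w n * (y n * d (n + 1) - y (n + 1) * d n) =
      w (n - 1) * (y (n - 1) * d n - y n * d (n - 1)) - d n * if n = N then 1 else 0 := by
    intro n
    linear_combination y n * hd n - d n * hy n
  have key := eq_pred_of_tendsto_zero (N := N)
    (v := fun n => w n * (y n * d (n + 1) - y (n + 1) * d n))
    (tendsto_wronskian hC (lp_tendsto_zero_atBot y)
      (tendsto_comp_add_one_atBot (lp_tendsto_zero_atBot y)) (lp_tendsto_zero_atBot d)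
      (tendsto_comp_add_one_atBot (lp_tendsto_zero_atBot d)))
    (tendsto_wronskian hC (lp_tendsto_zero_atTop y)
      (tendsto_comp_add_one_atTop (lp_tendsto_zero_atTop y)) (lp_tendsto_zero_atTop d)
      (tendsto_comp_add_one_atTop (lp_tendsto_zero_atTop d))) fun n hn => by
        rw [step n, if_neg hn]
        simp
  have h1 := step N
  simp only [sub_add_cancel] at key
  rw [key.1, key.2, if_pos rfl] at h1
  simpa using h1

end Difference

/-! ### Vector-valued analytic functions -/

section Vector

/-- The series ∑ h_j e_{i(j)} converges locally uniformly in ℓ², because ‖h_j e_{i(j)}‖ = |h_j| has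
a summable majorant. This turns entrywise analyticity into analyticity of an ℓ²-valued function. -/
theorem exists_vector_function {h : ℕ → ℂ → ℂ} {i : ℕ → ℤ} (hi : Function.Injective i)
    (hd : ∀ j, DifferentiableOn ℂ (h j) {0}ᶜ)
    (hb : ∀ z ≠ 0, ∃ U ∈ 𝓝 z, ∃ u : ℕ → ℝ, Summable u ∧ ∀ ξ ∈ U, ∀ j, ‖h j ξ‖ ≤ u j) :
    ∃ V : ℂ → L2Z, DifferentiableOn ℂ V {0}ᶜ ∧ ∀ ξ ≠ 0, (∀ j, V ξ (i j) = h j ξ) ∧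
      ∀ n, (∀ j, i j ≠ n) → V ξ n = 0 := by
  set t : ℕ → ℂ → L2Z := fun j ξ => h j ξ • lp.single 2 (i j) (1 : ℂ) with ht
  have hnorm : ∀ j ξ, ‖t j ξ‖ = ‖h j ξ‖ := by
    intro j ξ
    rw [ht]
    simp only
    rw [norm_smul, lp.norm_single (by norm_num), norm_one, mul_one]
  refine ⟨fun ξ => ∑' j, t j ξ, ?_, ?_⟩
  · intro z hz
    obtain ⟨U, hU, u, hu, hbu⟩ := hb z hz
    obtain ⟨U', hU', hU'o, hzU'⟩ :=
      mem_nhds_iff.1 (inter_mem hU (isOpen_compl_singleton.mem_nhds hz))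
    have h1 : DifferentiableOn ℂ (fun ξ => ∑' j, t j ξ) U' := by
      refine Complex.differentiableOn_tsum_of_summable_norm hu (fun j => ?_) hU'o
        fun j ξ hξ => ?_
      · exact ((hd j).mono fun ξ hξ => (hU' hξ).2).smul_const _
      · rw [hnorm]
        exact hbu ξ (hU' hξ).1 j
    exact (h1.differentiableAt (hU'o.mem_nhds hzU')).differentiableWithinAt
  · intro ξ hξ
    obtain ⟨U, hU, u, hu, hbu⟩ := hb ξ hξ
    have hs : Summable fun j => t j ξ :=
      Summable.of_norm_bounded hu fun j => by
        rw [hnorm]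
        exact hbu ξ (mem_of_mem_nhds hU) j
    have happ : ∀ n, (∑' j, t j ξ : L2Z) n = ∑' j, if n = i j then h j ξ else 0 := by
      intro n
      have h1 := (lp.evalCLM ℂ (fun _ : ℤ => ℂ) 2 n).map_tsum hs
      refine h1.trans (tsum_congr fun j => ?_)
      change h j ξ * (lp.single 2 (i j) (1 : ℂ) : L2Z) n = _
      rw [lp_single_apply]
      split_ifs
      · exact mul_one _
      · exact mul_zero _
    refine ⟨fun j => ?_, fun n hn => ?_⟩
    · rw [happ, tsum_eq_single j]
      · simp
      · intro k hk
        rw [if_neg fun h => hk (hi h).symm]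
    · rw [happ]
      simp [fun j => (hn j).symm]

/-- Leibniz rule for a linear factor; at ξ = z only the term (j + 1)u^(j) survives, which is the
chain relation. -/
theorem iteratedDeriv_sub_smul {E : Type*} [NormedAddCommGroup E] [NormedSpace ℂ E]
    [CompleteSpace E] {u : ℂ → E} {z : ℂ} (hu : AnalyticAt ℂ u z) (j : ℕ) :
    iteratedDeriv (j + 1) (fun ξ => (ξ - z) • u ξ) =ᶠ[𝓝 z]
      fun ξ => (ξ - z) • iteratedDeriv (j + 1) u ξ + ((j : ℂ) + 1) • iteratedDeriv j u ξ := by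
  have hd : ∀ v : ℂ → E, (∀ᶠ ξ in 𝓝 z, DifferentiableAt ℂ v ξ) →
      (deriv fun ξ => (ξ - z) • v ξ) =ᶠ[𝓝 z] fun ξ => (ξ - z) • deriv v ξ + v ξ := by
    intro v hv
    filter_upwards [hv] with ξ hξ
    have h1 : HasDerivAt (fun ξ : ℂ => ξ - z) 1 ξ := (hasDerivAt_id ξ).sub_const z
    have := (h1.smul hξ.hasDerivAt).deriv
    rw [one_smul] at this
    exact this
  have han : ∀ k, ∀ᶠ ξ in 𝓝 z, DifferentiableAt ℂ (iteratedDeriv k u) ξ := by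
    intro k
    filter_upwards [hu.eventually_analyticAt] with ξ hξ
    rw [iteratedDeriv_eq_iterate]
    exact (hξ.iterated_deriv k).differentiableAt
  induction j with
  | zero =>
    have := hd u (by simpa using han 0)
    simpa using this
  | succ j ih =>
    rw [iteratedDeriv_succ]
    refine ih.deriv.trans ?_
    have h1 := hd _ (han (j + 1))
    filter_upwards [h1, han (j + 1), han j] with ξ e1 e2 e3
    have h2 : deriv (fun ξ => (ξ - z) • iteratedDeriv (j + 1) u ξ +
        ((j : ℂ) + 1) • iteratedDeriv j u ξ) ξ =
        deriv (fun ξ => (ξ - z) • iteratedDeriv (j + 1) u ξ) ξ +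
          ((j : ℂ) + 1) • deriv (iteratedDeriv j u) ξ := by
      have d1 : DifferentiableAt ℂ (fun ξ => (ξ - z) • iteratedDeriv (j + 1) u ξ) ξ :=
        DifferentiableAt.smul (by fun_prop) e2
      exact (d1.hasDerivAt.add (e3.hasDerivAt.const_smul ((j : ℂ) + 1))).deriv
    rw [h2, e1, ← iteratedDeriv_succ (n := j), ← iteratedDeriv_succ (n := j + 1)]
    push_cast
    module

theorem iteratedDeriv_clm_apply {E F : Type*} [NormedAddCommGroup E] [NormedSpace ℂ E]
    [CompleteSpace E] [NormedAddCommGroup F] [NormedSpace ℂ F] (L : E →L[ℂ] F) {u : ℂ → E} {z : ℂ}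
    (hu : AnalyticAt ℂ u z) (j : ℕ) :
    iteratedDeriv j (fun ξ => L (u ξ)) z = L (iteratedDeriv j u z) := by
  rw [iteratedDeriv_eq_iteratedFDeriv, iteratedDeriv_eq_iteratedFDeriv]
  have := L.iteratedFDeriv_comp_left (f := u) (x := z) (n := j) (i := j) hu.contDiffAt le_rfl
  change iteratedFDeriv ℂ j (L ∘ u) z _ = _
  rw [this]
  rfl

end Vector

/-! ### Spectral analysis by means of the two decaying solutions -/

section Spectral

variable {w lam : ℤ → ℂ} {f g : ℤ → ℂ → ℂ} {T : L2Z →L[ℂ] L2Z} {C : ℝ}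

/-- The Wronskian of `f` and `g` at the origin, divided by `w₀`. -/
def wronskianZero (f g : ℤ → ℂ → ℂ) (z : ℂ) : ℂ := f 0 z * g 1 z - f 1 z * g 0 z

theorem IsDecayingSolution.isSolution (hf : IsDecayingSolution w lam f) {z : ℂ} (hz : z ≠ 0) :
    IsSolution w lam z fun n => f n z :=
  hf.recurrence z hz

theorem IsDecayingSolution.isSolution_left
    (hg : IsDecayingSolution (fun k => w (-k)) (reflect lam) fun n => g (1 - n)) {z : ℂ}
    (hz : z ≠ 0) : IsSolution w lam z fun n => g n z := by
  intro n
  have h := hg.recurrence z hz (1 - n)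
  have e1 : (1 : ℤ) - (1 - n - 1) = n + 1 := by ring
  have e2 : (1 : ℤ) - (1 - n) = n := by ring
  have e3 : (1 : ℤ) - (1 - n + 1) = n - 1 := by ring
  have e4 : -((1 : ℤ) - n - 1) = n := by ring
  have e5 : -((1 : ℤ) - n) = n - 1 := by ring
  simp only [reflect, e1, e2, e3, e4, e5] at h
  linear_combination h

theorem IsDecayingSolution.differentiableOn_left
    (hg : IsDecayingSolution (fun k => w (-k)) (reflect lam) fun n => g (1 - n)) (n : ℤ) :
    DifferentiableOn ℂ (g n) {0}ᶜ := by
  simpa using hg.differentiableOn (1 - n)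

theorem IsDecayingSolution.decay_left
    (hg : IsDecayingSolution (fun k => w (-k)) (reflect lam) fun n => g (1 - n)) {z : ℂ}
    (hz : z ≠ 0) (k : ℤ) : ∃ U ∈ 𝓝 z, ∃ u : ℕ → ℝ, Summable u ∧
      ∀ ξ ∈ U, ∀ j : ℕ, ‖g (k - j) ξ‖ ≤ u j := by
  obtain ⟨U, hU, u, hu, hb⟩ := hg.decay z hz (1 - k)
  refine ⟨U, hU, u, hu, fun ξ hξ j => ?_⟩
  have := hb ξ hξ j
  rwa [show (1 : ℤ) - (1 - k + j) = k - j by ring] at this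

theorem IsDecayingSolution.tendsto (hf : IsDecayingSolution w lam f) {z : ℂ} (hz : z ≠ 0) :
    Tendsto (fun n => f n z) atTop (𝓝 0) := by
  obtain ⟨U, hU, u, hu, hb⟩ := hf.decay z hz 0
  have h1 : Tendsto (fun j : ℕ => f j z) atTop (𝓝 0) :=
    squeeze_zero_norm (fun j => by simpa using hb z (mem_of_mem_nhds hU) j)
      hu.tendsto_atTop_zero
  have h2 : Tendsto Int.toNat atTop atTop :=
    tendsto_atTop_atTop.2 fun b => ⟨b, fun a ha => by omega⟩
  refine (h1.comp h2).congr' ?_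
  filter_upwards [eventually_ge_atTop 0] with n hn
  simp only [Function.comp_apply]
  rw [Int.toNat_of_nonneg hn]

theorem IsDecayingSolution.tendsto_left
    (hg : IsDecayingSolution (fun k => w (-k)) (reflect lam) fun n => g (1 - n)) {z : ℂ}
    (hz : z ≠ 0) : Tendsto (fun n => g n z) atBot (𝓝 0) := by
  have h1 := (hg.tendsto hz).comp
    (tendsto_atTop_add_const_left _ (1 : ℤ) tendsto_neg_atBot_atTop)
  refine h1.congr fun n => ?_
  simp

theorem differentiableOn_wronskianZero (hf : IsDecayingSolution w lam f)
    (hg : IsDecayingSolution (fun k => w (-k)) (reflect lam) fun n => g (1 - n)) :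
    DifferentiableOn ℂ (wronskianZero f g) {0}ᶜ :=
  ((hf.differentiableOn 0).mul (hg.differentiableOn_left 1)).sub
    ((hf.differentiableOn 1).mul (hg.differentiableOn_left 0))

theorem jacobi_apply (hT : ∀ x : L2Z, (T x : ℤ → ℂ) = jacobiMatrix w lam x) (x : L2Z) (z : ℂ)
    (n : ℤ) : (T x - z • x) n =
      w (n - 1) * x (n - 1) + lam n * x n + w n * x (n + 1) - z * x n := by
  rw [lp.coeFn_sub, lp.coeFn_smul, hT]
  rfl

theorem isSolution_iff (hT : ∀ x : L2Z, (T x : ℤ → ℂ) = jacobiMatrix w lam x) {x : L2Z} {z : ℂ} :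
    IsSolution w lam z x ↔ T x - z • x = 0 := by
  constructor
  · intro h
    apply lp.ext
    funext n
    rw [jacobi_apply hT, h n, sub_self]
    rfl
  · intro h n
    have := jacobi_apply hT x z n
    rw [h] at this
    exact (sub_eq_zero.1 this.symm)

/-- The numerator of Green's function. -/
theorem exists_green (hT : ∀ x : L2Z, (T x : ℤ → ℂ) = jacobiMatrix w lam x)
    (hf : IsDecayingSolution w lam f)
    (hg : IsDecayingSolution (fun k => w (-k)) (reflect lam) fun n => g (1 - n)) (N : ℤ) :
    ∃ U : ℂ → L2Z, DifferentiableOn ℂ U {0}ᶜ ∧ ∀ ξ ≠ 0,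
      (∀ n, U ξ n = if N ≤ n then g N ξ * f n ξ else f N ξ * g n ξ) ∧
      T (U ξ) - ξ • U ξ = -(w 0 * wronskianZero f g ξ) • lp.single 2 N (1 : ℂ) := by
  -- `R` carries the entries of f at indices from N on, `L` those of g below N; the coefficients g_N
  -- and f_N make the two pieces match at N.
  obtain ⟨R, hRd, hR⟩ := exists_vector_function (h := fun j => f (N + j))
    (i := fun j : ℕ => N + j) (add_natCast_injective N) (fun j => hf.differentiableOn _)
    (fun z hz => hf.decay z hz N)
  obtain ⟨L, hLd, hL⟩ := exists_vector_function (h := fun j => g (N - 1 - j))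
    (i := fun j : ℕ => N - 1 - j) (fun a b hab => by simpa using hab)
    (fun j => hg.differentiableOn_left _) (fun z hz => hg.decay_left hz (N - 1))
  have hU : ∀ ξ ≠ 0, ∀ n, (g N ξ • R ξ + f N ξ • L ξ : L2Z) n =
      if N ≤ n then g N ξ * f n ξ else f N ξ * g n ξ := by
    intro ξ hξ n
    change g N ξ * R ξ n + f N ξ * L ξ n = _
    split_ifs with h
    · have h1 := (hR ξ hξ).1 (n - N).toNat
      rw [show N + ((n - N).toNat : ℤ) = n by omega] at h1
      rw [h1, (hL ξ hξ).2 n (fun j => by omega), mul_zero, add_zero]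
    · have h1 := (hL ξ hξ).1 (N - 1 - n).toNat
      rw [show N - 1 - ((N - 1 - n).toNat : ℤ) = n by omega] at h1
      rw [h1, (hR ξ hξ).2 n (fun j => by omega), mul_zero, zero_add]
  refine ⟨fun ξ => g N ξ • R ξ + f N ξ • L ξ,
    ((hg.differentiableOn_left N).smul hRd).add ((hf.differentiableOn N).smul hLd),
    fun ξ hξ => ⟨hU ξ hξ, ?_⟩⟩
  have sf := hf.isSolution hξ
  have sg := hg.isSolution_left hξ
  apply lp.ext
  funext n
  rw [jacobi_apply hT, hU ξ hξ, hU ξ hξ, hU ξ hξ]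
  change _ = -(w 0 * wronskianZero f g ξ) * (lp.single 2 N (1 : ℂ) : L2Z) n
  rw [lp_single_apply]
  rcases lt_trichotomy n N with h | h | h
  · rw [if_neg (show ¬ N ≤ n - 1 by omega), if_neg (show ¬ N ≤ n by omega),
      if_neg (show ¬ n = N by omega)]
    rcases eq_or_ne (n + 1) N with h' | h'
    · rw [if_pos h'.ge, ← h']
      linear_combination f (n + 1) ξ * sg n
    · rw [if_neg (show ¬ N ≤ n + 1 by omega)]
      linear_combination f N ξ * sg n
  · subst h
    rw [if_neg (show ¬ n ≤ n - 1 by omega), if_pos le_rfl, if_pos (show n ≤ n + 1 by omega),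
      if_pos rfl]
    -- At n = N the left neighbour comes from g and the right one from f; the defect in the equation
    -- is the weighted Wronskian.
    have h1 := sf.wronskian_eq sg n
    simp only [wronskianZero]
    linear_combination f n ξ * sg n - h1
  · rw [if_pos (show N ≤ n - 1 by omega), if_pos (show N ≤ n by omega),
      if_pos (show N ≤ n + 1 by omega), if_neg (show ¬ n = N by omega)]
    linear_combination g N ξ * sf n

/-- Eigenvectors are multiples of `f`. -/
theorem eq_mul_right (hw0 : ∀ n, w n ≠ 0) (hC : ∀ n, ‖w n‖ ≤ C)
    (hf : IsDecayingSolution w lam f) {z : ℂ} (hz : z ≠ 0) {x : L2Z}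
    (hx : IsSolution w lam z x) : ∃ c : ℂ, ∀ n, x n = c * f n z := by
  have sf := hf.isSolution hz
  have h1 := tendsto_wronskian hC (lp_tendsto_zero_atTop x)
    (tendsto_comp_add_one_atTop (lp_tendsto_zero_atTop x)) (hf.tendsto hz)
    (tendsto_comp_add_one_atTop (hf.tendsto hz))
  have h2 := tendsto_nhds_unique h1 (tendsto_const_nhds.congr fun n => (hx.wronskian_eq sf n).symm)
  refine hx.exists_eq_mul hw0 sf ?_ (hf.exists_ne_zero z hz)
  exact sub_eq_zero.1 ((mul_eq_zero.1 h2.symm).resolve_left (hw0 0))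

/-- Eigenvectors are multiples of `g`. -/
theorem eq_mul_left (hw0 : ∀ n, w n ≠ 0) (hC : ∀ n, ‖w n‖ ≤ C)
    (hg : IsDecayingSolution (fun k => w (-k)) (reflect lam) fun n => g (1 - n)) {z : ℂ}
    (hz : z ≠ 0) {x : L2Z} (hx : IsSolution w lam z x) : ∃ c : ℂ, ∀ n, x n = c * g n z := by
  have sg := hg.isSolution_left hz
  have h1 := tendsto_wronskian hC (lp_tendsto_zero_atBot x)
    (tendsto_comp_add_one_atBot (lp_tendsto_zero_atBot x)) (hg.tendsto_left hz)
    (tendsto_comp_add_one_atBot (hg.tendsto_left hz))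
  have h2 := tendsto_nhds_unique h1 (tendsto_const_nhds.congr fun n => (hx.wronskian_eq sg n).symm)
  obtain ⟨m, hm⟩ := hg.exists_ne_zero z hz
  refine hx.exists_eq_mul hw0 sg ?_ ⟨1 - m, hm⟩
  exact sub_eq_zero.1 ((mul_eq_zero.1 h2.symm).resolve_left (hw0 0))

theorem exists_ne_zero_of_wronskianZero (hw0 : ∀ n, w n ≠ 0) (hf : IsDecayingSolution w lam f)
    (hg : IsDecayingSolution (fun k => w (-k)) (reflect lam) fun n => g (1 - n)) {z : ℂ}
    (hz : z ≠ 0) (hW : wronskianZero f g z = 0) : ∃ N, f N z ≠ 0 ∧ g N z ≠ 0 := by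
  obtain ⟨m, hm⟩ := hg.exists_ne_zero z hz
  obtain ⟨c, hc⟩ := (hf.isSolution hz).exists_eq_mul hw0 (hg.isSolution_left hz)
    (sub_eq_zero.1 hW) ⟨1 - m, hm⟩
  obtain ⟨N, hN⟩ := hf.exists_ne_zero z hz
  refine ⟨N, hN, fun h => hN ?_⟩
  have := hc N
  rw [h, mul_zero] at this
  exact this

/-- An eigenvector is a nonzero multiple of both f and g, which forces W = 0. Conversely, when W = 0
the numerator of Green's function solves the homogeneous equation, and its N-th entry is f_N g_N ≠
0. -/
theorem exists_eigenvector_iff (hw0 : ∀ n, w n ≠ 0) (hC : ∀ n, ‖w n‖ ≤ C)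
    (hT : ∀ x : L2Z, (T x : ℤ → ℂ) = jacobiMatrix w lam x) (hf : IsDecayingSolution w lam f)
    (hg : IsDecayingSolution (fun k => w (-k)) (reflect lam) fun n => g (1 - n)) {z : ℂ}
    (hz : z ≠ 0) : (∃ x : L2Z, x ≠ 0 ∧ T x = z • x) ↔ wronskianZero f g z = 0 := by
  constructor
  · rintro ⟨x, h0, hx⟩
    have sx := (isSolution_iff hT).2 (sub_eq_zero.2 hx)
    obtain ⟨c, hc⟩ := eq_mul_right hw0 hC hf hz sx
    obtain ⟨d, hd⟩ := eq_mul_left hw0 hC hg hz sx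
    have hd0 : d ≠ 0 := by
      rintro rfl
      exact h0 (lp.ext (by funext n; rw [hd, zero_mul]; rfl))
    have hc0 : c ≠ 0 := by
      rintro rfl
      exact h0 (lp.ext (by funext n; rw [hc, zero_mul]; rfl))
    have h1 : d * c * wronskianZero f g z = 0 := by
      have e0 := (hc 0).symm.trans (hd 0)
      have e1 := (hc 1).symm.trans (hd 1)
      unfold wronskianZero
      linear_combination d * g 1 z * e0 - d * g 0 z * e1
    exact (mul_eq_zero.1 h1).resolve_left (mul_ne_zero hd0 hc0)
  · intro hW
    obtain ⟨N, hN, hN'⟩ := exists_ne_zero_of_wronskianZero hw0 hf hg hz hW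
    obtain ⟨U, -, hU⟩ := exists_green hT hf hg N
    refine ⟨U z, fun h => ?_, ?_⟩
    · have := (hU z hz).1 N
      rw [h, if_pos le_rfl] at this
      exact mul_ne_zero hN' hN this.symm
    · have := (hU z hz).2
      rw [hW, mul_zero, neg_zero, zero_smul] at this
      exact sub_eq_zero.1 this

theorem analyticAt_of_differentiableOn {E : Type*} [NormedAddCommGroup E] [NormedSpace ℂ E]
    [CompleteSpace E] {h : ℂ → E} (hd : DifferentiableOn ℂ h {0}ᶜ) {z : ℂ} (hz : z ≠ 0) :
    AnalyticAt ℂ h z :=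
  hd.analyticAt (isOpen_compl_singleton.mem_nhds hz)

/-- The Wronskian does not vanish identically near any point. -/
theorem analyticOrderAt_wronskianZero_ne_top (hw0 : ∀ n, w n ≠ 0) (hC : ∀ n, ‖w n‖ ≤ C)
    (hT : ∀ x : L2Z, (T x : ℤ → ℂ) = jacobiMatrix w lam x) (hf : IsDecayingSolution w lam f)
    (hg : IsDecayingSolution (fun k => w (-k)) (reflect lam) fun n => g (1 - n)) {z : ℂ}
    (hz : z ≠ 0) : analyticOrderAt (wronskianZero f g) z ≠ ⊤ := by
  have hd := differentiableOn_wronskianZero hf hg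
  -- A point of modulus greater than ‖T‖ is not an eigenvalue, so W is nonzero there; the identity
  -- theorem on the connected set ℂ ∖ {0} then excludes infinite order everywhere.
  set ξ : ℂ := ((‖T‖ + 1 : ℝ) : ℂ) with hξ
  have hnorm : ‖ξ‖ = ‖T‖ + 1 := by
    rw [hξ, Complex.norm_real, Real.norm_of_nonneg (by positivity)]
  have hξ0 : ξ ≠ 0 := norm_pos_iff.1 (by rw [hnorm]; positivity)
  have hne : wronskianZero f g ξ ≠ 0 := by
    intro h
    obtain ⟨x, h0, hx⟩ := (exists_eigenvector_iff hw0 hC hT hf hg hξ0).2 h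
    have h1 := T.le_opNorm x
    rw [hx, norm_smul, hnorm] at h1
    have h2 : 0 < ‖x‖ := norm_pos_iff.2 h0
    nlinarith
  have hconn : IsPreconnected ({0}ᶜ : Set ℂ) :=
    (isConnected_compl_singleton_of_one_lt_rank
      (by simp [Complex.rank_real_complex]) 0).isPreconnected
  have han : AnalyticOnNhd ℂ (wronskianZero f g) {0}ᶜ := fun x hx =>
    analyticAt_of_differentiableOn hd hx
  refine han.analyticOrderAt_ne_top_of_isPreconnected hconn (x := ξ) hξ0 hz ?_
  rw [(han ξ hξ0).analyticOrderAt_eq_zero.2 hne]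
  exact ENat.zero_ne_top

/-- The differences `f_n g_N - f_N g_n` are divisible by the Wronskian. -/
theorem exists_factor (hw0 : ∀ n, w n ≠ 0) (hf : IsDecayingSolution w lam f)
    (hg : IsDecayingSolution (fun k => w (-k)) (reflect lam) fun n => g (1 - n)) (N n : ℤ)
    (hn : n ≤ N) : ∃ q : ℂ → ℂ, DifferentiableOn ℂ q {0}ᶜ ∧ ∀ ξ ≠ 0,
      f n ξ * g N ξ - f N ξ * g n ξ = q ξ * wronskianZero f g ξ := by
  have key : ∀ j : ℕ, (∃ q : ℂ → ℂ, DifferentiableOn ℂ q {0}ᶜ ∧ ∀ ξ ≠ 0,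
      f (N - j) ξ * g N ξ - f N ξ * g (N - j) ξ = q ξ * wronskianZero f g ξ) ∧
      ∃ q : ℂ → ℂ, DifferentiableOn ℂ q {0}ᶜ ∧ ∀ ξ ≠ 0,
      f (N - j + 1) ξ * g N ξ - f N ξ * g (N - j + 1) ξ = q ξ * wronskianZero f g ξ := by
    intro j
    induction j with
    | zero =>
      refine ⟨⟨fun _ => 0, differentiableOn_const 0, fun ξ hξ => by simp⟩,
        fun _ => -(w 0 / w N), differentiableOn_const _, fun ξ hξ => ?_⟩
      have h := (hf.isSolution hξ).wronskian_eq (hg.isSolution_left hξ) N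
      have h0 := hw0 N
      simp only [Nat.cast_zero, sub_zero, wronskianZero]
      field_simp
      linear_combination -h
    | succ j ih =>
      obtain ⟨⟨q₀, hd₀, he₀⟩, q₁, hd₁, he₁⟩ := ih
      have a1 : N - ((j + 1 : ℕ) : ℤ) = N - j - 1 := by push_cast; ring
      have a2 : N - (j : ℤ) - 1 + 1 = N - j := by ring
      rw [a1, a2]
      refine ⟨⟨fun ξ => (w (N - j - 1))⁻¹ * ((ξ - lam (N - j)) * q₀ ξ - w (N - j) * q₁ ξ),
        by fun_prop, fun ξ hξ => ?_⟩, q₀, hd₀, he₀⟩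
      have r1 := hf.isSolution hξ (N - j)
      have r2 := hg.isSolution_left hξ (N - j)
      have h0 := hw0 (N - j - 1)
      simp only at r1 r2 ⊢
      rw [mul_assoc, eq_comm, inv_mul_eq_iff_eq_mul₀ h0]
      linear_combination -g N ξ * r1 + f N ξ * r2 - (ξ - lam (N - j)) * he₀ ξ hξ +
        w (N - j) * he₁ ξ hξ
  have := (key (N - n).toNat).1
  rwa [show N - ((N - n).toNat : ℤ) = n by omega] at this

end Spectral

/-! ### Multiplicities and generalized eigenvectors -/

section Multiplicity

variable {w lam : ℤ → ℂ} {f g : ℤ → ℂ → ℂ} {T : L2Z →L[ℂ] L2Z} {C : ℝ}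

/-- The derivatives of `f` form a Jordan chain, the last vector of which is not in the range of
`J - z`. -/
theorem exists_jordan_chain (hw0 : ∀ n, w n ≠ 0) (hC : ∀ n, ‖w n‖ ≤ C)
    (hT : ∀ x : L2Z, (T x : ℤ → ℂ) = jacobiMatrix w lam x) (hf : IsDecayingSolution w lam f)
    (hg : IsDecayingSolution (fun k => w (-k)) (reflect lam) fun n => g (1 - n)) {z : ℂ}
    (hz : z ≠ 0) {m : ℕ} (hm : 0 < m) (hW : analyticOrderAt (wronskianZero f g) z = m) :
    ∃ D : ℕ → L2Z, (∀ j < m, ∀ n, D j n = iteratedDeriv j (f n) z) ∧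
      (T - z • 1) (D 0) = 0 ∧ D 0 ≠ 0 ∧
      (∀ j, j + 1 < m → (T - z • 1) (D (j + 1)) = ((j : ℂ) + 1) • D j) ∧
      ∀ y, (T - z • 1) y ≠ D (m - 1) := by
  have hWan : AnalyticAt ℂ (wronskianZero f g) z :=
    analyticAt_of_differentiableOn (differentiableOn_wronskianZero hf hg) hz
  have hWz : wronskianZero f g z = 0 :=
    apply_eq_zero_of_analyticOrderAt_ne_zero (by rw [hW]; exact_mod_cast hm.ne')
  obtain ⟨N, hfN, hgN⟩ := exists_ne_zero_of_wronskianZero hw0 hf hg hz hWz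
  obtain ⟨U, hUd, hU⟩ := exists_green hT hf hg N
  have hgan : AnalyticAt ℂ (g N) z :=
    analyticAt_of_differentiableOn (hg.differentiableOn_left N) hz
  have hginv : AnalyticAt ℂ (fun ξ => (g N ξ)⁻¹) z := hgan.inv hgN
  -- Division by g_N makes the entries with index at least N equal to those of f; the equation
  -- becomes (T - ξ)u(ξ) = B(ξ)e_N, with B vanishing at z to the same order as W.
  set u : ℂ → L2Z := fun ξ => (g N ξ)⁻¹ • U ξ with hu_def
  have hu : AnalyticAt ℂ u z := hginv.smul (analyticAt_of_differentiableOn hUd hz)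
  have hnear : ∀ᶠ ξ in 𝓝 z, ξ ≠ 0 ∧ g N ξ ≠ 0 :=
    (eventually_ne_nhds hz).and (hgan.continuousAt.eventually_ne hgN)
  have huapp : ∀ ξ n, u ξ n = (g N ξ)⁻¹ * U ξ n := fun ξ n => rfl
  set S : L2Z →L[ℂ] L2Z := T - z • 1 with hS_def
  have hSapp : ∀ x, S x = T x - z • x := fun x => rfl
  set B : ℂ → ℂ := fun ξ => wronskianZero f g ξ * (-w 0 * (g N ξ)⁻¹) with hB_def
  have hb : AnalyticAt ℂ (fun ξ => -w 0 * (g N ξ)⁻¹) z := analyticAt_const.mul hginv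
  have hBan : AnalyticAt ℂ B z := hWan.mul hb
  have hBord : analyticOrderAt B z = m := by
    have h1 := analyticOrderAt_mul hWan hb
    rw [hW, hb.analyticOrderAt_eq_zero.2
      (mul_ne_zero (neg_ne_zero.2 (hw0 0)) (inv_ne_zero hgN)), add_zero] at h1
    exact h1
  have hBder := (analyticOrderAt_eq_nat_iff_iteratedDeriv_eq_zero hBan).1 hBord
  -- the entries
  have hentry : ∀ j < m, ∀ n, iteratedDeriv j u z n = iteratedDeriv j (f n) z := by
    intro j hj n
    have h1 : iteratedDeriv j u z n = iteratedDeriv j (fun ξ => u ξ n) z :=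
      (iteratedDeriv_clm_apply (lp.evalCLM ℂ (fun _ : ℤ => ℂ) 2 n) hu j).symm
    rw [h1]
    rcases le_or_gt N n with hn | hn
    · refine EventuallyEq.iteratedDeriv_eq j ?_
      filter_upwards [hnear] with ξ hξ
      rw [huapp, (hU ξ hξ.1).1, if_pos hn, inv_mul_cancel_left₀ hξ.2]
    -- Below N the entries of f and u differ by an analytic multiple of W, hence their derivatives
    -- of order less than m agree at z.
    · obtain ⟨q, hqd, hq⟩ := exists_factor hw0 hf hg N n hn.le
      have hqan : AnalyticAt ℂ (fun ξ => q ξ * (g N ξ)⁻¹) z :=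
        (analyticAt_of_differentiableOn hqd hz).mul hginv
      have hfan : AnalyticAt ℂ (f n) z :=
        analyticAt_of_differentiableOn (hf.differentiableOn n) hz
      have huan : AnalyticAt ℂ (fun ξ => u ξ n) z :=
        (lp.evalCLM ℂ (fun _ : ℤ => ℂ) 2 n).analyticAt _ |>.comp hu
      have h2 : (m : ℕ∞) ≤ analyticOrderAt
          (wronskianZero f g * fun ξ => q ξ * (g N ξ)⁻¹) z := by
        rw [analyticOrderAt_mul hWan hqan, hW]
        exact le_self_add
      have h3 := (natCast_le_analyticOrderAt_iff_iteratedDeriv_eq_zero (hWan.mul hqan)).1 h2 j hj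
      have h4 : (f n - fun ξ => u ξ n) =ᶠ[𝓝 z]
          (wronskianZero f g * fun ξ => q ξ * (g N ξ)⁻¹) := by
        filter_upwards [hnear] with ξ hξ
        simp only [Pi.sub_apply, Pi.mul_apply]
        rw [huapp, (hU ξ hξ.1).1, if_neg (not_le.2 hn)]
        have e := hq ξ hξ.1
        have h0 := hξ.2
        field_simp
        linear_combination e
      have h5 : iteratedDeriv j (f n - fun ξ => u ξ n) z = 0 := (h4.iteratedDeriv_eq j).trans h3
      rw [iteratedDeriv_sub hfan.contDiffAt huan.contDiffAt] at h5
      exact (sub_eq_zero.1 h5).symm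
  -- the differentiated equation
  have hSu : (fun ξ => S (u ξ)) =ᶠ[𝓝 z]
      ((fun ξ => (ξ - z) • u ξ) + fun ξ => B ξ • (lp.single 2 N (1 : ℂ) : L2Z)) := by
    filter_upwards [hnear] with ξ hξ
    have e := (hU ξ hξ.1).2
    simp only [Pi.add_apply]
    have e2 : B ξ • (lp.single 2 N (1 : ℂ) : L2Z) =
        (g N ξ)⁻¹ • (-(w 0 * wronskianZero f g ξ) • (lp.single 2 N (1 : ℂ) : L2Z)) := by
      rw [smul_smul]
      congr 1
      simp only [hB_def]
      ring
    rw [e2, ← e, hSapp, hu_def]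
    simp only [map_smul]
    module
  have hsub : AnalyticAt ℂ (fun ξ => (ξ - z) • u ξ) z :=
    (analyticAt_id.sub analyticAt_const).smul hu
  have hSD : ∀ j, S (iteratedDeriv j u z) = iteratedDeriv j (fun ξ => (ξ - z) • u ξ) z +
      iteratedDeriv j B z • (lp.single 2 N (1 : ℂ) : L2Z) := by
    intro j
    have hBe : AnalyticAt ℂ (fun ξ => B ξ • (lp.single 2 N (1 : ℂ) : L2Z)) z :=
      hBan.smul analyticAt_const
    rw [← iteratedDeriv_clm_apply S hu j, hSu.iteratedDeriv_eq j,
      iteratedDeriv_add hsub.contDiffAt hBe.contDiffAt,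
      iteratedDeriv_smul_const hBan.contDiffAt]
  have hSD0 : S (iteratedDeriv 0 u z) = 0 := by
    rw [hSD, hBder.1 0 hm]
    simp
  have hSDs : ∀ j, S (iteratedDeriv (j + 1) u z) = ((j : ℂ) + 1) • iteratedDeriv j u z +
      iteratedDeriv (j + 1) B z • (lp.single 2 N (1 : ℂ) : L2Z) := by
    intro j
    have e := (iteratedDeriv_sub_smul hu j).self_of_nhds
    simp only [sub_self, zero_smul, zero_add] at e
    rw [hSD, e]
  have hD0 : iteratedDeriv 0 u z N = f N z := by
    rw [hentry 0 hm N, iteratedDeriv_zero]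
  refine ⟨fun j => iteratedDeriv j u z, hentry, hSD0, fun h => hfN ?_, fun j hj => ?_,
    fun y hy => hfN ?_⟩
  · rw [← hD0]
    simp only at h
    rw [h]
    rfl
  · rw [hSDs, hBder.1 (j + 1) hj, zero_smul, add_zero]
  · obtain ⟨q, rfl⟩ : ∃ q, m = q + 1 := ⟨m - 1, by omega⟩
    simp only [Nat.add_sub_cancel] at hy
    have h1 := hSDs q
    set β := iteratedDeriv (q + 1) B z with hβ
    -- Differentiating m = q + 1 times gives S u^(m) = m u^(m-1) + βe_N with β ≠ 0. If u^(m-1) = Sy,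
    -- then e_N would also be in the range of S, contrary to f_N(z) ≠ 0.
    have h2 : S (β⁻¹ • (iteratedDeriv (q + 1) u z - ((q : ℂ) + 1) • y)) =
        (lp.single 2 N (1 : ℂ) : L2Z) := by
      rw [map_smul, map_sub, map_smul, hy, h1, add_sub_cancel_left, inv_smul_smul₀ hBder.2]
    rw [← hD0]
    refine apply_eq_zero_of_range hC ((isSolution_iff hT).2 hSD0)
      (y := β⁻¹ • (iteratedDeriv (q + 1) u z - ((q : ℂ) + 1) • y)) fun n => ?_
    rw [← jacobi_apply hT, ← hSapp, h2, lp_single_apply]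

/-- Off the spectrum, Green's function has at most a pole of order `m` at a zero of order `m` of the
Wronskian. -/
theorem circleIntegral_pow_smul_resolvent {A : L2Z →ₗ.[ℂ] L2Z} (hA : IsTotal A T)
    (hw0 : ∀ n, w n ≠ 0)
    (hT : ∀ x : L2Z, (T x : ℤ → ℂ) = jacobiMatrix w lam x) (hf : IsDecayingSolution w lam f)
    (hg : IsDecayingSolution (fun k => w (-k)) (reflect lam) fun n => g (1 - n)) {z : ℂ}
    (hz : z ≠ 0) {m : ℕ} (hW : analyticOrderAt (wronskianZero f g) z = m) {r : ℝ}
    (hr : IsIsolatingRadius A z r) (hr0 : Metric.closedBall z r ⊆ {0}ᶜ)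
    (hrW : ∀ ξ ∈ Metric.closedBall z r, ξ ≠ z → wronskianZero f g ξ ≠ 0) (k : ℤ) :
    (∮ ξ in C(z, r), (ξ - z) ^ (m : ℤ) • resolvent A ξ (lp.single 2 k (1 : ℂ))) = 0 := by
  have hWd := differentiableOn_wronskianZero hf hg
  have hWan : AnalyticAt ℂ (wronskianZero f g) z := analyticAt_of_differentiableOn hWd hz
  obtain ⟨h, hh, hhz, hWh⟩ := hWan.analyticOrderAt_eq_natCast.1 hW
  obtain ⟨U, hUd, hU⟩ := exists_green hT hf hg k
  classical
  -- This is (ξ - z)^m / W with its removable singularity filled in: near z, W = (ξ - z)^m h with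
  -- h(z) ≠ 0. The integrand thus extends analytically to the whole disc.
  set c : ℂ → ℂ := fun ξ => if ξ = z then (h z)⁻¹ else (ξ - z) ^ m * (wronskianZero f g ξ)⁻¹
    with hc_def
  have hcd : ∀ ξ ∈ Metric.closedBall z r, DifferentiableAt ℂ c ξ := by
    intro ξ hξ
    by_cases hξz : ξ = z
    · subst hξz
      refine (hh.inv hhz).differentiableAt.congr_of_eventuallyEq ?_
      filter_upwards [hWh, hh.continuousAt.eventually_ne hhz] with η e1 e2
      simp only [hc_def]
      split_ifs with hη
      · rw [hη, Pi.inv_apply]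
      · have : (η - ξ) ^ m ≠ 0 := pow_ne_zero _ (sub_ne_zero.2 hη)
        rw [e1, smul_eq_mul, mul_inv, mul_inv_cancel_left₀ this, Pi.inv_apply]
    · have hd : DifferentiableAt ℂ (fun ξ => (ξ - z) ^ m * (wronskianZero f g ξ)⁻¹) ξ :=
        DifferentiableAt.mul (by fun_prop)
          ((hWd.differentiableAt (isOpen_compl_singleton.mem_nhds (hr0 hξ))).inv (hrW ξ hξ hξz))
      refine hd.congr_of_eventuallyEq ?_
      filter_upwards [eventually_ne_nhds hξz] with η hη
      simp only [hc_def, if_neg hη]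
  have hVd : ∀ ξ ∈ Metric.closedBall z r, DifferentiableAt ℂ (fun ξ => c ξ • U ξ) ξ :=
    fun ξ hξ => (hcd ξ hξ).smul (hUd.differentiableAt (isOpen_compl_singleton.mem_nhds (hr0 hξ)))
  have hzero : (∮ ξ in C(z, r), c ξ • U ξ) = 0 :=
    Complex.circleIntegral_eq_zero_of_differentiable_on_off_countable hr.1.le
      Set.countable_empty (fun ξ hξ => (hVd ξ hξ).continuousAt.continuousWithinAt)
      fun ξ hξ => hVd ξ (Metric.ball_subset_closedBall hξ.1)
  have hcongr : (∮ ξ in C(z, r), (ξ - z) ^ (m : ℤ) • resolvent A ξ (lp.single 2 k (1 : ℂ))) =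
      ∮ ξ in C(z, r), (-(w 0)⁻¹) • (c ξ • U ξ) := by
    refine circleIntegral.integral_congr hr.1.le fun ξ hξ => ?_
    have hξ' := Metric.sphere_subset_closedBall hξ
    have hne : ξ ≠ z := sub_ne_zero.1 (hr.sub_ne_zero hξ)
    have h0 := hrW ξ hξ' hne
    have e := (hU ξ (hr0 hξ')).2
    have e2 := hA.resolvent_apply (hr.sphere_subset hξ) (U ξ)
    rw [e, map_smul] at e2
    simp only [hc_def, if_neg hne]
    rw [← e2, smul_smul, smul_smul, zpow_natCast]
    congr 1
    have h1 := hw0 0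
    field_simp
  rw [hcongr, circleIntegral.integral_smul, hzero, smul_zero]

end Multiplicity

/-! ### Spectrum, isolated eigenvalues and the rank of the Riesz projection -/

section Spectrum

variable {w lam : ℤ → ℂ} {f g : ℤ → ℂ → ℂ} {T : L2Z →L[ℂ] L2Z} {A : L2Z →ₗ.[ℂ] L2Z} {C : ℝ}

theorem pow_apply_eq_toLinearMap_pow_apply (S : L2Z →L[ℂ] L2Z) (n : ℕ) (x : L2Z) :
    (S ^ n) x = ((S : L2Z →ₗ[ℂ] L2Z) ^ n) x := by
  induction n generalizing x with
  | zero => simp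
  | succ n ih =>
    rw [pow_succ, pow_succ, mul_apply_eq_comp, Module.End.mul_apply, ih]
    rfl

theorem spec_eq_pointSpec_union (hA : IsTotal A T) (hTc : IsCompactOperator T) :
    spec A = pointSpec A ∪ {0} := by
  ext z
  by_cases hz : z = 0
  · subst hz
    simp [zero_mem_spec hA hTc]
  · simp [mem_spec_iff_mem_pointSpec hA hTc hz, hz]

theorem mem_pointSpec_iff (hA : IsTotal A T) (hw0 : ∀ n, w n ≠ 0) (hC : ∀ n, ‖w n‖ ≤ C)
    (hT : ∀ x : L2Z, (T x : ℤ → ℂ) = jacobiMatrix w lam x) (hf : IsDecayingSolution w lam f)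
    (hg : IsDecayingSolution (fun k => w (-k)) (reflect lam) fun n => g (1 - n)) {z : ℂ}
    (hz : z ≠ 0) : z ∈ pointSpec A ↔ wronskianZero f g z = 0 :=
  hA.mem_pointSpec.trans (exists_eigenvector_iff hw0 hC hT hf hg hz)

theorem mem_resolventSet_iff (hA : IsTotal A T) (hTc : IsCompactOperator T)
    (hw0 : ∀ n, w n ≠ 0) (hC : ∀ n, ‖w n‖ ≤ C)
    (hT : ∀ x : L2Z, (T x : ℤ → ℂ) = jacobiMatrix w lam x) (hf : IsDecayingSolution w lam f)
    (hg : IsDecayingSolution (fun k => w (-k)) (reflect lam) fun n => g (1 - n)) {z : ℂ} :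
    z ∈ resolventSet A ↔ z ≠ 0 ∧ wronskianZero f g z ≠ 0 := by
  have e : z ∈ resolventSet A ↔ z ∉ spec A := by
    rw [spec, Set.notMem_compl_iff]
  rw [e]
  by_cases hz : z = 0
  · subst hz
    simp [zero_mem_spec hA hTc]
  · rw [mem_spec_iff_mem_pointSpec hA hTc hz, mem_pointSpec_iff hA hw0 hC hT hf hg hz]
    simp [hz]

/-- The nonzero eigenvalues are isolated points of the spectrum. -/
theorem exists_isIsolatingRadius (hA : IsTotal A T) (hTc : IsCompactOperator T)
    (hw0 : ∀ n, w n ≠ 0) (hC : ∀ n, ‖w n‖ ≤ C)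
    (hT : ∀ x : L2Z, (T x : ℤ → ℂ) = jacobiMatrix w lam x) (hf : IsDecayingSolution w lam f)
    (hg : IsDecayingSolution (fun k => w (-k)) (reflect lam) fun n => g (1 - n)) {z : ℂ}
    (hz : z ≠ 0) : ∃ r, IsIsolatingRadius A z r := by
  have hWan : AnalyticAt ℂ (wronskianZero f g) z :=
    analyticAt_of_differentiableOn (differentiableOn_wronskianZero hf hg) hz
  have h1 : ∀ᶠ ξ in 𝓝[≠] z, wronskianZero f g ξ ≠ 0 :=
    hWan.eventually_eq_zero_or_eventually_ne_zero.resolve_left fun h =>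
      analyticOrderAt_wronskianZero_ne_top hw0 hC hT hf hg hz (analyticOrderAt_eq_top.2 h)
  rw [eventually_nhdsWithin_iff] at h1
  -- The disc must avoid 0 as well as the other zeros of W, since 0 belongs to the spectrum.
  obtain ⟨r, hr, h⟩ := Metric.nhds_basis_closedBall.eventually_iff.1
    (h1.and (eventually_ne_nhds hz))
  exact ⟨r, hr, fun ξ hξ =>
    (mem_resolventSet_iff hA hTc hw0 hC hT hf hg).2 ⟨(h hξ.1).2, (h hξ.1).1 hξ.2⟩⟩

/-- The algebraic multiplicity of a nonzero eigenvalue is its order as a zero of the Wronskian, and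
the derivatives of `f` form a basis of the space of generalized eigenvectors. -/
theorem exists_basis_generalizedEigenvectors (hA : IsTotal A T) (hTc : IsCompactOperator T)
    (hw0 : ∀ n, w n ≠ 0) (hC : ∀ n, ‖w n‖ ≤ C)
    (hT : ∀ x : L2Z, (T x : ℤ → ℂ) = jacobiMatrix w lam x) (hf : IsDecayingSolution w lam f)
    (hg : IsDecayingSolution (fun k => w (-k)) (reflect lam) fun n => g (1 - n)) {z : ℂ}
    (hzA : z ∈ pointSpec A) (hz : z ≠ 0) :
    ∃ ν : ℕ,
      (∀ r : ℝ, IsIsolatingRadius A z r →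
        Module.rank ℂ (rieszProjection A z r).range = (ν : Cardinal)) ∧
      analyticOrderAt (wronskianZero f g) z = (ν : ℕ∞) ∧
      ∃ v : Fin ν → L2Z,
        (∀ (j : Fin ν) (n : ℤ), (v j : ℤ → ℂ) n = iteratedDeriv (j : ℕ) (f n) z) ∧
        (Submodule.span ℂ (Set.range v) : Set L2Z) = generalizedEigenvectors A z := by
  obtain ⟨m, hm⟩ := ENat.ne_top_iff_exists.1
    (analyticOrderAt_wronskianZero_ne_top hw0 hC hT hf hg hz)
  have hWan : AnalyticAt ℂ (wronskianZero f g) z :=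
    analyticAt_of_differentiableOn (differentiableOn_wronskianZero hf hg) hz
  have hWz := (mem_pointSpec_iff hA hw0 hC hT hf hg hz).1 hzA
  have hm0 : 0 < m := by
    have := hWan.analyticOrderAt_ne_zero.2 hWz
    rw [← hm] at this
    exact Nat.pos_of_ne_zero fun h => this (by rw [h]; rfl)
  obtain ⟨D, hentry, hD0, hDne, hchain, hlast⟩ :=
    exists_jordan_chain hw0 hC hT hf hg hz hm0 hm.symm
  set S : L2Z →ₗ[ℂ] L2Z := ((T - z • 1 : L2Z →L[ℂ] L2Z) : L2Z →ₗ[ℂ] L2Z) with hS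
  have hker : ∀ y, S y = 0 → ∃ c : ℂ, y = c • D 0 := by
    intro y hy
    obtain ⟨c, hc⟩ := eq_mul_right hw0 hC hf hz ((isSolution_iff hT).2 hy)
    refine ⟨c, lp.ext (funext fun n => ?_)⟩
    rw [hc n, lp.coeFn_smul, Pi.smul_apply, hentry 0 hm0 n, iteratedDeriv_zero, smul_eq_mul]
  have hkp : ∀ n v, v ∈ kerPow A z n ↔ (S ^ n) v = 0 := fun n v => by
    rw [hA.mem_kerPow, pow_apply_eq_toLinearMap_pow_apply]
  have hle : ∀ n, kerPow A z n ≤ Submodule.span ℂ (Set.range fun j : Fin m => D j) :=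
    fun n y hy => ker_pow_le_span_chain (S := S) hm0 hchain hker hlast n y ((hkp n y).1 hy)
  have hge : Submodule.span ℂ (Set.range fun j : Fin m => D j) ≤ kerPow A z m := by
    rw [Submodule.span_le]
    rintro _ ⟨j, rfl⟩
    exact (hkp m _).2 (Module.End.pow_map_zero_of_le j.2
      (chain_mem_ker_pow (S := S) hD0 hchain j.2))
  refine ⟨m, fun r hr => ?_, hm.symm, fun j => D j, fun j n => hentry j j.2 n, ?_⟩
  · have hreg : ∀ ξ ∈ Metric.closedBall z r, ξ ≠ z → ξ ≠ 0 ∧ wronskianZero f g ξ ≠ 0 :=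
      fun ξ hξ hne => (mem_resolventSet_iff hA hTc hw0 hC hT hf hg).1 (hr.2 ⟨hξ, hne⟩)
    -- An isolating disc about z ≠ 0 cannot contain 0, because 0 is a spectral point.
    have hr0 : Metric.closedBall z r ⊆ {0}ᶜ := fun ξ hξ => by
      by_cases h : ξ = z
      · exact h ▸ hz
      · exact (hreg ξ hξ h).1
    have h1 := hA.range_rieszProjection hr (m := m) topologicalClosure_finiteSequences
      fun k => circleIntegral_pow_smul_resolvent hA hw0 hT hf hg hz hm.symm hr hr0
        (fun ξ hξ h => (hreg ξ hξ h).2) k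
    -- The range of the projection is Ker (A - z)^m, which `hle` and `hge` identify with the span of
    -- the m independent chain vectors.
    rw [SetLike.coe_injective (h1.trans (congrArg _ (le_antisymm (hle m) hge)))]
    have hli := linearIndependent_chain (S := S) (m := m) hD0 hDne hchain
    rw [rank_span hli, Cardinal.mk_range_eq _ hli.injective, Cardinal.mk_fin]
  · ext v
    exact ⟨fun hv => ⟨m, hge hv⟩, fun ⟨n, hn⟩ => hle n hn⟩

end Spectrum

end DoublyInfiniteJacobi

end


open DoublyInfiniteJacobi in
theorem mainTheorem7 (w lam γ : ℤ → ℂ) (p : ℕ) (hp : 1 ≤ p)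
    (hw0 : ∀ n : ℤ, w n ≠ 0)
    (hw : Memℓp w 2)
    (hlam : Memℓp lam (p : ℝ≥0∞))
    (hγ : ∀ n : ℤ, γ n * γ (n + 1) = w n) :
    -- the functions involved are well defined, and the regularized ones are analytic off the origin
    (∀ z ∈ DoublyInfiniteJacobi.regularSet lam,
      DoublyInfiniteJacobi.DomF fun n => γ n ^ 2 / (z - lam n)) ∧
    (∀ z : ℂ, z ≠ 0 →
      Multipliable (fun n : ℕ => DoublyInfiniteJacobi.elemFactor p (lam ((n : ℤ) + 1) / z)) ∧
      Multipliable (fun n : ℕ => DoublyInfiniteJacobi.elemFactor p (lam (-(n : ℤ)) / z))) ∧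
    AnalyticOnNhd ℂ (DoublyInfiniteJacobi.regCharFn lam γ p) {0}ᶜ ∧
    (∀ n : ℤ, AnalyticOnNhd ℂ (DoublyInfiniteJacobi.regSolF w lam γ p n) {0}ᶜ) ∧
    (∀ z ∈ DoublyInfiniteJacobi.regularSet lam,
      DoublyInfiniteJacobi.regCharFn lam γ p z =
        DoublyInfiniteJacobi.Phi lam p z * DoublyInfiniteJacobi.charFn lam γ z ∧
      ∀ n : ℤ, DoublyInfiniteJacobi.regSolF w lam γ p n z =
        DoublyInfiniteJacobi.PhiPlus lam p z * DoublyInfiniteJacobi.solF w lam γ n z) ∧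
    -- the Jacobi matrix determines a unique Jacobi operator `J`
    (DoublyInfiniteJacobi.jacobiZero w lam).IsClosable ∧
    ∃ J : DoublyInfiniteJacobi.L2Z →ₗ.[ℂ] DoublyInfiniteJacobi.L2Z,
      DoublyInfiniteJacobi.jacobiMin w lam = J ∧
      DoublyInfiniteJacobi.jacobiMax w lam = J ∧
      -- the spectrum
      DoublyInfiniteJacobi.spec J = DoublyInfiniteJacobi.pointSpec J ∪ {0} ∧
      DoublyInfiniteJacobi.pointSpec J ∪ {0} =
        {z : ℂ | z ≠ 0 ∧ DoublyInfiniteJacobi.regCharFn lam γ p z = 0} ∪ {0} ∧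
      -- algebraic multiplicities and generalized eigenvectors
      ∀ z ∈ DoublyInfiniteJacobi.pointSpec J, z ≠ 0 →
        (∃ r : ℝ, DoublyInfiniteJacobi.IsIsolatingRadius J z r) ∧
        ∃ ν : ℕ,
          (∀ r : ℝ, DoublyInfiniteJacobi.IsIsolatingRadius J z r →
            Module.rank ℂ (DoublyInfiniteJacobi.rieszProjection J z r).range = (ν : Cardinal)) ∧
          analyticOrderAt (DoublyInfiniteJacobi.regCharFn lam γ p) z = (ν : ℕ∞) ∧
          ∃ v : Fin ν → DoublyInfiniteJacobi.L2Z,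
            (∀ (j : Fin ν) (n : ℤ), (v j : ℤ → ℂ) n =
              iteratedDeriv (j : ℕ) (DoublyInfiniteJacobi.regSolF w lam γ p n) z) ∧
            (Submodule.span ℂ (Set.range v) : Set DoublyInfiniteJacobi.L2Z) =
              DoublyInfiniteJacobi.generalizedEigenvectors J z := by
  have hsl := summable_norm_pow hp hlam
  have htl := tendsto_zero_of_summable_norm_pow hsl
  have htw := tendsto_zero_of_summable_norm_pow (summable_norm_sq hw)
  obtain ⟨C, hC⟩ := exists_bound_of_tendsto_zero htw
  obtain ⟨T, hT, hTc⟩ := exists_jacobi_clm htw htl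
  have hA := isTotal_jacobiMax hT
  have hf := isDecayingSolution_regSolF hp hw0 hw hlam hγ
  have hg := isDecayingSolution_leftSol hp hw0 hw hlam hγ
  have hWe : ∀ z, z ≠ 0 → regCharFn lam γ p z =
      wronskianZero (regSolF w lam γ p) (leftSol w lam γ p) z :=
    fun z hz => regCharFn_eq_wronskian hp hw0 hw hlam hγ hz
  refine ⟨fun z hz => domF_charArg hw hγ hz, fun z _ => ⟨?_, ?_⟩, ?_, ?_, fun z hz => ⟨?_, ?_⟩,
    isClosable_jacobiZero hA, jacobiMax w lam, jacobiMin_eq_jacobiMax hA, rfl,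
    spec_eq_pointSpec_union hA hTc, ?_, fun z hzA hz => ⟨?_, ?_⟩⟩
  · exact multipliable_elemFactor hp
      (hsl.comp_injective (i := fun n : ℕ => (n : ℤ) + 1) fun a b h => by simpa using h) z
  · exact multipliable_elemFactor hp
      (hsl.comp_injective (i := fun n : ℕ => -(n : ℤ)) fun a b h => by simpa using h) z
  · exact ((differentiableOn_wronskian hp hw0 hw hlam hγ).congr fun z hz => hWe z hz).analyticOnNhd
      isOpen_compl_singleton
  · exact fun n => (hf.differentiableOn n).analyticOnNhd isOpen_compl_singleton
  · rw [regCharFn_eq_wronskian hp hw0 hw hlam hγ ((mem_regularSet htl).1 hz).1,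
      wronskian_eq hp hw0 hw hlam hγ hz]
  · exact fun n => regSolF_eq_of_mem_regularSet hp hw0 hw hlam hγ n hz
  · ext z
    by_cases hz : z = 0
    · simp [hz]
    · simp [hz, mem_pointSpec_iff hA hw0 hC hT hf hg hz, hWe z hz]
  · exact exists_isIsolatingRadius hA hTc hw0 hC hT hf hg hz
  -- The order at z depends only on values near z, where 0 is avoided and the regularized
  -- characteristic function is the Wronskian.
  · rw [analyticOrderAt_congr ((eventually_ne_nhds hz).mono hWe)]
    exact exists_basis_generalizedEigenvectors hA hTc hw0 hC hT hf hg hzA hz
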